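/- Let $0<q<1$, let $c_1,c_2\in\mathbb{C}^\times$ and $\lambda_1,\lambda_2\in\mathbb{N}=\{0,1,2,\dots\}$. Let $\mathcal{U}_q(\mathfrak{su}(3))$ be the unital associative algebra over $\mathbb{C}$ with generators $E_i,F_i,K_i^{\pm1}$ ($i=1,2$), where the $K_i^{\pm1}$ commute, $K_iK_i^{-1}=K_i^{-1}K_i=1$, $K_iE_j=q^{a_{ij}}E_jK_i$, $K_iF_j=q^{-a_{ij}}F_jK_i$ with $a_{ii}=2$, $a_{12}=a_{21}=-1$, $[E_i,F_j]=\delta_{ij}\frac{K_i-K_i^{-1}}{q-q^{-1}}$, and, for $i\ne j$, $X_i^2X_j-(q+q^{-1})X_iX_jX_i+X_jX_i^2=0$ for $X=E$ and $X=F$. Put $K=K_1K_2^{-1}$, $B_1=F_1-c_1E_2K_1^{-1}$, $B_2=F_2-c_2E_1K_2^{-1}$, $$C_1=B_1B_2-qB_2B_1-\frac{c_2K}{q-q^{-1}}+\frac{q+q^{-1}}{q-q^{-1}}c_1K^{-1},\qquad \hat F_3=F_1F_2\frac{qK_2-q^{-1}K_2^{-1}}{q-q^{-1}}-F_2F_1\frac{K_2-K_2^{-1}}{q-q^{-1}}.$$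 Let $V$ be an irreducible finite-dimensional $\mathcal{U}_q(\mathfrak{su}(3))$-module with a vector $v\neq0$ such that $E_iv=0$ and $K_iv=q^{\lambda_i}v$ for $i=1,2$. Fix $0\le i\le\lambda_1$, let $U_i\subset V$ be the span of the vectors $F_2^k\hat F_3^lF_1^{i+k}v$ with $0\le l\le\lambda_2$, $0\le k\le\lambda_1-i$, and let $\ker(B_1)|_{U_i}=\{w\in U_i: B_1w=0\}$. For $0\le n\le\lambda_2$ put $$u^i_n=\sum_{k=0}^{\lambda_1-i}\sum_{l=0}^{\lambda_2}\gamma^n_{k,l}\,F_2^k\hat F_3^lF_1^{k+i}v,$$ where $\gamma^n_{\lambda_1-i,l}=\delta_{n,l}$ and, for $0\le k\le\lambda_1-i-1$ and $0\le l\le\lambda_2$ (with $\gamma^n_{k+1,-1}=0$), $$a_k(l,k+i)\gamma^n_{k,l}+b_{k+1}(l-1,k+i+1)\gamma^n_{k+1,l-1}-c_1q^{l+2i+k+1-\lambda_1}\eta_{k+1}(l,k+i+1)\gamma^n_{k+1,l}=0,$$ with, writing $\langle t\rangle=q^t-q^{-t}$, $$a_k(l,m)=\frac{\langle\lambda_2+m+1-k-l\rangle}{\langle\lambda_2+m+1-l\rangle},\quad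 b_k(l,m)=\frac{\langle k\rangle}{\langle\lambda_2+m+1-l\rangle},\quad \eta_k(l,m)=\frac{\langle k\rangle\langle 1-k+\lambda_2-l+m\rangle}{\langle1\rangle^2}.$$ Write $(a;Q)_n=\prod_{j=0}^{n-1}(1-aQ^j)$ and $(a,b,\dots;Q)_n=(a;Q)_n(b;Q)_n\cdots$. For $0\le n,x\le N$ the dual $Q$-Krawtchouk polynomial, a polynomial of degree $n$ in $\lambda(x)=Q^{-x}+cQ^{x-N}$, is $$K_n(\lambda(x);c,N|Q)=\sum_{k=0}^{n}\frac{(Q^{-n},Q^{-x},cQ^{x-N};Q)_k}{(Q^{-N},Q;Q)_k}\,Q^k.$$ **(1)** The vectors $u^i_0,\dots,u^i_{\lambda_2}$ form a basis of $\ker(B_1)|_{U_i}$, on which $C_1$ acts tridiagonally: for $0\le n\le\lambda_2$, $$C_1u^i_n=A(n)u^i_{n+1}+(B(n)+D)u^i_n+C(n)u^i_{n-1},$$ where the term in $u^i_{n+1}$ is absent for $n=\lambda_2$ and the term in $u^i_{n-1}$ is absent for $n=0$, and $$A(n)=\frac{q^{\lambda_2+i-n}(1-q^2)(1-q^{2\lambda_1+2\lambda_2-2n})}{(1-q^{2\lambda_1+2\lambda_2-2n+2})(1-q^{2\lambda_2+2i-2n})},$$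 $$B(n)=-c_1\frac{q^{2n+i-\lambda_1-\lambda_2}(1-q^{2\lambda_2-2n+2i})}{1-q^2}+c_2\frac{q^{\lambda_1-\lambda_2+2n-i+1}(1-q^{-2n-2i})}{1-q^2},$$ $$C(n)=\frac{c_1c_2\,q^{3n-3\lambda_2-i-2}(1-q^{2n})(1-q^{2\lambda_2-2n+2})(1-q^{2\lambda_1+2\lambda_2-2n+4})(1-q^{2\lambda_2+2i+2-2n})}{(1-q^2)^3(1-q^{2\lambda_1+2\lambda_2+2-2n})},$$ $$D=-c_2\frac{q^{\lambda_1-\lambda_2-3i}}{q-q^{-1}}+c_1\frac{q^{\lambda_2-\lambda_1+3i}(q+q^{-1})}{q-q^{-1}}.$$ **(2)** For $x=0,\dots,\lambda_2$ let $$\psi^i_x=\sum_{l=0}^{\lambda_2}\frac{(-1)^l\,c_2^{-l}\,(1-q^2)^{2l}\,q^{-l(\lambda_1+3)+l(l-1)/2}\,(q^{-2\lambda_2-2\lambda_1};q^2)_l}{(q^2,\,q^{-2\lambda_2-2\lambda_1-2},\,q^{-2\lambda_2-2i};q^2)_l}\,K_l\bigl(\lambda(x);-c_1^{-1}c_2q^{2\lambda_1-2i+1},\lambda_2\,|\,q^2\bigr)\,u^i_l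 .$$ Then $\psi^i_x$ is a nonzero vector of $\ker(B_1)|_{U_i}$ and $C_1\psi^i_x=\eta_1\psi^i_x$, where $$\eta_1=\frac{c_1\kappa^{-1}q(1+q^{-2n-2})-c_2\kappa q^{2n}}{q-q^{-1}},\qquad \kappa=q^{\lambda_1-3i-\lambda_2},\quad n=x+i.$$ **(3)** If $c_2c_1^{-1}\ne -q^{2\lambda_1+2\lambda_2+1-k}$ for all $k\in\mathbb{N}$, then $\psi^i_0,\dots,\psi^i_{\lambda_2}$ is a basis of $\ker(B_1)|_{U_i}$. -/

import Mathlib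

open Finset

/-- Names of the generators `E_i`, `F_i`, `K_i`, `K_i⁻¹` of the quantised universal enveloping
algebra of `sl(3)`; the paper's indices `i = 1, 2` are `0, 1 : Fin 2` here. -/
inductive UqGen : Type
  | E (i : Fin 2)
  | F (i : Fin 2)
  | K (i : Fin 2)
  | Kinv (i : Fin 2)

/-- The Cartan matrix `a_{ij} = (α_i, α_j)` of `sl(3)`. -/
def cartanA2 (i j : Fin 2) : ℤ := if i = j then 2 else -1

/-- Inclusion of the generators into the free algebra. -/
abbrev uqFree (g : UqGen) : FreeAlgebra ℂ UqGen := FreeAlgebra.ι ℂ g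

open UqGen in
/-- The defining relations, including the quantum Serre relations. -/
inductive UqRel (q : ℂ) : FreeAlgebra ℂ UqGen → FreeAlgebra ℂ UqGen → Prop
  | K_comm (i j : Fin 2) :
      UqRel q (uqFree (K i) * uqFree (K j)) (uqFree (K j) * uqFree (K i))
  | K_Kinv_comm (i j : Fin 2) :
      UqRel q (uqFree (K i) * uqFree (Kinv j)) (uqFree (Kinv j) * uqFree (K i))
  | Kinv_comm (i j : Fin 2) :
      UqRel q (uqFree (Kinv i) * uqFree (Kinv j)) (uqFree (Kinv j) * uqFree (Kinv i))
  | K_mul_Kinv (i : Fin 2) : UqRel q (uqFree (K i) * uqFree (Kinv i)) 1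
  | Kinv_mul_K (i : Fin 2) : UqRel q (uqFree (Kinv i) * uqFree (K i)) 1
  | K_E (i j : Fin 2) :
      UqRel q (uqFree (K i) * uqFree (E j)) (q ^ cartanA2 i j • (uqFree (E j) * uqFree (K i)))
  | K_F (i j : Fin 2) :
      UqRel q (uqFree (K i) * uqFree (F j)) (q ^ (-cartanA2 i j) • (uqFree (F j) * uqFree (K i)))
  | E_F_same (i : Fin 2) :
      UqRel q (uqFree (E i) * uqFree (F i) - uqFree (F i) * uqFree (E i))
        ((q - q⁻¹)⁻¹ • (uqFree (K i) - uqFree (Kinv i)))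
  | E_F_ne (i j : Fin 2) (h : i ≠ j) :
      UqRel q (uqFree (E i) * uqFree (F j) - uqFree (F j) * uqFree (E i)) 0
  | serre_E (i j : Fin 2) (h : i ≠ j) :
      UqRel q (uqFree (E i) ^ 2 * uqFree (E j)
        - (q + q⁻¹) • (uqFree (E i) * uqFree (E j) * uqFree (E i))
        + uqFree (E j) * uqFree (E i) ^ 2) 0
  | serre_F (i j : Fin 2) (h : i ≠ j) :
      UqRel q (uqFree (F i) ^ 2 * uqFree (F j)
        - (q + q⁻¹) • (uqFree (F i) * uqFree (F j) * uqFree (F i))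
        + uqFree (F j) * uqFree (F i) ^ 2) 0

/-- The quantised universal enveloping algebra, by generators and relations. -/
abbrev Uq (q : ℂ) : Type := RingQuot (UqRel q)

noncomputable section

namespace Uq

/-- The image of a generator in the algebra. -/
def gen (q : ℂ) (g : UqGen) : Uq q := RingQuot.mkAlgHom ℂ (UqRel q) (uqFree g)

/-- `E₁` -/
def E₁ (q : ℂ) : Uq q := gen q (.E 0)
/-- `E₂` -/
def E₂ (q : ℂ) : Uq q := gen q (.E 1)
/-- `F₁` -/
def F₁ (q : ℂ) : Uq q := gen q (.F 0)
/-- `F₂` -/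
def F₂ (q : ℂ) : Uq q := gen q (.F 1)
/-- `K₁` -/
def K₁ (q : ℂ) : Uq q := gen q (.K 0)
/-- `K₂` -/
def K₂ (q : ℂ) : Uq q := gen q (.K 1)
/-- `K₁⁻¹` -/
def K₁inv (q : ℂ) : Uq q := gen q (.Kinv 0)
/-- `K₂⁻¹` -/
def K₂inv (q : ℂ) : Uq q := gen q (.Kinv 1)

/-- `F̂₃ = F₁F₂ (qK₂ - q⁻¹K₂⁻¹)/(q - q⁻¹) - F₂F₁ (K₂ - K₂⁻¹)/(q - q⁻¹)`. -/
def F₃hat (q : ℂ) : Uq q :=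
  F₁ q * F₂ q * ((q - q⁻¹)⁻¹ • (q • K₂ q - q⁻¹ • K₂inv q))
    - F₂ q * F₁ q * ((q - q⁻¹)⁻¹ • (K₂ q - K₂inv q))

/-- `K = K₁K₂⁻¹`, a generator of the coideal subalgebra. -/
def Kco (q : ℂ) : Uq q := K₁ q * K₂inv q

/-- `K⁻¹ = (K₁K₂⁻¹)⁻¹ = K₂K₁⁻¹`. -/
def Kcoinv (q : ℂ) : Uq q := K₂ q * K₁inv q

/-- `B₁ = F₁ - c₁ E₂ K₁⁻¹`. -/
def B₁ (q c₁ : ℂ) : Uq q := F₁ q - c₁ • (E₂ q * K₁inv q)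

/-- `B₂ = F₂ - c₂ E₁ K₂⁻¹`. -/
def B₂ (q c₂ : ℂ) : Uq q := F₂ q - c₂ • (E₁ q * K₂inv q)

/-- `C₁ = B₁B₂ - q B₂B₁ - c₂ K/(q - q⁻¹) + c₁ (q + q⁻¹) K⁻¹/(q - q⁻¹)`. -/
def C₁ (q c₁ c₂ : ℂ) : Uq q :=
  B₁ q c₁ * B₂ q c₂ - q • (B₂ q c₂ * B₁ q c₁)
    - (c₂ / (q - q⁻¹)) • Kco q + (c₁ * (q + q⁻¹) / (q - q⁻¹)) • Kcoinv q

end Uq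

/-- `v` is a highest weight vector of weight `L₁ ϖ₁ + L₂ ϖ₂`. -/
structure IsHighestWeightVector (q : ℂ) (L₁ L₂ : ℕ) {V : Type*} [AddCommGroup V] [Module ℂ V]
    [Module (Uq q) V] (v : V) : Prop where
  ne_zero : v ≠ 0
  E₁_smul : Uq.E₁ q • v = 0
  E₂_smul : Uq.E₂ q • v = 0
  K₁_smul : Uq.K₁ q • v = q ^ L₁ • v
  K₂_smul : Uq.K₂ q • v = q ^ L₂ • v

section vectors

variable {V : Type*} [AddCommGroup V] [Module ℂ V]

/-- The vector `F₂^k F̂₃^l F₁^m v`. -/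
def mudrovVec (q : ℂ) [Module (Uq q) V] (v : V) (k l m : ℕ) : V :=
  (Uq.F₂ q ^ k * Uq.F₃hat q ^ l * Uq.F₁ q ^ m) • v

/-- The subspace `U_i`, spanned by `F₂^k F̂₃^l F₁^(i+k) v`, `0 ≤ l ≤ L₂`, `0 ≤ k ≤ L₁ - i`
(used for `i ≤ L₁`). -/
def layerU (q : ℂ) [Module (Uq q) V] (L₁ L₂ : ℕ) (v : V) (i : ℕ) : Submodule ℂ V :=
  Submodule.span ℂ {w | ∃ k l : ℕ, l ≤ L₂ ∧ k ≤ L₁ - i ∧ w = mudrovVec q v k l (i + k)}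

/-- The kernel of `B₁` acting on `V`, intersected with `U_i`. -/
def kerB₁U (q c₁ : ℂ) [Module (Uq q) V] [IsScalarTower ℂ (Uq q) V]
    (L₁ L₂ : ℕ) (v : V) (i : ℕ) : Submodule ℂ V :=
  LinearMap.ker (Algebra.lsmul ℂ ℂ V (Uq.B₁ q c₁)) ⊓ layerU q L₁ L₂ v i

/-- `q^n - q^(-n)` -/
def qdiff (q : ℂ) (n : ℤ) : ℂ := q ^ n - q ^ (-n)

/-- `a_k(l,m)`, the coefficient of `F₂^k F̂₃^l F₁^(m+1) v` in `F₁ F₂^k F̂₃^l F₁^m v`. -/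
def coefa (q : ℂ) (L₂ : ℕ) (k l m : ℤ) : ℂ :=
  qdiff q (L₂ + m + 1 - k - l) / qdiff q (L₂ + m + 1 - l)

/-- `b_k(l,m)`, the coefficient of `F₂^(k-1) F̂₃^(l+1) F₁^m v` in `F₁ F₂^k F̂₃^l F₁^m v`. -/
def coefb (q : ℂ) (L₂ : ℕ) (k l m : ℤ) : ℂ :=
  qdiff q k / qdiff q (L₂ + m + 1 - l)

/-- `η_k(l,m)`, the coefficient of `F₂^(k-1) F̂₃^l F₁^m v` in `E₂ F₂^k F̂₃^l F₁^m v`. -/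
def coefη (q : ℂ) (L₂ : ℕ) (k l m : ℤ) : ℂ :=
  qdiff q k / (q - q⁻¹) * (qdiff q (1 - k + L₂ - l + m) / (q - q⁻¹))

/-- `γ^n_{k,l}` as a function of `j = L₁ - i - k` and `l`. The value is `δ_{n,l}` for `j = 0`,
and the step is
`a_k(l,k+i) γ_{k,l} + b_{k+1}(l-1,k+i+1) γ_{k+1,l-1}
  - c₁ q^(l+2i+k+1-L₁) η_{k+1}(l,k+i+1) γ_{k+1,l} = 0` solved for `γ_{k,l}`, where
`γ_{k+1,-1} = 0`. The divisor `a_k(l,k+i)` is nonzero for `l ≤ L₂`, `0 < q < 1`. -/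
def gammaDown (q c₁ : ℂ) (L₁ L₂ i n : ℕ) : ℕ → ℕ → ℂ
  | 0, l => if l = n then 1 else 0
  | j + 1, l =>
      let k : ℤ := (L₁ : ℤ) - i - (j + 1);
      (c₁ * q ^ ((l : ℤ) + 2 * i + k + 1 - L₁) * coefη q L₂ (k + 1) l (k + i + 1)
            * gammaDown q c₁ L₁ L₂ i n j l
          - (if l = 0 then 0 else
              coefb q L₂ (k + 1) (l - 1) (k + i + 1) * gammaDown q c₁ L₁ L₂ i n j (l - 1)))
        / coefa q L₂ k l (k + i)

/-- `γ^n_{k,l}` for `0 ≤ k ≤ L₁ - i`. -/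
def gammaCoef (q c₁ : ℂ) (L₁ L₂ i n k l : ℕ) : ℂ := gammaDown q c₁ L₁ L₂ i n (L₁ - i - k) l

/-- `u^i_n = ∑_{k=0}^{L₁-i} ∑_{l=0}^{L₂} γ^n_{k,l} F₂^k F̂₃^l F₁^(k+i) v`. -/
def uVec (q c₁ : ℂ) [Module (Uq q) V] (L₁ L₂ : ℕ) (v : V) (i n : ℕ) : V :=
  ∑ k ∈ range (L₁ - i + 1), ∑ l ∈ range (L₂ + 1),
    gammaCoef q c₁ L₁ L₂ i n k l • mudrovVec q v k l (k + i)

/-- The `q`-shifted factorial `(a;Q)_n = ∏_{j<n} (1 - a Q^j)`. -/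
def qShifted (a Q : ℂ) (n : ℕ) : ℂ := ∏ j ∈ range n, (1 - a * Q ^ j)

/-- The dual `Q`-Krawtchouk polynomial `K_n(λ(x); c, N | Q)`, `λ(x) = Q^(-x) + c Q^(x-N)`,
`0 ≤ n, x ≤ N`, as the terminating series
`₃φ₂(Q^(-n), Q^(-x), c Q^(x-N); Q^(-N), 0 | Q; Q)`. It is a polynomial of degree `n` in `λ(x)`,
since `(1 - Q^(j-x)) (1 - c Q^(x-N+j)) = 1 - λ(x) Q^j + c Q^(2j-N)`. -/
def dualQKrawtchouk (Q c : ℂ) (N n x : ℕ) : ℂ :=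
  ∑ k ∈ range (n + 1),
    qShifted (Q ^ (-(n : ℤ))) Q k * qShifted (Q ^ (-(x : ℤ))) Q k
        * qShifted (c * Q ^ ((x : ℤ) - N)) Q k
      / (qShifted (Q ^ (-(N : ℤ))) Q k * qShifted Q Q k) * Q ^ k

/-- The coefficient of `u^i_l` in the eigenvector `ψ^i_x`. -/
def psiCoef (q c₁ c₂ : ℂ) (L₁ L₂ i x l : ℕ) : ℂ :=
  (-1) ^ l * (c₂⁻¹) ^ l * (1 - q ^ 2) ^ (2 * l)
      * q ^ (-(l : ℤ) * (L₁ + 3) + (l.choose 2 : ℤ))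
    * qShifted (q ^ (-2 * (L₂ : ℤ) - 2 * L₁)) (q ^ 2) l
    / (qShifted (q ^ 2) (q ^ 2) l * qShifted (q ^ (-2 * (L₂ : ℤ) - 2 * L₁ - 2)) (q ^ 2) l
        * qShifted (q ^ (-2 * (L₂ : ℤ) - 2 * i)) (q ^ 2) l)
    * dualQKrawtchouk (q ^ 2) (-c₁⁻¹ * c₂ * q ^ (2 * (L₁ : ℤ) - 2 * i + 1)) L₂ l x

/-- The eigenvector `ψ^i_x`. -/
def psiVec (q c₁ c₂ : ℂ) [Module (Uq q) V] (L₁ L₂ : ℕ) (v : V) (i x : ℕ) : V :=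
  ∑ l ∈ range (L₂ + 1), psiCoef q c₁ c₂ L₁ L₂ i x l • uVec q c₁ L₁ L₂ v i l

end vectors

/-- `A(n)`, the coefficient of `u^i_{n+1}` in `C₁ u^i_n` (used for `n < L₂`). -/
def triA (q : ℂ) (L₁ L₂ i n : ℕ) : ℂ :=
  q ^ ((L₂ : ℤ) + i - n) * (1 - q ^ 2) * (1 - q ^ (2 * (L₁ : ℤ) + 2 * L₂ - 2 * n))
    / ((1 - q ^ (2 * (L₂ : ℤ) + 2 * L₁ - 2 * n + 2)) * (1 - q ^ (2 * (L₂ : ℤ) + 2 * i - 2 * n)))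

/-- `B(n)`; the coefficient of `u^i_n` in `C₁ u^i_n` is `B(n) + D`. -/
def triB (q c₁ c₂ : ℂ) (L₁ L₂ i n : ℕ) : ℂ :=
  -c₁ * (q ^ (2 * (n : ℤ) + i - L₁ - L₂) * (1 - q ^ (2 * (L₂ : ℤ) - 2 * n + 2 * i)) / (1 - q ^ 2))
    + c₂ * q ^ ((L₁ : ℤ) - L₂ + 2 * n - i + 1) * (1 - q ^ (-2 * (n : ℤ) - 2 * i)) / (1 - q ^ 2)

/-- `C(n)`, the coefficient of `u^i_{n-1}` in `C₁ u^i_n` (used for `1 ≤ n`). -/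
def triC (q c₁ c₂ : ℂ) (L₁ L₂ i n : ℕ) : ℂ :=
  c₁ * c₂ * q ^ (3 * (n : ℤ) - 3 * L₂ - i - 2) * (1 - q ^ (2 * n))
      * (1 - q ^ (2 * (L₂ : ℤ) - 2 * n + 2)) * (1 - q ^ (2 * (L₁ : ℤ) + 2 * L₂ - 2 * n + 4))
      * (1 - q ^ (2 * (L₂ : ℤ) + 2 * i + 2 - 2 * n))
    / ((1 - q ^ 2) ^ 3 * (1 - q ^ (2 * (L₂ : ℤ) + 2 * L₁ + 2 - 2 * n)))

/-- `D`, the scalar by which `-c₂ K/(q - q⁻¹) + c₁ (q + q⁻¹) K⁻¹/(q - q⁻¹)` acts on `U_i`. -/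
def triD (q c₁ c₂ : ℂ) (L₁ L₂ i : ℕ) : ℂ :=
  -c₂ * (q ^ ((L₁ : ℤ) - L₂ - 3 * i) / (q - q⁻¹))
    + c₁ * (q ^ ((L₂ : ℤ) - L₁ + 3 * i) * (q + q⁻¹) / (q - q⁻¹))

/-- The `(m, n)` entry of the tridiagonal matrix of `C₁` in the basis `u^i_n`. -/
def triMatrix (q c₁ c₂ : ℂ) (L₁ L₂ i m n : ℕ) : ℂ :=
  if m = n + 1 then triA q L₁ L₂ i n
  else if m = n then triB q c₁ c₂ L₁ L₂ i n + triD q c₁ c₂ L₁ L₂ i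
  else if m + 1 = n then triC q c₁ c₂ L₁ L₂ i n
  else 0

/-- `η₁ = (c₁ κ⁻¹ q (1 + q^(-2n-2)) - c₂ κ q^(2n)) / (q - q⁻¹)`. -/
def eta₁ (q c₁ c₂ κ : ℂ) (n : ℕ) : ℂ :=
  (c₁ * κ⁻¹ * q * (1 + q ^ (-2 * (n : ℤ) - 2)) - c₂ * κ * q ^ (2 * n)) / (q - q⁻¹)

end

set_option linter.unusedSectionVars false
set_option linter.unusedSimpArgs false

/-! ### Defining relations inside the quotient algebra -/

namespace Uq

variable {q : ℂ}

/-! For the copy of quantum sl(2) generated by E₂, F₂ and K₂, the vectors F̂₃^l F₁^m v are highest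
weight vectors: F̂₃ preserves the kernel of E₂ and, by a Serre relation, commutes there with F₁.
Hence F₁, E₂ and E₁ act on F₂^k F̂₃^l F₁^m v through explicit q-number coefficients (`F₁_mudrovVec`,
`E₂_mudrovVec`, `E₁_mudrovVec`). Finite dimension forces F̂₃^(L₂+1) F₁^m v = 0 and F₁^(L₁+1) v = 0,
while the vectors spanning U_i are independent (`eq_zero_of_diagSum_eq_zero`).

Regard k as a row index in U_i. Then B₁ maps U_i to U_{i+1}, and row k of the image involves only
rows k and k+1, row k with the nonzero coefficient a_k (`B₁_diagSum`). The image has no row k = L₁ -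
i, because F₁^(L₁+1) v = 0. So a vector of the kernel is determined by its top row, and the top row
is arbitrary; u^i_n is the solution whose top row is the n-th unit vector.

B₁ and B₂ satisfy a Serre relation with right-hand side a multiple of B₁ on each layer
(`IsWt.serre_B₁_B₂`). On ker B₁ it gives B₁B₁B₂ = 0, and there C₁ is B₁B₂ plus a scalar, so B₁C₁ = 0
as well. The tridiagonal formula thus equates two kernel vectors and can be checked on top rows
alone. Since B₁B₂ raises rows by at most one, only the two top rows of u^i_n matter (`B₁_B₂_uVec`),
and q-number identities turn the result into A(n), B(n) + D and C(n).

Rescaling the basis by `psiPrefactor` turns the tridiagonal matrix into the three-term recurrence of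
the dual Krawtchouk polynomials, which follows by comparing coefficients in the basis (Q^(-x), c
Q^(x-N); Q)_k. Each ψ^i_x has u^i_0-coordinate 1, hence is nonzero. Under the genericity condition
the eigenvalues are distinct (`eta₁_ne`), and a dimension count gives the last basis. -/

theorem gen_rel {x y : FreeAlgebra ℂ UqGen} (h : UqRel q x y) :
    RingQuot.mkAlgHom ℂ (UqRel q) x = RingQuot.mkAlgHom ℂ (UqRel q) y :=
  RingQuot.mkAlgHom_rel ℂ h

theorem K_mul_E (i j : Fin 2) :
    gen q (.K i) * gen q (.E j) = q ^ cartanA2 i j • (gen q (.E j) * gen q (.K i)) := by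
  simpa [gen] using gen_rel (UqRel.K_E (q := q) i j)

theorem K_mul_F (i j : Fin 2) :
    gen q (.K i) * gen q (.F j) = q ^ (-cartanA2 i j) • (gen q (.F j) * gen q (.K i)) := by
  simpa [gen] using gen_rel (UqRel.K_F (q := q) i j)

theorem Kinv_mul_K (i : Fin 2) : gen q (.Kinv i) * gen q (.K i) = 1 := by
  simpa [gen] using gen_rel (UqRel.Kinv_mul_K (q := q) i)

theorem E_F_same (i : Fin 2) : gen q (.E i) * gen q (.F i) - gen q (.F i) * gen q (.E i)
    = (q - q⁻¹)⁻¹ • (gen q (.K i) - gen q (.Kinv i)) := by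
  simpa [gen] using gen_rel (UqRel.E_F_same (q := q) i)

theorem E_F_ne {i j : Fin 2} (h : i ≠ j) :
    gen q (.E i) * gen q (.F j) - gen q (.F j) * gen q (.E i) = 0 := by
  simpa [gen] using gen_rel (UqRel.E_F_ne (q := q) i j h)

theorem serre_E {i j : Fin 2} (h : i ≠ j) :
    gen q (.E i) ^ 2 * gen q (.E j)
      - (q + q⁻¹) • (gen q (.E i) * gen q (.E j) * gen q (.E i))
      + gen q (.E j) * gen q (.E i) ^ 2 = 0 := by
  simpa [gen] using gen_rel (UqRel.serre_E (q := q) i j h)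

theorem serre_F {i j : Fin 2} (h : i ≠ j) :
    gen q (.F i) ^ 2 * gen q (.F j)
      - (q + q⁻¹) • (gen q (.F i) * gen q (.F j) * gen q (.F i))
      + gen q (.F j) * gen q (.F i) ^ 2 = 0 := by
  simpa [gen] using gen_rel (UqRel.serre_F (q := q) i j h)

end Uq

/-- The `q`-number `[n] = (q^n - q^(-n)) / (q - q⁻¹)`. -/
noncomputable def qNum (q : ℂ) (n : ℤ) : ℂ := qdiff q n / (q - q⁻¹)

/-! ### Weight vectors and the generators acting on them -/

section weights

open Uq

variable {q : ℂ} {V : Type*} [AddCommGroup V] [Module ℂ V] [Module (Uq q) V]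

/-- `x` has weight `(r, s)`: `K₁ x = q^r x` and `K₂ x = q^s x`. -/
def IsWt (q : ℂ) [Module (Uq q) V] (r s : ℤ) (x : V) : Prop :=
  K₁ q • x = q ^ r • x ∧ K₂ q • x = q ^ s • x

variable [IsScalarTower ℂ (Uq q) V]

/-- The action of an element of the algebra as a linear map. -/
noncomputable def toEnd (a : Uq q) : V →ₗ[ℂ] V := Algebra.lsmul ℂ ℂ V a

/-- Used to pass from the algebra action to linear maps, so that `map_smul` moves scalars outward
and `module` sees words applied to x as atoms. -/
theorem smul_eq_toEnd (a : Uq q) (x : V) : a • x = toEnd a x := rfl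

theorem gen_smul_mul {a b : UqGen} {c : ℂ}
    (h : gen q a * gen q b = c • (gen q b * gen q a)) {t : ℂ} {x : V}
    (hx : gen q a • x = t • x) : gen q a • gen q b • x = (c * t) • gen q b • x := by
  rw [smul_smul, h, smul_assoc, mul_smul, hx, smul_comm (gen q b) t x, smul_smul]

theorem IsWt.E₁_smul (hq : q ≠ 0) {r s : ℤ} {x : V} (h : IsWt q r s x) :
    IsWt q (r + 2) (s - 1) (E₁ q • x) := by
  refine ⟨?_, ?_⟩
  · rw [add_comm, zpow_add₀ hq]; exact gen_smul_mul (K_mul_E 0 0) h.1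
  · rw [sub_eq_neg_add, zpow_add₀ hq]; exact gen_smul_mul (K_mul_E 1 0) h.2

theorem IsWt.E₂_smul (hq : q ≠ 0) {r s : ℤ} {x : V} (h : IsWt q r s x) :
    IsWt q (r - 1) (s + 2) (E₂ q • x) := by
  refine ⟨?_, ?_⟩
  · rw [sub_eq_neg_add, zpow_add₀ hq]; exact gen_smul_mul (K_mul_E 0 1) h.1
  · rw [add_comm, zpow_add₀ hq]; exact gen_smul_mul (K_mul_E 1 1) h.2

theorem IsWt.F₁_smul (hq : q ≠ 0) {r s : ℤ} {x : V} (h : IsWt q r s x) :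
    IsWt q (r - 2) (s + 1) (F₁ q • x) := by
  refine ⟨?_, ?_⟩
  · rw [sub_eq_neg_add, zpow_add₀ hq]; exact gen_smul_mul (K_mul_F 0 0) h.1
  · rw [add_comm, zpow_add₀ hq]; exact gen_smul_mul (K_mul_F 1 0) h.2

theorem IsWt.F₂_smul (hq : q ≠ 0) {r s : ℤ} {x : V} (h : IsWt q r s x) :
    IsWt q (r + 1) (s - 2) (F₂ q • x) := by
  refine ⟨?_, ?_⟩
  · rw [add_comm, zpow_add₀ hq]; exact gen_smul_mul (K_mul_F 0 1) h.1
  · rw [sub_eq_neg_add, zpow_add₀ hq]; exact gen_smul_mul (K_mul_F 1 1) h.2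

theorem IsWt.congr {r s r' s' : ℤ} {x : V} (h : IsWt q r s x) (hr : r = r') (hs : s = s') :
    IsWt q r' s' x := hr ▸ hs ▸ h

theorem gen_Kinv_smul (hq : q ≠ 0) {i : Fin 2} {r : ℤ} {x : V}
    (hx : gen q (.K i) • x = q ^ r • x) : gen q (.Kinv i) • x = q ^ (-r) • x := by
  have h : gen q (.Kinv i) • gen q (.K i) • x = x := by
    rw [smul_smul, Kinv_mul_K, one_smul]
  rw [hx, smul_comm] at h
  rw [zpow_neg, eq_inv_smul_iff₀ (zpow_ne_zero _ hq), h]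

theorem IsWt.K₁inv (hq : q ≠ 0) {r s : ℤ} {x : V} (h : IsWt q r s x) :
    K₁inv q • x = q ^ (-r) • x := gen_Kinv_smul hq h.1

theorem IsWt.K₂inv (hq : q ≠ 0) {r s : ℤ} {x : V} (h : IsWt q r s x) :
    K₂inv q • x = q ^ (-s) • x := gen_Kinv_smul hq h.2

theorem gen_E_F (hq : q ≠ 0) {i : Fin 2} {r : ℤ} {x : V} (hx : gen q (.K i) • x = q ^ r • x) :
    gen q (.E i) • gen q (.F i) • x = gen q (.F i) • gen q (.E i) • x + qNum q r • x := by
  have h := congrArg (· • x) (E_F_same (q := q) i)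
  simp only [sub_smul, mul_smul, smul_assoc, hx, gen_Kinv_smul hq hx] at h
  rw [← sub_eq_iff_eq_add', h, ← sub_smul, smul_smul, qNum, qdiff, div_eq_inv_mul]

theorem IsWt.E₁_F₁ (hq : q ≠ 0) {r s : ℤ} {x : V} (h : IsWt q r s x) :
    E₁ q • F₁ q • x = F₁ q • E₁ q • x + qNum q r • x := gen_E_F hq h.1

theorem IsWt.E₂_F₂ (hq : q ≠ 0) {r s : ℤ} {x : V} (h : IsWt q r s x) :
    E₂ q • F₂ q • x = F₂ q • E₂ q • x + qNum q s • x := gen_E_F hq h.2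

theorem E₁_F₂ (x : V) : E₁ q • F₂ q • x = F₂ q • E₁ q • x := by
  have h := sub_eq_zero.mp (E_F_ne (q := q) (i := 0) (j := 1) (by decide))
  rw [smul_smul, smul_smul]; exact congrArg (· • x) h

theorem E₂_F₁ (x : V) : E₂ q • F₁ q • x = F₁ q • E₂ q • x := by
  have h := sub_eq_zero.mp (E_F_ne (q := q) (i := 1) (j := 0) (by decide))
  rw [smul_smul, smul_smul]; exact congrArg (· • x) h

theorem serre_F_smul {i j : Fin 2} (h : i ≠ j) (x : V) :
    gen q (.F i) • gen q (.F i) • gen q (.F j) • x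
      - (q + q⁻¹) • gen q (.F i) • gen q (.F j) • gen q (.F i) • x
      + gen q (.F j) • gen q (.F i) • gen q (.F i) • x = 0 := by
  have := congrArg (· • x) (serre_F (q := q) h)
  simpa only [sub_smul, add_smul, mul_smul, smul_assoc, pow_two, zero_smul] using this

theorem serre_E_smul {i j : Fin 2} (h : i ≠ j) (x : V) :
    gen q (.E i) • gen q (.E i) • gen q (.E j) • x
      - (q + q⁻¹) • gen q (.E i) • gen q (.E j) • gen q (.E i) • x
      + gen q (.E j) • gen q (.E i) • gen q (.E i) • x = 0 := by
  have := congrArg (· • x) (serre_E (q := q) h)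
  simpa only [sub_smul, add_smul, mul_smul, smul_assoc, pow_two, zero_smul] using this

/-- `F₁² F₂ - [2] F₁F₂F₁ + F₂F₁² = 0`. -/
theorem serre_F₁_F₂ (x : V) : F₁ q • F₁ q • F₂ q • x
    - (q + q⁻¹) • F₁ q • F₂ q • F₁ q • x + F₂ q • F₁ q • F₁ q • x = 0 :=
  serre_F_smul (i := 0) (j := 1) (by decide) x

/-- `F₂² F₁ - [2] F₂F₁F₂ + F₁F₂² = 0`. -/
theorem serre_F₂_F₁ (x : V) : F₂ q • F₂ q • F₁ q • x
    - (q + q⁻¹) • F₂ q • F₁ q • F₂ q • x + F₁ q • F₂ q • F₂ q • x = 0 :=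
  serre_F_smul (i := 1) (j := 0) (by decide) x

/-- `E₂² E₁ - [2] E₂E₁E₂ + E₁E₂² = 0`. -/
theorem serre_E₂_E₁ (x : V) : E₂ q • E₂ q • E₁ q • x
    - (q + q⁻¹) • E₂ q • E₁ q • E₂ q • x + E₁ q • E₂ q • E₂ q • x = 0 :=
  serre_E_smul (i := 1) (j := 0) (by decide) x

/-- The Cartan factors of F̂₃ stand on the right, so they act on x itself and become q-numbers of
its K₂-weight. -/
theorem IsWt.F₃hat_smul (hq : q ≠ 0) {r s : ℤ} {x : V} (h : IsWt q r s x) :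
    F₃hat q • x = qNum q (s + 1) • F₁ q • F₂ q • x - qNum q s • F₂ q • F₁ q • x := by
  have h1 : q * q ^ s - q⁻¹ * q ^ (-s) = qdiff q (s + 1) := by
    rw [qdiff, zpow_add₀ hq, neg_add, zpow_add₀ hq, zpow_one, zpow_neg_one]; ring
  simp only [F₃hat, sub_smul, mul_smul, smul_assoc, h.2, h.K₂inv hq]
  rw [qNum, ← h1, qNum, qdiff]
  simp only [smul_eq_toEnd, map_smul, map_sub]
  module

theorem IsWt.B₁_smul (hq : q ≠ 0) (c₁ : ℂ) {r s : ℤ} {x : V} (h : IsWt q r s x) :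
    B₁ q c₁ • x = F₁ q • x - (c₁ * q ^ (-r)) • E₂ q • x := by
  simp only [B₁, sub_smul, smul_assoc, mul_smul, h.K₁inv hq, smul_comm (E₂ q) (_ : ℂ)]

theorem IsWt.B₂_smul (hq : q ≠ 0) (c₂ : ℂ) {r s : ℤ} {x : V} (h : IsWt q r s x) :
    B₂ q c₂ • x = F₂ q • x - (c₂ * q ^ (-s)) • E₁ q • x := by
  simp only [B₂, sub_smul, smul_assoc, mul_smul, h.K₂inv hq, smul_comm (E₁ q) (_ : ℂ)]

theorem IsWt.C₁_smul (hq : q ≠ 0) (c₁ c₂ : ℂ) {r s : ℤ} {x : V} (h : IsWt q r s x) :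
    C₁ q c₁ c₂ • x = B₁ q c₁ • B₂ q c₂ • x - q • B₂ q c₂ • B₁ q c₁ • x
      + (-(c₂ / (q - q⁻¹)) * q ^ (r - s) + c₁ * (q + q⁻¹) / (q - q⁻¹) * q ^ (s - r)) • x := by
  have e1 : q ^ (r - s) = q ^ r * q ^ (-s) := by rw [← zpow_add₀ hq, sub_eq_add_neg]
  have e2 : q ^ (s - r) = q ^ s * q ^ (-r) := by rw [← zpow_add₀ hq, sub_eq_add_neg]
  rw [e1, e2]
  simp only [C₁, Kco, Kcoinv, add_smul, sub_smul, mul_smul, smul_assoc, h.K₁inv hq, h.K₂inv hq,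
    h.1, h.2, smul_comm (K₁ q) (_ : ℂ), smul_comm (K₂ q) (_ : ℂ), neg_smul]
  simp only [smul_eq_toEnd]
  module

end weights

/-- `q` is nonzero and not a root of unity. -/
structure IsGenericQ (q : ℂ) : Prop where
  ne_zero : q ≠ 0
  zpow_ne_one : ∀ n : ℤ, n ≠ 0 → q ^ n ≠ 1

/-! ### q-numbers for generic q -/

namespace IsGenericQ

variable {q : ℂ}

theorem zpow_injective (hq : IsGenericQ q) : Function.Injective (fun n : ℤ => q ^ n) := by
  intro a b h
  by_contra hab
  refine hq.zpow_ne_one (a - b) (sub_ne_zero.mpr hab) ?_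
  rw [zpow_sub₀ hq.ne_zero]
  exact (div_eq_one_iff_eq (zpow_ne_zero _ hq.ne_zero)).mpr h

theorem qdiff_ne_zero (hq : IsGenericQ q) {n : ℤ} (hn : n ≠ 0) : qdiff q n ≠ 0 := by
  intro h
  have := hq.zpow_injective (sub_eq_zero.mp h)
  omega

theorem sub_inv_ne_zero (hq : IsGenericQ q) : q - q⁻¹ ≠ 0 := by
  simpa [qdiff] using hq.qdiff_ne_zero one_ne_zero

theorem sq_sub_one_ne_zero (hq : IsGenericQ q) : q ^ 2 - 1 ≠ 0 :=
  sub_ne_zero.mpr (by exact_mod_cast hq.zpow_ne_one 2 two_ne_zero)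

theorem qNum_ne_zero (hq : IsGenericQ q) {n : ℤ} (hn : n ≠ 0) : qNum q n ≠ 0 :=
  div_ne_zero (hq.qdiff_ne_zero hn) hq.sub_inv_ne_zero

theorem qNum_one (hq : IsGenericQ q) : qNum q 1 = 1 := by
  simp [qNum, qdiff, hq.sub_inv_ne_zero]

/-- `[2][n + 1] = [n + 2] + [n]`. -/
theorem qNum_add_two (hq : IsGenericQ q) (n : ℤ) :
    qNum q (n + 2) = (q + q⁻¹) * qNum q (n + 1) - qNum q n := by
  have := hq.ne_zero
  simp only [qNum, qdiff, neg_add, zpow_add₀ this, zpow_neg, zpow_one, zpow_ofNat]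
  have := zpow_ne_zero n this
  field_simp
  ring

theorem qNum_succ_succ (hq : IsGenericQ q) (n : ℤ) :
    qNum q (n + 1 + 1) = (q + q⁻¹) * qNum q (n + 1) - qNum q n := by
  rw [add_assoc]; exact hq.qNum_add_two n

end IsGenericQ

@[simp] theorem qNum_zero (q : ℂ) : qNum q 0 = 0 := by simp [qNum, qdiff]

/-! ### Vectors annihilated by E₂ -/

section extremal

open Uq

variable {q : ℂ} {V : Type*} [AddCommGroup V] [Module ℂ V] [Module (Uq q) V]

/-- `x` has weight `(r, s)` and is annihilated by `E₂`. -/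
structure IsE₂Extremal (q : ℂ) [Module (Uq q) V] (r s : ℤ) (x : V) : Prop where
  wt : IsWt q r s x
  E₂_smul : E₂ q • x = 0

variable [IsScalarTower ℂ (Uq q) V]

theorem IsWt.F₂_pow_smul (hq : q ≠ 0) {r s : ℤ} {x : V} (h : IsWt q r s x) (k : ℕ) :
    IsWt q (r + k) (s - 2 * k) (F₂ q ^ k • x) := by
  induction k with
  | zero => simpa using h
  | succ k ih =>
    rw [pow_succ', mul_smul]
    exact (ih.F₂_smul hq).congr (by push_cast; ring) (by push_cast; ring)

namespace IsE₂Extremal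

theorem congr {r s r' s' : ℤ} {x : V} (h : IsE₂Extremal q r s x) (hr : r = r') (hs : s = s') :
    IsE₂Extremal q r' s' x := hr ▸ hs ▸ h

theorem F₁_smul (hq : q ≠ 0) {r s : ℤ} {x : V} (h : IsE₂Extremal q r s x) :
    IsE₂Extremal q (r - 2) (s + 1) (F₁ q • x) :=
  ⟨h.wt.F₁_smul hq, by rw [E₂_F₁, h.E₂_smul, smul_zero]⟩

/-- The coefficients of F̂₃ are made for this: E₂F₁F₂x = [s]F₁x and E₂F₂F₁x = [s+1]F₁x, so the
combination with weights [s+1] and -[s] cancels. -/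
theorem F₃hat_smul (hq : q ≠ 0) {r s : ℤ} {x : V} (h : IsE₂Extremal q r s x) :
    IsE₂Extremal q (r - 1) (s - 1) (F₃hat q • x) := by
  have h1 := ((h.wt.F₂_smul hq).F₁_smul hq).congr (r' := r - 1) (s' := s - 1) (by ring) (by ring)
  have h2 := ((h.wt.F₁_smul hq).F₂_smul hq).congr (r' := r - 1) (s' := s - 1) (by ring) (by ring)
  have e1 : E₂ q • F₁ q • F₂ q • x = qNum q s • F₁ q • x := by
    rw [E₂_F₁, h.wt.E₂_F₂ hq, h.E₂_smul, smul_zero, zero_add, smul_comm]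
  have e2 : E₂ q • F₂ q • F₁ q • x = qNum q (s + 1) • F₁ q • x := by
    rw [(h.wt.F₁_smul hq).E₂_F₂ hq, E₂_F₁, h.E₂_smul, smul_zero, smul_zero, zero_add]
  refine ⟨⟨?_, ?_⟩, ?_⟩ <;> rw [h.wt.F₃hat_smul hq, smul_sub]
  · rw [smul_comm _ (qNum q (s + 1)), smul_comm _ (qNum q s), h1.1, h2.1, smul_sub]
    simp only [smul_smul, mul_comm]
  · rw [smul_comm _ (qNum q (s + 1)), smul_comm _ (qNum q s), h1.2, h2.2, smul_sub]
    simp only [smul_smul, mul_comm]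
  · rw [smul_comm _ (qNum q (s + 1)), smul_comm _ (qNum q s), e1, e2, smul_smul, smul_smul,
      mul_comm, sub_self]

/-- F₁x has K₂-weight s+1, and [s] + [s+2] = [2][s+1]; the difference of the two sides is therefore
[s+1] times a Serre relation. -/
theorem F₁_F₃hat (hq : IsGenericQ q) {r s : ℤ} {x : V} (h : IsE₂Extremal q r s x) :
    F₁ q • F₃hat q • x = F₃hat q • F₁ q • x := by
  rw [h.wt.F₃hat_smul hq.ne_zero, (h.wt.F₁_smul hq.ne_zero).F₃hat_smul hq.ne_zero,
    hq.qNum_succ_succ]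
  have := serre_F₁_F₂ (q := q) x
  simp only [smul_eq_toEnd, map_smul, map_sub] at this ⊢
  linear_combination (norm := module) qNum q (s + 1) • this

theorem E₂_F₂_pow (hq : IsGenericQ q) {r s : ℤ} {x : V} (h : IsE₂Extremal q r s x) (k : ℕ) :
    E₂ q • F₂ q ^ (k + 1) • x = (qNum q (k + 1) * qNum q (s - k)) • F₂ q ^ k • x := by
  induction k with
  | zero => simp [h.wt.E₂_F₂ hq.ne_zero, h.E₂_smul, hq.qNum_one]
  | succ k ih =>
    rw [pow_succ', mul_smul, (h.wt.F₂_pow_smul hq.ne_zero (k + 1)).E₂_F₂ hq.ne_zero, ih, smul_comm (F₂ q),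
      ← mul_smul (F₂ q), ← pow_succ', ← add_smul]
    congr 1
    have h0 := hq.ne_zero
    have := hq.sub_inv_ne_zero
    push_cast
    simp only [qNum, qdiff, neg_add, neg_sub, sub_eq_add_neg, mul_add, two_mul, neg_neg,
      zpow_add₀ h0, zpow_neg, zpow_one, zpow_natCast]
    have hs := zpow_ne_zero s h0
    have hk := pow_ne_zero k h0
    generalize q ^ s = S at *
    generalize q ^ k = K at *
    have h2 := hq.sq_sub_one_ne_zero
    field_simp
    ring

/-- The Serre relation gives F₁F₂^(k+2) = [2]F₂F₁F₂^(k+1) - F₂²F₁F₂^k, a second-order recursion in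
k. Both [s-k] and [k+1] obey the same recursion, whence the two-step induction. The factor [s+1]
stays on the left so that nothing is divided. -/
theorem F₁_F₂_pow (hq : IsGenericQ q) {r s : ℤ} {x : V} (h : IsE₂Extremal q r s x) (k : ℕ) :
    qNum q (s + 1) • F₁ q • F₂ q ^ (k + 1) • x
      = qNum q (s - k) • F₂ q ^ (k + 1) • F₁ q • x
        + qNum q (k + 1) • F₂ q ^ k • F₃hat q • x := by
  induction k using Nat.twoStepInduction with
  | zero => simp [h.wt.F₃hat_smul hq.ne_zero, hq.qNum_one]
  | one =>
    have e := h.wt.F₃hat_smul hq.ne_zero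
    have := serre_F₂_F₁ (q := q) x
    have h1 := hq.qNum_add_two (s - 1)
    have h2 := hq.qNum_add_two 0
    rw [zero_add, zero_add, hq.qNum_one, qNum_zero] at h2
    rw [sub_add_cancel] at h1
    rw [show s - 1 + 2 = s + 1 by ring] at h1
    simp only [pow_succ', pow_zero, mul_one, mul_smul, zero_add, Nat.cast_one]
    rw [one_add_one_eq_two, h2]
    simp only [smul_eq_toEnd, map_smul, map_sub] at this e ⊢
    have e' := congrArg (toEnd (F₂ q)) e
    simp only [map_smul, map_sub] at e'
    have h3 : qNum q (s - 1) = (q + q⁻¹) * qNum q s - qNum q (s + 1) := by rw [h1]; ring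
    rw [h3]
    linear_combination (norm := module) qNum q (s + 1) • this - (q + q⁻¹) • e'
  | more k ih1 ih2 =>
    have := serre_F₂_F₁ (q := q) (F₂ q ^ (k + 1) • x)
    have h1 := hq.qNum_add_two (s - (k + 2))
    have h2 := hq.qNum_add_two (k + 1)
    have h3 : qNum q (s - (k + 2)) = (q + q⁻¹) * qNum q (s - (k + 1)) - qNum q (s - k) := by
      rw [show s - ((k : ℤ) + 2) + 1 = s - (k + 1) by ring,
        show s - ((k : ℤ) + 2) + 2 = s - k by ring] at h1
      rw [h1]; ring
    push_cast at ih2 ⊢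
    rw [show (k : ℤ) + 2 + 1 = k + 1 + 2 by ring, h2, h3]
    simp only [pow_succ' (F₂ q) (k + 2), pow_succ' (F₂ q) (k + 1), mul_smul] at ih1 ih2 ⊢
    simp only [pow_succ' (F₂ q) k, mul_smul] at this ih1 ih2 ⊢
    simp only [smul_eq_toEnd, map_smul, map_sub] at this ih1 ih2 ⊢
    have ih1' := congrArg (fun y => toEnd (F₂ q) (toEnd (F₂ q) y)) ih1
    have ih2' := congrArg (toEnd (F₂ q)) ih2
    simp only [map_smul, map_sub, map_add] at ih1' ih2'
    linear_combination (norm := module) qNum q (s + 1) • this - ih1' + (q + q⁻¹) • ih2'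

end IsE₂Extremal

end extremal

/-! ### q-number identities behind the action of E₁ -/

theorem qNum_eq {q : ℂ} (n : ℤ) : qNum q n = (q ^ n - (q ^ n)⁻¹) / (q - q⁻¹) := by
  rw [qNum, qdiff, zpow_neg]

/-- `α(l,m)`, the coefficient of `F̂₃^l F₁^(m-1) v` in `E₁ F̂₃^l F₁^m v`. -/
noncomputable def coefα (q : ℂ) (L₁ L₂ : ℕ) (l m : ℤ) : ℂ :=
  qNum q m * qNum q (L₁ - m + 1) * qNum q (L₂ + m + 1) / qNum q (L₂ + m - l + 1)

/-- `β(l,m)`, the coefficient of `F₂ F̂₃^(l-1) F₁^m v` in `E₁ F̂₃^l F₁^m v`. -/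
noncomputable def coefβ (q : ℂ) (L₁ L₂ : ℕ) (l m : ℤ) : ℂ :=
  qNum q l * qNum q (L₁ + L₂ + 2 - l) * qNum q (L₂ - l + 1) / qNum q (L₂ + m - l + 1)

theorem coefa_eq {q : ℂ} (hq : IsGenericQ q) (L₂ : ℕ) (k l m : ℤ) :
    coefa q L₂ k l m = qNum q (L₂ + m - l + 1 - k) / qNum q (L₂ + m - l + 1) := by
  rw [coefa, qNum, qNum, div_div_div_cancel_right₀ hq.sub_inv_ne_zero]
  congr 2 <;> ring

theorem coefb_eq {q : ℂ} (hq : IsGenericQ q) (L₂ : ℕ) (k l m : ℤ) :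
    coefb q L₂ k l m = qNum q k / qNum q (L₂ + m - l + 1) := by
  rw [coefb, qNum, qNum, div_div_div_cancel_right₀ hq.sub_inv_ne_zero]
  congr 2; ring

theorem coefη_eq {q : ℂ} (L₂ : ℕ) (k l m : ℤ) :
    coefη q L₂ k l m = qNum q k * qNum q (L₂ + m - l + 1 - k) := by
  rw [coefη, qNum, qNum]
  congr 3; ring

/-- With p = L₁ + L₂, this is the induction step in l for the coefficient of E₁ on F̂₃^l v. -/
theorem qNum_mul_succ {q : ℂ} (hq : IsGenericQ q) (l p : ℤ) :
    qNum q l * qNum q (p + 2 - l) + qNum q (p + 1 - 2 * l) = qNum q (l + 1) * qNum q (p + 1 - l) := by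
  have h0 := hq.ne_zero
  have h2 := hq.sq_sub_one_ne_zero
  rw [show p + 2 - l = p + 1 + 1 - l by ring]
  simp only [qNum_eq, zpow_add₀ h0, zpow_sub₀ h0, two_mul, zpow_one]
  have := zpow_ne_zero l h0
  have := zpow_ne_zero p h0
  field_simp
  ring

/-- The induction step in m for E₁F̂₃^l F₁^m v: the three summands come from F₁E₁, from the
commutator [E₁, F₁], and from the F̂₃ term that arises when F₁ is moved past the F₂ of the β-part.
-/
theorem coefα_succ {q : ℂ} (hq : IsGenericQ q) (L₁ L₂ : ℕ) (l m : ℤ)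
    (h1 : (L₂ : ℤ) + m - l + 1 ≠ 0) (h2 : (L₂ : ℤ) + m - l + 2 ≠ 0) :
    coefα q L₁ L₂ l m + qNum q (L₁ - l - 2 * m) + coefβ q L₁ L₂ l m / qNum q (L₂ + m - l + 2)
      = coefα q L₁ L₂ l (m + 1) := by
  have h0 := hq.ne_zero
  have h3 := hq.sq_sub_one_ne_zero
  have e1 := hq.qNum_ne_zero h1
  have e2 := hq.qNum_ne_zero h2
  rw [coefα, coefα, coefβ, show (L₂ : ℤ) + (m + 1) - l + 1 = L₂ + m - l + 2 by ring]
  field_simp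
  rw [show (L₂ : ℤ) + m - l + 2 = L₂ + m - l + 1 + 1 by ring,
    show (L₁ : ℤ) + L₂ + 2 - l = L₁ + L₂ + 1 + 1 - l by ring]
  simp only [qNum_eq, zpow_add₀ h0, zpow_sub₀ h0, two_mul, zpow_one, zpow_natCast]
  have := zpow_ne_zero l h0
  have := zpow_ne_zero m h0
  have := pow_ne_zero L₁ h0
  have := pow_ne_zero L₂ h0
  generalize q ^ L₁ = X at *
  generalize q ^ L₂ = Y at *
  generalize q ^ l = S at *
  generalize q ^ m = T at *
  field_simp
  ring

/-! ### Explicit action on the vectors F₂^k F̂₃^l F₁^m v -/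

section mudrov

open Uq

variable {q : ℂ} {V : Type*} [AddCommGroup V] [Module ℂ V] [Module (Uq q) V]

theorem mudrovVec_eq_pow_smul (v : V) (k l m : ℕ) :
    mudrovVec q v k l m = F₂ q ^ k • mudrovVec q v 0 l m := by
  simp [mudrovVec, mul_smul]

theorem mudrovVec_succ_left (v : V) (k l m : ℕ) :
    mudrovVec q v (k + 1) l m = F₂ q • mudrovVec q v k l m := by
  rw [mudrovVec_eq_pow_smul, mudrovVec_eq_pow_smul v k, pow_succ', mul_smul]

theorem mudrovVec_zero_succ (v : V) (l m : ℕ) :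
    mudrovVec q v 0 (l + 1) m = F₃hat q • mudrovVec q v 0 l m := by
  simp [mudrovVec, mul_smul, pow_succ']

theorem mudrovVec_zero_zero_succ (v : V) (m : ℕ) :
    mudrovVec q v 0 0 (m + 1) = F₁ q • mudrovVec q v 0 0 m := by
  simp [mudrovVec, mul_smul, pow_succ']

variable [IsScalarTower ℂ (Uq q) V]

/-- Otherwise these would be infinitely many eigenvectors with distinct eigenvalues, hence an
infinite independent family. -/
theorem exists_eq_zero_of_weights [FiniteDimensional ℂ V] (hq : IsGenericQ q) (a : Uq q)
    (f : ℕ → ℤ) (hf : Function.Injective f) (y : ℕ → V)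
    (hy : ∀ n, a • y n = q ^ f n • y n) : ∃ n, y n = 0 := by
  by_contra! h
  have := Module.End.eigenvectors_linearIndependent' (toEnd (V := V) a) (fun n => q ^ f n)
    (hq.zpow_injective.comp hf) y
    (fun n => ⟨Module.End.mem_eigenspace_iff.mpr (hy n), h n⟩)
  exact not_finite_iff_infinite.mpr inferInstance this.finite_of_isNoetherian

/-- Some F₂^n x vanishes by finite dimension. If the least such exponent were n+1, applying E₂ would
give [n+1][s-n]F₂^n x = 0, and neither q-number vanishes for s < 0. -/
theorem IsE₂Extremal.eq_zero_of_neg [FiniteDimensional ℂ V] (hq : IsGenericQ q) {r s : ℤ} {x : V}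
    (h : IsE₂Extremal q r s x) (hs : s < 0) : x = 0 := by
  classical
  have hex : ∃ n : ℕ, F₂ q ^ n • x = 0 :=
    exists_eq_zero_of_weights hq (K₂ q) (fun n : ℕ => s - 2 * n) (fun a b hab => by simpa using hab)
      _ (fun n => (h.wt.F₂_pow_smul hq.ne_zero n).2)
  have hn := Nat.find_spec hex
  rcases e : Nat.find hex with _ | n
  · simpa [e] using hn
  · exfalso
    rw [e] at hn
    have h1 := h.E₂_F₂_pow hq n
    rw [hn, smul_zero, eq_comm, smul_eq_zero] at h1
    rcases h1 with h1 | h1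
    · exact mul_ne_zero (hq.qNum_ne_zero (by omega)) (hq.qNum_ne_zero (by omega)) h1
    · exact Nat.find_min hex (m := n) (by omega) h1

/-- The linear elimination in `IsE₂Extremal.E₁_F₃hat`. There X = F₂x, P = F₁F₂²y, Q = F₂²F₁y, R =
F₂F₁F₂y, and s₀, s₁, s₂ are [s], [s+1], [s+2]. After multiplication by s₂ the vector Q cancels. -/
theorem smul_sub_smul_of_relations {s₀ s₁ s₂ d b r₀ r₁ : ℂ} {X P Q R A B : V}
    (hs : s₂ = d * s₁ - s₀) (hne : s₂ ≠ 0) (hR : s₂ • R = s₁ • Q + b • X)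
    (hP : s₂ • P = s₀ • Q + d • b • X) (hA : A = P + r₁ • X) (hB : B = R + r₀ • X) :
    s₁ • A - s₀ • B = (b + (s₁ * r₁ - s₀ * r₀)) • X := by
  subst hs hA hB
  apply smul_right_injective V hne
  dsimp only
  linear_combination (norm := module) s₁ • hP - s₀ • hR

/-- One step up the F̂₃-ladder, where y plays the rung below x up to a scalar. The commutators [E₁,
F₁] contribute [s+1][r+1] - [s][r] = [s+r+1]; the rest reduces to b through `F₁_F₂_pow` for y. -/
theorem IsE₂Extremal.E₁_F₃hat (hq : IsGenericQ q) {r s : ℤ} {x y : V} {b : ℂ}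
    (hx : IsE₂Extremal q r s x) (hy : IsE₂Extremal q (r + 1) (s + 1) y)
    (h : E₁ q • x = F₂ q • y) (hxy : F₃hat q • y = b • x) (hs : s + 2 ≠ 0) :
    E₁ q • F₃hat q • x = (b + qNum q (s + r + 1)) • F₂ q • x := by
  have h0 := hq.ne_zero
  have a1 := hy.F₁_F₂_pow hq 0
  have a2 := hy.F₁_F₂_pow hq 1
  have a3 := (hx.wt.F₂_smul h0).E₁_F₁ h0
  have a4 := hx.wt.E₁_F₁ h0
  have hne := hq.qNum_ne_zero hs
  have i1 := hq.qNum_add_two s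
  have i2 : qNum q (s + r + 1) = qNum q (s + 1) * qNum q (r + 1) - qNum q s * qNum q r := by
    have h2 := hq.sq_sub_one_ne_zero
    simp only [qNum_eq, zpow_add₀ h0, zpow_one]
    have := zpow_ne_zero r h0
    have := zpow_ne_zero s h0
    field_simp
    ring
  have i3 := hq.qNum_add_two 0
  rw [zero_add, zero_add, hq.qNum_one, qNum_zero, mul_one, sub_zero] at i3
  rw [E₁_F₂, h] at a3
  rw [h] at a4
  simp only [pow_two, pow_succ', pow_zero, mul_one, mul_smul, one_smul, hxy, zero_add, Nat.cast_zero,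
    Nat.cast_one, sub_zero, hq.qNum_one, add_sub_cancel_right, add_assoc s 1 1,
    one_add_one_eq_two, i3] at a1 a2
  have a4' := congrArg (fun z => F₂ q • z) a4
  have a1' := congrArg (fun z => F₂ q • z) a1
  simp only [smul_add, smul_comm (F₂ q) (_ : ℂ)] at a1' a2 a4'
  rw [hx.wt.F₃hat_smul h0, i2, smul_sub, smul_comm (E₁ q) (qNum q (s + 1)),
    smul_comm (E₁ q) (qNum q s), E₁_F₂]
  exact smul_sub_smul_of_relations i1 hne a1' a2 a3 a4'

theorem isE₂Extremal_mudrovVec (hq : IsGenericQ q) {L₁ L₂ : ℕ} {v : V}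
    (hv : IsHighestWeightVector q L₁ L₂ v) (l m : ℕ) :
    IsE₂Extremal q (L₁ - l - 2 * m) (L₂ + m - l) (mudrovVec q v 0 l m) := by
  induction l with
  | zero =>
    induction m with
    | zero =>
      have : IsE₂Extremal q L₁ L₂ v :=
        ⟨⟨by simpa using hv.K₁_smul, by simpa using hv.K₂_smul⟩, hv.E₂_smul⟩
      simpa [mudrovVec] using this
    | succ m ih =>
      rw [mudrovVec_zero_zero_succ]
      exact (ih.F₁_smul hq.ne_zero).congr (by push_cast; ring) (by push_cast; ring)
  | succ l ih =>
    rw [mudrovVec_zero_succ]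
    exact (ih.F₃hat_smul hq.ne_zero).congr (by push_cast; ring) (by push_cast; ring)

theorem isWt_mudrovVec (hq : IsGenericQ q) {L₁ L₂ : ℕ} {v : V}
    (hv : IsHighestWeightVector q L₁ L₂ v) (k l m : ℕ) :
    IsWt q (L₁ - l - 2 * m + k) (L₂ + m - l - 2 * k) (mudrovVec q v k l m) := by
  rw [mudrovVec_eq_pow_smul]
  exact (isE₂Extremal_mudrovVec hq hv l m).wt.F₂_pow_smul hq.ne_zero k

theorem F₁_mudrovVec_zero (hq : IsGenericQ q) {L₁ L₂ : ℕ} {v : V}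
    (hv : IsHighestWeightVector q L₁ L₂ v) (l m : ℕ) :
    F₁ q • mudrovVec q v 0 l m = mudrovVec q v 0 l (m + 1) := by
  induction l with
  | zero => rw [mudrovVec_zero_zero_succ]
  | succ l ih =>
    rw [mudrovVec_zero_succ, (isE₂Extremal_mudrovVec hq hv l m).F₁_F₃hat hq, ih,
      mudrovVec_zero_succ]

theorem F₁_mudrovVec (hq : IsGenericQ q) {L₁ L₂ : ℕ} {v : V}
    (hv : IsHighestWeightVector q L₁ L₂ v) (k l m : ℕ) (h : (L₂ : ℤ) + m - l + 1 ≠ 0) :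
    F₁ q • mudrovVec q v k l m = coefa q L₂ k l m • mudrovVec q v k l (m + 1)
      + coefb q L₂ k l m • mudrovVec q v (k - 1) (l + 1) m := by
  have hne := hq.qNum_ne_zero h
  rw [coefa_eq hq, coefb_eq hq]
  rcases k with _ | k
  · simp [F₁_mudrovVec_zero hq hv, hne]
  · have := (isE₂Extremal_mudrovVec hq hv l m).F₁_F₂_pow hq k
    rw [F₁_mudrovVec_zero hq hv, ← mudrovVec_zero_succ, ← mudrovVec_eq_pow_smul,
      ← mudrovVec_eq_pow_smul, ← mudrovVec_eq_pow_smul] at this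
    rw [← inv_smul_smul₀ hne (F₁ q • _), this, smul_add, smul_smul, smul_smul,
      Nat.add_sub_cancel, div_eq_inv_mul, div_eq_inv_mul]
    congr 4
    push_cast; ring_nf

theorem E₂_mudrovVec (hq : IsGenericQ q) {L₁ L₂ : ℕ} {v : V}
    (hv : IsHighestWeightVector q L₁ L₂ v) (k l m : ℕ) :
    E₂ q • mudrovVec q v k l m = coefη q L₂ k l m • mudrovVec q v (k - 1) l m := by
  rw [coefη_eq]
  rcases k with _ | k
  · simp [(isE₂Extremal_mudrovVec hq hv l m).E₂_smul]
  · rw [mudrovVec_eq_pow_smul, (isE₂Extremal_mudrovVec hq hv l m).E₂_F₂_pow hq,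
      ← mudrovVec_eq_pow_smul]
    congr 3
    · push_cast; ring_nf

theorem E₁_mudrovVec_zero_zero (hq : IsGenericQ q) {L₁ L₂ : ℕ} {v : V}
    (hv : IsHighestWeightVector q L₁ L₂ v) (l : ℕ) (hl : l ≤ L₂) :
    E₁ q • mudrovVec q v 0 l 0
      = (qNum q l * qNum q (L₁ + L₂ + 2 - l)) • F₂ q • mudrovVec q v 0 (l - 1) 0 := by
  induction l with
  | zero => simpa [mudrovVec] using hv.E₁_smul
  | succ l ih =>
    have ih := ih (by omega)
    have hx := isE₂Extremal_mudrovVec hq hv l 0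
    rw [mudrovVec_zero_succ]
    rw [hx.E₁_F₃hat hq (y := (qNum q l * qNum q (L₁ + L₂ + 2 - l)) • mudrovVec q v 0 (l - 1) 0)
      (b := qNum q l * qNum q (L₁ + L₂ + 2 - l)) _ (by rw [ih, smul_comm]) _ (by push_cast; omega)]
    · have := qNum_mul_succ hq l (L₁ + L₂)
      rw [Nat.add_sub_cancel]
      congr 1
      push_cast
      rw [show (L₁ : ℤ) + L₂ + 2 - (l + 1) = L₁ + L₂ + 1 - l by ring, ← this]
      congr 2; ring
    -- For l = 0 there is no lower rung; the factor [l] makes y zero, so the truncated index l - 1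
    -- is harmless.
    · rcases l with _ | l
      · simp only [Nat.cast_zero, qNum_zero, zero_mul, zero_smul]
        exact ⟨⟨by simp, by simp⟩, by simp⟩
      · have hy := isE₂Extremal_mudrovVec hq hv l 0
        rw [Nat.add_sub_cancel]
        refine IsE₂Extremal.congr ⟨⟨?_, ?_⟩, ?_⟩ (r := L₁ - l - 2 * (0 : ℕ))
          (s := L₂ + (0 : ℕ) - l) (by push_cast; ring) (by push_cast; ring)
        · rw [smul_comm, hy.wt.1, smul_comm]
        · rw [smul_comm, hy.wt.2, smul_comm]
        · rw [smul_comm, hy.E₂_smul, smul_zero]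
    · rcases l with _ | l
      · simp
      · rw [smul_comm, Nat.add_sub_cancel, mudrovVec_zero_succ]

/-- Induction on m, commuting E₁ past one F₁ at a time. The factors [m] in α and [l] in β remove the
terms in which m - 1 or l - 1 would truncate. -/
theorem E₁_mudrovVec_zero (hq : IsGenericQ q) {L₁ L₂ : ℕ} {v : V}
    (hv : IsHighestWeightVector q L₁ L₂ v) (l m : ℕ) (hl : l ≤ L₂) :
    E₁ q • mudrovVec q v 0 l m = coefα q L₁ L₂ l m • mudrovVec q v 0 l (m - 1)
      + coefβ q L₁ L₂ l m • mudrovVec q v 1 (l - 1) m := by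
  induction m with
  | zero =>
    have : qNum q ((L₂ : ℤ) - l + 1) ≠ 0 := hq.qNum_ne_zero (by omega)
    rw [E₁_mudrovVec_zero_zero hq hv l hl, mudrovVec_succ_left, coefα, coefβ]
    simp [this]
  | succ m ih =>
    have e1 := (isE₂Extremal_mudrovVec hq hv l m).wt.E₁_F₁ hq.ne_zero
    have e2 := coefα_succ hq L₁ L₂ l m (by omega) (by omega)
    have e3 : (coefα q L₁ L₂ l m) • F₁ q • mudrovVec q v 0 l (m - 1)
        = (coefα q L₁ L₂ l m) • mudrovVec q v 0 l m := by
      rcases m with _ | m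
      · simp [coefα]
      · rw [Nat.add_sub_cancel, F₁_mudrovVec_zero hq hv]
    rw [← F₁_mudrovVec_zero hq hv, e1, ih, smul_add, smul_comm (F₁ q) (coefα q L₁ L₂ l m), e3,
      smul_comm (F₁ q) (coefβ q L₁ L₂ l m), Nat.add_sub_cancel]
    push_cast
    rw [← e2]
    rcases l with _ | l
    · simp [coefβ]
      module
    · rw [Nat.add_sub_cancel, F₁_mudrovVec hq hv _ _ _ (by omega), coefa_eq hq, coefb_eq hq]
      have h1 : qNum q ((L₂ : ℤ) + m - l) ≠ 0 := hq.qNum_ne_zero (by omega)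
      -- The ratio of consecutive β is exactly the coefficient a₁ acquired when F₁ passes F₂.
      have e4 : coefβ q L₁ L₂ ((l + 1 : ℕ) : ℤ) (m + 1)
          = coefβ q L₁ L₂ ((l + 1 : ℕ) : ℤ) m * (qNum q (L₂ + m - l) / qNum q (L₂ + m - l + 1)) := by
        rw [coefβ, coefβ, show (L₂ : ℤ) + m - (l + 1 : ℕ) + 1 = L₂ + m - l by push_cast; ring,
          show (L₂ : ℤ) + (m + 1) - (l + 1 : ℕ) + 1 = L₂ + m - l + 1 by push_cast; ring]
        field_simp
      rw [e4, Nat.sub_self, show (L₂ : ℤ) + m - (l + 1 : ℕ) + 2 = L₂ + m - l + 1 by push_cast; ring]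
      simp only [Nat.cast_one, add_sub_cancel_right, hq.qNum_one]
      module

theorem E₁_mudrovVec (hq : IsGenericQ q) {L₁ L₂ : ℕ} {v : V}
    (hv : IsHighestWeightVector q L₁ L₂ v) (k l m : ℕ) (hl : l ≤ L₂) :
    E₁ q • mudrovVec q v k l m = coefα q L₁ L₂ l m • mudrovVec q v k l (m - 1)
      + coefβ q L₁ L₂ l m • mudrovVec q v (k + 1) (l - 1) m := by
  induction k with
  | zero => exact E₁_mudrovVec_zero hq hv l m hl
  | succ k ih =>
    rw [mudrovVec_succ_left, E₁_F₂, ih, smul_add, smul_comm (F₂ q) (_ : ℂ),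
      smul_comm (F₂ q) (_ : ℂ), ← mudrovVec_succ_left, ← mudrovVec_succ_left]

/-- F̂₃^(L₂+1) v is annihilated by E₂ and has K₂-weight exponent -1, so it vanishes; F₁ commutes
past F̂₃ and carries this to every m. -/
theorem mudrovVec_eq_zero_of_lt_left [FiniteDimensional ℂ V] (hq : IsGenericQ q) {L₁ L₂ : ℕ} {v : V}
    (hv : IsHighestWeightVector q L₁ L₂ v) (k m : ℕ) : mudrovVec q v k (L₂ + 1) m = 0 := by
  have : mudrovVec q v 0 (L₂ + 1) m = 0 := by
    induction m with
    | zero => exact (isE₂Extremal_mudrovVec hq hv (L₂ + 1) 0).eq_zero_of_neg hq (by push_cast; omega)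
    | succ m ih => rw [← F₁_mudrovVec_zero hq hv, ih, smul_zero]
  rw [mudrovVec_eq_pow_smul, this, smul_zero]

theorem coefα_zero_ne_zero (hq : IsGenericQ q) {L₁ L₂ m : ℕ} (h : m ≠ 0) (h' : m ≠ L₁ + 1) :
    coefα q L₁ L₂ 0 m ≠ 0 := by
  rw [coefα]
  exact div_ne_zero (mul_ne_zero (mul_ne_zero (hq.qNum_ne_zero (by omega))
    (hq.qNum_ne_zero (by omega))) (hq.qNum_ne_zero (by omega))) (hq.qNum_ne_zero (by omega))

theorem mudrovVec_zero_zero_ne_zero (hq : IsGenericQ q) {L₁ L₂ : ℕ} {v : V}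
    (hv : IsHighestWeightVector q L₁ L₂ v) (m : ℕ) (hm : m ≤ L₁) : mudrovVec q v 0 0 m ≠ 0 := by
  induction m with
  | zero => simpa [mudrovVec] using hv.ne_zero
  | succ m ih =>
    intro h
    have e := E₁_mudrovVec_zero hq hv 0 (m + 1) (by omega)
    rw [h, smul_zero, eq_comm] at e
    simp only [coefβ, Nat.cast_zero, qNum_zero, zero_mul, zero_div, zero_smul, add_zero,
      smul_eq_zero] at e
    exact e.elim (coefα_zero_ne_zero hq (by omega) (by omega)) (ih (by omega))

/-- A least exponent n+1 with F₁^(n+1) v = 0 exists. Applying E₁ shows that α(0, n+1) must vanish,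
which leaves only n = L₁. -/
theorem mudrovVec_eq_zero_of_lt_right [FiniteDimensional ℂ V] (hq : IsGenericQ q) {L₁ L₂ : ℕ} {v : V}
    (hv : IsHighestWeightVector q L₁ L₂ v) (k l : ℕ) : mudrovVec q v k l (L₁ + 1) = 0 := by
  have : mudrovVec q v 0 0 (L₁ + 1) = 0 := by
    classical
    have hex : ∃ n : ℕ, mudrovVec q v 0 0 n = 0 :=
      exists_eq_zero_of_weights hq (K₂ q) (fun n : ℕ => L₂ + n) (fun a b hab => by simpa using hab)
        _ (fun n => by simpa using (isE₂Extremal_mudrovVec hq hv 0 n).wt.2)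
    have hn := Nat.find_spec hex
    rcases e : Nat.find hex with _ | n
    · rw [e] at hn
      exact absurd hn (mudrovVec_zero_zero_ne_zero hq hv 0 (by omega))
    · rw [e] at hn
      by_cases h : n = L₁
      · rwa [h] at hn
      exfalso
      have e2 := E₁_mudrovVec_zero hq hv 0 (n + 1) (by omega)
      rw [hn, smul_zero, eq_comm] at e2
      simp only [coefβ, Nat.cast_zero, qNum_zero, zero_mul, zero_div, zero_smul, add_zero,
        smul_eq_zero] at e2
      rcases e2 with e2 | e2
      · exact coefα_zero_ne_zero hq (by omega) (by omega) e2
      · exact Nat.find_min hex (m := n) (by omega) e2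
  have h2 : mudrovVec q v 0 l (L₁ + 1) = 0 := by
    induction l with
    | zero => exact this
    | succ l ih => rw [mudrovVec_zero_succ, ih, smul_zero]
  rw [mudrovVec_eq_pow_smul, h2, smul_zero]

/-- E₂E₁ undoes one F̂₃: E₂ kills the α-part of E₁F̂₃^(l+1)F₁^m v and sends the β-part to a nonzero
multiple of F̂₃^l F₁^m v. -/
theorem mudrovVec_zero_ne_zero (hq : IsGenericQ q) {L₁ L₂ : ℕ} {v : V}
    (hv : IsHighestWeightVector q L₁ L₂ v) (l m : ℕ) (hl : l ≤ L₂) (hm : m ≤ L₁) :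
    mudrovVec q v 0 l m ≠ 0 := by
  induction l with
  | zero => exact mudrovVec_zero_zero_ne_zero hq hv m hm
  | succ l ih =>
    intro h
    have e := congrArg (fun x => E₂ q • x) (E₁_mudrovVec_zero hq hv (l + 1) m hl)
    simp only [h, smul_zero, smul_add, smul_comm (E₂ q) (_ : ℂ), E₂_mudrovVec hq hv,
      Nat.add_sub_cancel, coefη_eq, Nat.cast_zero, qNum_zero, zero_mul, zero_smul, zero_add,
      Nat.sub_self] at e
    rw [smul_smul, eq_comm, smul_eq_zero] at e
    refine e.elim ?_ (ih (by omega))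
    rw [coefβ]
    exact mul_ne_zero (div_ne_zero (mul_ne_zero (mul_ne_zero (hq.qNum_ne_zero (by omega))
      (hq.qNum_ne_zero (by omega))) (hq.qNum_ne_zero (by omega))) (hq.qNum_ne_zero (by omega)))
      (mul_ne_zero (hq.qNum_ne_zero (by omega)) (hq.qNum_ne_zero (by omega)))

end mudrov

/-! ### The layers U_i, the action of B₁ and its kernel -/

section layers

open Uq

variable {q : ℂ} {V : Type*} [AddCommGroup V] [Module ℂ V] [Module (Uq q) V]

/-- The linear combination `∑_{k < N} ∑_{l ≤ L₂} c_{k,l} F₂^k F̂₃^l F₁^(k+i) v`. -/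
noncomputable def diagSum (q : ℂ) [Module (Uq q) V] (L₂ : ℕ) (v : V) (i N : ℕ) : (ℕ → ℕ → ℂ) →ₗ[ℂ] V where
  toFun c := ∑ k ∈ range N, ∑ l ∈ range (L₂ + 1), c k l • mudrovVec q v k l (k + i)
  map_add' c d := by simp [add_smul, sum_add_distrib]
  map_smul' t c := by simp [mul_smul, smul_sum]

theorem diagSum_apply (L₂ : ℕ) (v : V) (i N : ℕ) (c : ℕ → ℕ → ℂ) : diagSum q L₂ v i N c
    = ∑ k ∈ range N, ∑ l ∈ range (L₂ + 1), c k l • mudrovVec q v k l (k + i) := rfl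

theorem diagSum_succ (L₂ : ℕ) (v : V) (i N : ℕ) (c : ℕ → ℕ → ℂ) : diagSum q L₂ v i (N + 1) c
    = diagSum q L₂ v i N c + ∑ l ∈ range (L₂ + 1), c N l • mudrovVec q v N l (N + i) := by
  rw [diagSum_apply, sum_range_succ, diagSum_apply]

theorem diagSum_congr (L₂ : ℕ) (v : V) (i N : ℕ) {c d : ℕ → ℕ → ℂ}
    (h : ∀ k < N, ∀ l ≤ L₂, c k l = d k l) : diagSum q L₂ v i N c = diagSum q L₂ v i N d := by
  rw [diagSum_apply, diagSum_apply]
  refine sum_congr rfl fun k hk => sum_congr rfl fun l hl => ?_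
  rw [h k (mem_range.mp hk) l (Nat.lt_succ_iff.mp (mem_range.mp hl))]

theorem mudrovVec_mem_range_diagSum (L₂ : ℕ) (v : V) (i N k l : ℕ) (hk : k < N) (hl : l ≤ L₂) :
    mudrovVec q v k l (k + i) ∈ LinearMap.range (diagSum q L₂ v i N) := by
  refine ⟨fun k' l' => if k' = k then if l' = l then 1 else 0 else 0, ?_⟩
  rw [diagSum_apply, sum_eq_single_of_mem k (mem_range.mpr hk) (fun b _ hb => by simp [hb]),
    sum_eq_single_of_mem l (mem_range.mpr (by omega)) (fun b _ hb => by simp [hb])]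
  simp

theorem layerU_eq_range_diagSum (L₁ L₂ : ℕ) (v : V) (i : ℕ) :
    layerU q L₁ L₂ v i = LinearMap.range (diagSum q L₂ v i (L₁ - i + 1)) := by
  apply le_antisymm
  · refine Submodule.span_le.mpr ?_
    rintro _ ⟨k, l, hl, hk, rfl⟩
    rw [add_comm i k]
    exact mudrovVec_mem_range_diagSum L₂ v i _ k l (by omega) hl
  · rintro _ ⟨c, rfl⟩
    rw [diagSum_apply]
    refine Submodule.sum_mem _ fun k hk => Submodule.sum_mem _ fun l hl =>
      Submodule.smul_mem _ _ ?_
    have hk := mem_range.mp hk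
    have hl := mem_range.mp hl
    rw [add_comm k i]
    exact Submodule.subset_span ⟨k, l, by omega, by omega, rfl⟩

theorem range_diagSum_mono (L₂ : ℕ) (v : V) (i : ℕ) {M N : ℕ} (h : M ≤ N) :
    LinearMap.range (diagSum q L₂ v i M) ≤ LinearMap.range (diagSum q L₂ v i N) := by
  rintro _ ⟨c, rfl⟩
  rw [diagSum_apply]
  refine Submodule.sum_mem _ fun k hk => Submodule.sum_mem _ fun l hl =>
    Submodule.smul_mem _ _ ?_
  have hk := mem_range.mp hk
  have hl := mem_range.mp hl
  exact mudrovVec_mem_range_diagSum L₂ v i N k l (by omega) (by omega)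

variable [IsScalarTower ℂ (Uq q) V]

theorem uq_smul_sum {ι : Type*} (a : Uq q) (s : Finset ι) (c : ι → ℂ) (x : ι → V) :
    a • ∑ j ∈ s, c j • x j = ∑ j ∈ s, c j • a • x j := by
  rw [smul_sum]
  exact sum_congr rfl fun j _ => smul_comm _ _ _

/-- For fixed m the vectors are separated by their K₂-eigenvalues q^(L₂+m-l). -/
theorem mudrovVec_zero_sum_eq_zero (hq : IsGenericQ q) {L₁ L₂ : ℕ} {v : V}
    (hv : IsHighestWeightVector q L₁ L₂ v) (m : ℕ) (hm : m ≤ L₁) (d : ℕ → ℂ)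
    (h : ∑ l ∈ range (L₂ + 1), d l • mudrovVec q v 0 l m = 0) : ∀ l ≤ L₂, d l = 0 := by
  have hli := Module.End.eigenvectors_linearIndependent' (toEnd (V := V) (K₂ q))
    (fun l : Fin (L₂ + 1) => q ^ ((L₂ : ℤ) + m - (l : ℕ)))
    (fun a b hab => Fin.ext (by have := hq.zpow_injective hab; omega))
    (fun l : Fin (L₂ + 1) => mudrovVec q v 0 l m)
    (fun l => ⟨Module.End.mem_eigenspace_iff.mpr (isE₂Extremal_mudrovVec hq hv l m).wt.2,
      mudrovVec_zero_ne_zero hq hv l m (by omega) hm⟩)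
  rw [sum_range] at h
  intro l hl
  exact Fintype.linearIndependent_iff.mp hli _ h ⟨l, by omega⟩

theorem E₂_pow_mudrovVec_of_lt (hq : IsGenericQ q) {L₁ L₂ : ℕ} {v : V}
    (hv : IsHighestWeightVector q L₁ L₂ v) {n k : ℕ} (h : k < n) (l m : ℕ) :
    E₂ q ^ n • mudrovVec q v k l m = 0 := by
  induction n generalizing k with
  | zero => omega
  | succ n ih =>
    rw [pow_succ, mul_smul, E₂_mudrovVec hq hv, smul_comm]
    rcases k with _ | k
    · simp [coefη_eq]
    · rw [Nat.add_sub_cancel, ih (by omega), smul_zero]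

theorem exists_E₂_pow_mudrovVec (hq : IsGenericQ q) {L₁ L₂ : ℕ} {v : V}
    (hv : IsHighestWeightVector q L₁ L₂ v) (k l m : ℕ) (hl : l ≤ L₂) (hk : k ≤ m) :
    ∃ t : ℂ, t ≠ 0 ∧ E₂ q ^ k • mudrovVec q v k l m = t • mudrovVec q v 0 l m := by
  induction k with
  | zero => exact ⟨1, one_ne_zero, by simp⟩
  | succ k ih =>
    obtain ⟨t, ht, h⟩ := ih (by omega)
    refine ⟨coefη q L₂ (k + 1 : ℕ) l m * t, mul_ne_zero ?_ ht, ?_⟩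
    · rw [coefη_eq]
      exact mul_ne_zero (hq.qNum_ne_zero (by omega)) (hq.qNum_ne_zero (by omega))
    · rw [pow_succ, mul_smul, E₂_mudrovVec hq hv, smul_comm, Nat.add_sub_cancel, h, smul_smul]

/-- E₂^N annihilates every row below the N-th and strips all the F₂ from row N with nonzero factors.
This isolates the top row, where weights separate the entries; then the number of rows drops by one.
-/
theorem eq_zero_of_diagSum_eq_zero (hq : IsGenericQ q) {L₁ L₂ : ℕ} {v : V}
    (hv : IsHighestWeightVector q L₁ L₂ v) (i N : ℕ) (hN : N + i ≤ L₁ + 1) (c : ℕ → ℕ → ℂ)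
    (h : diagSum q L₂ v i N c = 0) : ∀ k < N, ∀ l ≤ L₂, c k l = 0 := by
  induction N with
  | zero => intro k hk; omega
  | succ N ih =>
    have htop : ∀ l ≤ L₂, c N l = 0 := by
      have e := congrArg (fun x => E₂ q ^ N • x) h
      have e0 : E₂ q ^ N • diagSum q L₂ v i N c = 0 := by
        rw [diagSum_apply, smul_sum]
        refine sum_eq_zero fun k hk => ?_
        rw [uq_smul_sum]
        exact sum_eq_zero fun l _ => by
          rw [E₂_pow_mudrovVec_of_lt hq hv (mem_range.mp hk), smul_zero]
      simp only [diagSum_succ, smul_add, e0, zero_add, smul_zero, uq_smul_sum] at e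
      have hex : ∀ l : ℕ, ∃ t : ℂ, l ≤ L₂ → t ≠ 0 ∧
          E₂ q ^ N • mudrovVec q v N l (N + i) = t • mudrovVec q v 0 l (N + i) := by
        intro l
        by_cases hl : l ≤ L₂
        · obtain ⟨t, ht⟩ := exists_E₂_pow_mudrovVec hq hv N l (N + i) hl (by omega)
          exact ⟨t, fun _ => ht⟩
        · exact ⟨0, fun h => absurd h hl⟩
      choose t ht using hex
      have e2 : ∑ l ∈ range (L₂ + 1), (c N l * t l) • mudrovVec q v 0 l (N + i) = 0 := by
        rw [← e]
        refine sum_congr rfl fun l hl => ?_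
        rw [(ht l (by have := mem_range.mp hl; omega)).2, smul_smul]
      intro l hl
      have := mudrovVec_zero_sum_eq_zero hq hv (N + i) (by omega) _ e2 l hl
      exact (mul_eq_zero.mp this).resolve_right (ht l hl).1
    have hrest : diagSum q L₂ v i N c = 0 := by
      rw [diagSum_succ] at h
      rw [← h, left_eq_add]
      exact sum_eq_zero fun l hl => by
        rw [htop l (by have := mem_range.mp hl; omega), zero_smul]
    intro k hk
    rcases Nat.lt_succ_iff_lt_or_eq.mp hk with hk | rfl
    · exact ih (by omega) hrest k hk
    · exact htop

/-- The coefficients of `B₁` applied to `∑ c_{k,l} F₂^k F̂₃^l F₁^(k+i) v`. -/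
noncomputable def stepCoef (q c₁ : ℂ) (L₁ L₂ i : ℕ) (c : ℕ → ℕ → ℂ) (k l : ℕ) : ℂ :=
  coefa q L₂ k l (k + i) * c k l
    + (if l = 0 then 0 else coefb q L₂ (k + 1) (l - 1) (k + i + 1) * c (k + 1) (l - 1))
    - c₁ * q ^ ((l : ℤ) + 2 * i + k + 1 - L₁) * coefη q L₂ (k + 1) l (k + i + 1) * c (k + 1) l

theorem B₁_mudrovVec (hq : IsGenericQ q) (c₁ : ℂ) {L₁ L₂ : ℕ} {v : V}
    (hv : IsHighestWeightVector q L₁ L₂ v) (k l m : ℕ) (h : (L₂ : ℤ) + m - l + 1 ≠ 0) :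
    B₁ q c₁ • mudrovVec q v k l m = coefa q L₂ k l m • mudrovVec q v k l (m + 1)
      + coefb q L₂ k l m • mudrovVec q v (k - 1) (l + 1) m
      - (c₁ * q ^ ((l : ℤ) + 2 * m - k - L₁) * coefη q L₂ k l m) • mudrovVec q v (k - 1) l m := by
  rw [(isWt_mudrovVec hq hv k l m).B₁_smul hq.ne_zero, F₁_mudrovVec hq hv k l m h,
    E₂_mudrovVec hq hv, smul_smul]
  congr 4
  congr 1; ring

/-- Each of the three terms of B₁ increases (exponent of F₁) - (exponent of F₂) by one, so layer i
goes to layer i+1. One row is lost at the top. -/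
theorem B₁_diagSum [FiniteDimensional ℂ V] (hq : IsGenericQ q) (c₁ : ℂ) {L₁ L₂ : ℕ} {v : V}
    (hv : IsHighestWeightVector q L₁ L₂ v) (i M : ℕ) (hM : M + i = L₁) (c : ℕ → ℕ → ℂ) :
    B₁ q c₁ • diagSum q L₂ v i (M + 1) c
      = diagSum q L₂ v (i + 1) M (stepCoef q c₁ L₁ L₂ i c) := by
  have hB : B₁ q c₁ • diagSum q L₂ v i (M + 1) c
      = (∑ k ∈ range (M + 1), ∑ l ∈ range (L₂ + 1),
          (coefa q L₂ k l (k + i) * c k l) • mudrovVec q v k l (k + i + 1))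
        + (∑ k ∈ range (M + 1), ∑ l ∈ range (L₂ + 1),
          (coefb q L₂ k l (k + i) * c k l) • mudrovVec q v (k - 1) (l + 1) (k + i))
        - ∑ k ∈ range (M + 1), ∑ l ∈ range (L₂ + 1),
          (c₁ * q ^ ((l : ℤ) + 2 * (k + i) - k - L₁) * coefη q L₂ k l (k + i) * c k l)
            • mudrovVec q v (k - 1) l (k + i) := by
    rw [diagSum_apply, smul_sum, ← sum_add_distrib, ← sum_sub_distrib]
    refine sum_congr rfl fun k _ => ?_
    rw [uq_smul_sum, ← sum_add_distrib, ← sum_sub_distrib]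
    refine sum_congr rfl fun l hl => ?_
    have := mem_range.mp hl
    rw [B₁_mudrovVec hq c₁ hv _ _ _ (by omega)]
    push_cast
    module
  -- The summand k = M contains F₁^(L₁+1) v = 0.
  have ha : (∑ k ∈ range (M + 1), ∑ l ∈ range (L₂ + 1),
      (coefa q L₂ k l (k + i) * c k l) • mudrovVec q v k l (k + i + 1))
      = ∑ k ∈ range M, ∑ l ∈ range (L₂ + 1),
      (coefa q L₂ k l (k + i) * c k l) • mudrovVec q v k l (k + (i + 1)) := by
    rw [sum_range_succ, hM]
    simp only [mudrovVec_eq_zero_of_lt_right hq hv, smul_zero, sum_const_zero, add_zero]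
    rfl
  -- Both indices shift: k = 0 drops out because b₀ = 0, and l = L₂ because F̂₃^(L₂+1) kills F₁^m v.
  have hb : (∑ k ∈ range (M + 1), ∑ l ∈ range (L₂ + 1),
      (coefb q L₂ k l (k + i) * c k l) • mudrovVec q v (k - 1) (l + 1) (k + i))
      = ∑ k ∈ range M, ∑ l ∈ range (L₂ + 1),
        (if l = 0 then 0 else coefb q L₂ (k + 1) (l - 1) (k + i + 1) * c (k + 1) (l - 1))
          • mudrovVec q v k l (k + (i + 1)) := by
    rw [sum_range_succ']
    have h0 : ∀ l m : ℤ, coefb q L₂ (0 : ℕ) l m = 0 := by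
      intro l m; simp [coefb_eq hq]
    simp only [h0, zero_mul, zero_smul, sum_const_zero, add_zero]
    refine sum_congr rfl fun k _ => ?_
    rw [sum_range_succ, mudrovVec_eq_zero_of_lt_left hq hv, smul_zero, add_zero, sum_range_succ']
    simp only [if_true, zero_smul, add_zero, Nat.add_sub_cancel, Nat.add_eq_zero_iff, one_ne_zero,
      and_false, if_false]
    refine sum_congr rfl fun l _ => ?_
    rw [show k + 1 + i = k + (i + 1) by ring]
    push_cast
    congr 3
    · ring
    · ring
  have hc : (∑ k ∈ range (M + 1), ∑ l ∈ range (L₂ + 1),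
      (c₁ * q ^ ((l : ℤ) + 2 * (k + i) - k - L₁) * coefη q L₂ k l (k + i) * c k l)
        • mudrovVec q v (k - 1) l (k + i))
      = ∑ k ∈ range M, ∑ l ∈ range (L₂ + 1),
      (c₁ * q ^ ((l : ℤ) + 2 * i + k + 1 - L₁) * coefη q L₂ (k + 1) l (k + i + 1) * c (k + 1) l)
        • mudrovVec q v k l (k + (i + 1)) := by
    rw [sum_range_succ']
    have h0 : ∀ l m : ℤ, coefη q L₂ (0 : ℕ) l m = 0 := by
      intro l m; simp [coefη_eq]
    simp only [h0, zero_mul, mul_zero, zero_smul, sum_const_zero, add_zero]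
    refine sum_congr rfl fun k _ => sum_congr rfl fun l _ => ?_
    rw [show k + 1 + i = k + (i + 1) by ring, Nat.add_sub_cancel]
    push_cast
    congr 4
    · congr 1; ring
    · ring
  rw [hB, ha, hb, hc, diagSum_apply, ← sum_add_distrib, ← sum_sub_distrib]
  refine sum_congr rfl fun k _ => ?_
  rw [← sum_add_distrib, ← sum_sub_distrib]
  refine sum_congr rfl fun l _ => ?_
  rw [← add_smul, ← sub_smul, stepCoef]

theorem coefa_diag_ne_zero (hq : IsGenericQ q) {L₂ : ℕ} (i k l : ℤ) (hi : 0 ≤ i) (hk : 0 ≤ k)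
    (hl : l ≤ L₂) : coefa q L₂ k l (k + i) ≠ 0 := by
  rw [coefa_eq hq]
  exact div_ne_zero (hq.qNum_ne_zero (by omega)) (hq.qNum_ne_zero (by omega))

/-- Descent from the top row: once row k+1 vanishes, the k-th equation reduces to a_k(l,k+i) c_{k,l}
= 0 with a nonzero coefficient. -/
theorem diagSum_eq_zero_of_B₁ [FiniteDimensional ℂ V] (hq : IsGenericQ q) (c₁ : ℂ) {L₁ L₂ : ℕ}
    {v : V} (hv : IsHighestWeightVector q L₁ L₂ v) (i M : ℕ) (hM : M + i = L₁) (c : ℕ → ℕ → ℂ)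
    (h : B₁ q c₁ • diagSum q L₂ v i (M + 1) c = 0) (htop : ∀ l ≤ L₂, c M l = 0) :
    diagSum q L₂ v i (M + 1) c = 0 := by
  rw [B₁_diagSum hq c₁ hv i M hM] at h
  have hs := eq_zero_of_diagSum_eq_zero hq hv _ _ (by omega) _ h
  have hz : ∀ j ≤ M, ∀ l ≤ L₂, c (M - j) l = 0 := by
    intro j
    induction j with
    | zero => intro _; exact htop
    | succ j ih =>
      intro hj l hl
      have e := hs (M - (j + 1)) (by omega) l hl
      rw [stepCoef, show M - (j + 1) + 1 = M - j by omega, ih (by omega) l hl,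
        ih (by omega) (l - 1) (by omega)] at e
      simp only [mul_zero, ite_self, add_zero, sub_zero, mul_eq_zero] at e
      exact e.resolve_left (coefa_diag_ne_zero hq _ _ _ (by omega) (by omega) (by omega))
  rw [diagSum_congr L₂ v i (M + 1) (d := 0), map_zero]
  intro k hk l hl
  have := hz (M - k) (by omega) l hl
  rwa [show M - (M - k) = k by omega] at this

theorem gammaCoef_top (c₁ : ℂ) (L₁ L₂ i n l : ℕ) :
    gammaCoef q c₁ L₁ L₂ i n (L₁ - i) l = if l = n then 1 else 0 := by
  rw [gammaCoef, Nat.sub_self, gammaDown]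

theorem stepCoef_gammaCoef (hq : IsGenericQ q) (c₁ : ℂ) {L₁ L₂ i : ℕ} (n k l : ℕ) (hk : k < L₁ - i)
    (hl : l ≤ L₂) : stepCoef q c₁ L₁ L₂ i (gammaCoef q c₁ L₁ L₂ i n) k l = 0 := by
  have ha := coefa_diag_ne_zero hq (L₂ := L₂) i k l (by omega) (by omega) (by omega)
  obtain ⟨j, hj⟩ : ∃ j, L₁ - i - k = j + 1 := ⟨L₁ - i - k - 1, by omega⟩
  have hj' : L₁ - i - (k + 1) = j := by omega
  have hk' : (L₁ : ℤ) - i - (j + 1) = k := by omega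
  simp only [stepCoef, gammaCoef, hj, hj']
  rw [gammaDown]
  simp only [hk']
  rw [mul_div_cancel₀ _ ha]
  ring_nf

theorem uVec_eq_diagSum (c₁ : ℂ) (L₁ L₂ : ℕ) (v : V) (i n : ℕ) : uVec q c₁ L₁ L₂ v i n
    = diagSum q L₂ v i (L₁ - i + 1) (gammaCoef q c₁ L₁ L₂ i n) := rfl

theorem B₁_uVec [FiniteDimensional ℂ V] (hq : IsGenericQ q) (c₁ : ℂ) {L₁ L₂ : ℕ} {v : V}
    (hv : IsHighestWeightVector q L₁ L₂ v) (i n : ℕ) (hi : i ≤ L₁) :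
    B₁ q c₁ • uVec q c₁ L₁ L₂ v i n = 0 := by
  rw [uVec_eq_diagSum, B₁_diagSum hq c₁ hv _ _ (by omega), diagSum_congr (d := 0), map_zero]
  exact fun k hk l hl => stepCoef_gammaCoef hq c₁ n k l hk hl

theorem mem_kerB₁U {c₁ : ℂ} {L₁ L₂ : ℕ} {v : V} {i : ℕ} {x : V} :
    x ∈ kerB₁U q c₁ L₁ L₂ v i ↔
      B₁ q c₁ • x = 0 ∧ x ∈ LinearMap.range (diagSum q L₂ v i (L₁ - i + 1)) := by
  rw [← layerU_eq_range_diagSum, kerB₁U, Submodule.mem_inf]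
  rfl

theorem uVec_mem_kerB₁U [FiniteDimensional ℂ V] (hq : IsGenericQ q) (c₁ : ℂ) {L₁ L₂ : ℕ} {v : V}
    (hv : IsHighestWeightVector q L₁ L₂ v) (i n : ℕ) (hi : i ≤ L₁) :
    uVec q c₁ L₁ L₂ v i n ∈ kerB₁U q c₁ L₁ L₂ v i :=
  mem_kerB₁U.mpr ⟨B₁_uVec hq c₁ hv i n hi, _, (uVec_eq_diagSum c₁ L₁ L₂ v i n).symm⟩

/-- The top rows of the u^i_n are unit vectors, so coordinates in the family u^i_n can be read off
the top row. -/
theorem sum_gammaCoef_top (c₁ : ℂ) (L₁ L₂ i : ℕ) (t : ℕ → ℂ) (l : ℕ) (hl : l ≤ L₂) :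
    (∑ n ∈ range (L₂ + 1), t n • gammaCoef q c₁ L₁ L₂ i n) (L₁ - i) l = t l := by
  simp only [Finset.sum_apply, Pi.smul_apply, gammaCoef_top, smul_eq_mul, mul_ite, mul_one,
    mul_zero, sum_ite_eq, mem_range]
  rw [if_pos (by omega)]

theorem sum_smul_uVec (c₁ : ℂ) (L₁ L₂ : ℕ) (v : V) (i : ℕ) (t : ℕ → ℂ) :
    ∑ n ∈ range (L₂ + 1), t n • uVec q c₁ L₁ L₂ v i n = diagSum q L₂ v i (L₁ - i + 1)
      (∑ n ∈ range (L₂ + 1), t n • gammaCoef q c₁ L₁ L₂ i n) := by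
  simp only [uVec_eq_diagSum, map_sum, map_smul]

theorem linearIndependent_uVec (hq : IsGenericQ q) (c₁ : ℂ) {L₁ L₂ : ℕ} {v : V}
    (hv : IsHighestWeightVector q L₁ L₂ v) (i : ℕ) (hi : i ≤ L₁) :
    LinearIndependent ℂ (fun n : Fin (L₂ + 1) => uVec q c₁ L₁ L₂ v i n) := by
  rw [Fintype.linearIndependent_iff]
  intro g hg n
  have h : ∑ n ∈ range (L₂ + 1), (if h : n < L₂ + 1 then g ⟨n, h⟩ else 0)
      • uVec q c₁ L₁ L₂ v i n = 0 := by
    rw [sum_range, ← hg]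
    exact sum_congr rfl fun k _ => by rw [dif_pos k.2]
  rw [sum_smul_uVec] at h
  have := eq_zero_of_diagSum_eq_zero hq hv _ _ (by omega) _ h (L₁ - i) (by omega) n (by omega)
  rw [sum_gammaCoef_top _ _ _ _ _ _ (by omega), dif_pos n.2] at this
  exact this

/-- Both sides lie in ker B₁ and have the same top row. -/
theorem eq_sum_uVec_of_B₁ [FiniteDimensional ℂ V] (hq : IsGenericQ q) (c₁ : ℂ) {L₁ L₂ : ℕ} {v : V}
    (hv : IsHighestWeightVector q L₁ L₂ v) (i : ℕ) (hi : i ≤ L₁) (c : ℕ → ℕ → ℂ)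
    (h : B₁ q c₁ • diagSum q L₂ v i (L₁ - i + 1) c = 0) : diagSum q L₂ v i (L₁ - i + 1) c
      = ∑ n ∈ range (L₂ + 1), c (L₁ - i) n • uVec q c₁ L₁ L₂ v i n := by
  rw [← sub_eq_zero, sum_smul_uVec, ← map_sub]
  refine diagSum_eq_zero_of_B₁ hq c₁ hv i (L₁ - i) (by omega) _ ?_ ?_
  · rw [map_sub, ← sum_smul_uVec, smul_sub, h, uq_smul_sum, zero_sub, neg_eq_zero]
    exact sum_eq_zero fun n _ => by rw [B₁_uVec hq c₁ hv i n hi, smul_zero]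
  · intro l hl
    rw [Pi.sub_apply, Pi.sub_apply, sum_gammaCoef_top _ _ _ _ _ _ hl, sub_self]

theorem span_uVec [FiniteDimensional ℂ V] (hq : IsGenericQ q) (c₁ : ℂ) {L₁ L₂ : ℕ} {v : V}
    (hv : IsHighestWeightVector q L₁ L₂ v) (i : ℕ) (hi : i ≤ L₁) :
    Submodule.span ℂ (Set.range fun n : Fin (L₂ + 1) => uVec q c₁ L₁ L₂ v i n)
      = kerB₁U q c₁ L₁ L₂ v i := by
  apply le_antisymm
  · rw [Submodule.span_le]
    rintro _ ⟨n, rfl⟩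
    exact uVec_mem_kerB₁U hq c₁ hv i n hi
  · intro x hx
    obtain ⟨hB, c, rfl⟩ := mem_kerB₁U.mp hx
    rw [eq_sum_uVec_of_B₁ hq c₁ hv i hi c hB]
    exact sum_mem fun n hn => Submodule.smul_mem _ _
      (Submodule.subset_span ⟨⟨n, mem_range.mp hn⟩, rfl⟩)

/-- A vector of `U_i` annihilated by `B₁` vanishes as soon as its top row vanishes. -/
theorem eq_zero_of_mem_range_diagSum [FiniteDimensional ℂ V] (hq : IsGenericQ q) (c₁ : ℂ)
    {L₁ L₂ : ℕ} {v : V} (hv : IsHighestWeightVector q L₁ L₂ v) (i : ℕ) (hi : i ≤ L₁) {x : V}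
    (hx : x ∈ LinearMap.range (diagSum q L₂ v i (L₁ - i))) (hB : B₁ q c₁ • x = 0) : x = 0 := by
  obtain ⟨c, rfl⟩ := hx
  have e : diagSum q L₂ v i (L₁ - i) c
      = diagSum q L₂ v i (L₁ - i + 1) (fun k l => if k < L₁ - i then c k l else 0) := by
    rw [diagSum_succ]
    simp only [lt_irrefl, if_false, zero_smul, sum_const_zero, add_zero]
    exact diagSum_congr _ _ _ _ fun k hk l _ => by rw [if_pos hk]
  rw [e] at hB ⊢
  exact diagSum_eq_zero_of_B₁ hq c₁ hv i _ (by omega) _ hB (fun l _ => by simp)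

end layers

/-! ### The Serre relation of the coideal subalgebra -/

section coideal

open Uq

variable {q : ℂ} {V : Type*} [AddCommGroup V] [Module ℂ V] [Module (Uq q) V]
  [IsScalarTower ℂ (Uq q) V]

/-- The inhomogeneous Serre relation between `B₁` and `B₂`, on a weight vector. -/
theorem IsWt.serre_B₁_B₂ (hq : IsGenericQ q) (c₁ c₂ : ℂ) {r s : ℤ} {x : V} (h : IsWt q r s x) :
    B₁ q c₁ • B₁ q c₁ • B₂ q c₂ • x - (q + q⁻¹) • B₁ q c₁ • B₂ q c₂ • B₁ q c₁ • x
      + B₂ q c₂ • B₁ q c₁ • B₁ q c₁ • x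
      = ((q + q⁻¹) * (c₂ * q ^ (r - s - 2) + c₁ * q ^ (s - r + 1))) • B₁ q c₁ • x := by
  have h0 := hq.ne_zero
  have hE1 := h.E₁_smul h0
  have hE2 := h.E₂_smul h0
  have hF1 := h.F₁_smul h0
  have hF2 := h.F₂_smul h0
  have n1 := h.B₂_smul h0 c₂
  have n2 := h.B₁_smul h0 c₁
  have n3 := hF2.B₁_smul h0 c₁
  have n4 := hE1.B₁_smul h0 c₁
  have n5 := (hF2.F₁_smul h0).B₁_smul h0 c₁
  have n6 := (hF2.E₂_smul h0).B₁_smul h0 c₁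
  have n7 := (hE1.F₁_smul h0).B₁_smul h0 c₁
  have n8 := (hE1.E₂_smul h0).B₁_smul h0 c₁
  have n9 := hF1.B₂_smul h0 c₂
  have n10 := hE2.B₂_smul h0 c₂
  have n11 := (hF1.F₂_smul h0).B₁_smul h0 c₁
  have n12 := (hF1.E₁_smul h0).B₁_smul h0 c₁
  have n13 := (hE2.F₂_smul h0).B₁_smul h0 c₁
  have n14 := (hE2.E₁_smul h0).B₁_smul h0 c₁
  have n15 := hF1.B₁_smul h0 c₁
  have n16 := hE2.B₁_smul h0 c₁
  have n17 := (hF1.F₁_smul h0).B₂_smul h0 c₂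
  have n18 := (hF1.E₂_smul h0).B₂_smul h0 c₂
  have n19 := (hE2.F₁_smul h0).B₂_smul h0 c₂
  have n20 := (hE2.E₂_smul h0).B₂_smul h0 c₂
  have m1 := h.E₁_F₁ h0
  have m2 := h.E₂_F₂ h0
  have m3 := hF1.E₁_F₁ h0
  have m4 := hF1.E₂_F₂ h0
  have m5 := hE2.E₁_F₁ h0
  have m6 := hE2.E₂_F₂ h0
  have sF := serre_F₁_F₂ (q := q) x
  have sE := serre_E₂_E₁ (q := q) x
  have cE2 := fun y : V => E₂_F₁ (q := q) y
  simp only [smul_eq_toEnd] at *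
  -- Every B is expanded at the weight of the vector it meets, and the E-F commutators bring the
  -- words to a common order.
  simp only [n1, n2, n3, n4, n5, n6, n7, n8, n9, n10, n11, n12, n13, n14, n15, n16, n17, n18, n19,
    n20, m1, m2, m3, m4, m5, m6, cE2, map_sub, map_add, map_smul, smul_sub, smul_add]
  -- Each Serre relation eliminates one word; the others are then compared coefficient by
  -- coefficient.
  have e1 : toEnd (F₁ q) (toEnd (F₁ q) (toEnd (F₂ q) x))
      = (q + q⁻¹) • toEnd (F₁ q) (toEnd (F₂ q) (toEnd (F₁ q) x))
        - toEnd (F₂ q) (toEnd (F₁ q) (toEnd (F₁ q) x)) := by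
    rw [← sub_eq_zero, ← sF]; abel
  have e2 : toEnd (E₂ q) (toEnd (E₂ q) (toEnd (E₁ q) x))
      = (q + q⁻¹) • toEnd (E₂ q) (toEnd (E₁ q) (toEnd (E₂ q) x))
        - toEnd (E₁ q) (toEnd (E₂ q) (toEnd (E₂ q) x)) := by
    rw [← sub_eq_zero, ← sE]; abel
  rw [e1, e2]
  have h2 := hq.sq_sub_one_ne_zero
  have hr := zpow_ne_zero r h0
  have hs := zpow_ne_zero s h0
  simp only [qNum_eq, zpow_add₀ h0, zpow_sub₀ h0, zpow_neg, zpow_one, zpow_ofNat]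
  generalize q ^ r = X at *
  generalize q ^ s = Y at *
  match_scalars <;> field_simp <;> ring

end coideal

/-! ### Closed forms for the tridiagonal coefficients -/

section scalars

variable {q : ℂ}

theorem IsGenericQ.one_sub_sq_ne_zero (hq : IsGenericQ q) : 1 - q ^ 2 ≠ 0 := by
  rw [← neg_sub]; exact neg_ne_zero.mpr hq.sq_sub_one_ne_zero

theorem IsGenericQ.one_sub_zpow_ne_zero (hq : IsGenericQ q) {n : ℤ} (hn : n ≠ 0) :
    1 - q ^ n ≠ 0 := sub_ne_zero.mpr (hq.zpow_ne_one _ hn).symm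

theorem qNum_eq_one_sub (hq : IsGenericQ q) (n : ℤ) :
    qNum q n = q * (1 - q ^ (2 * n)) / (q ^ n * (1 - q ^ 2)) := by
  have h0 := hq.ne_zero
  have h2 := hq.sq_sub_one_ne_zero
  have h3 := hq.one_sub_sq_ne_zero
  have hp := zpow_ne_zero n h0
  simp only [qNum_eq, two_mul, zpow_add₀ h0]
  field_simp
  ring

/-- Applied with P = L₂ + L₁ - n and I = L₂ + i - n, so that P - I = L₁ - i. -/
theorem qNum_A (hq : IsGenericQ q) (P I : ℤ) (hP : P + 1 ≠ 0) (hI : I ≠ 0) :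
    qNum q (P - I + 1) / qNum q (P + 1)
      - qNum q (P - I) * qNum q (I - 1) / (qNum q (P + 1) * qNum q I)
      = q ^ I * (1 - q ^ 2) * (1 - q ^ (2 * P)) / ((1 - q ^ (2 * P + 2)) * (1 - q ^ (2 * I))) := by
  have h0 := hq.ne_zero
  have h2 := hq.sq_sub_one_ne_zero
  have h3 := hq.one_sub_sq_ne_zero
  have d1 : 1 - q ^ (2 * P + 2) ≠ 0 := hq.one_sub_zpow_ne_zero (by omega)
  have d2 : 1 - q ^ (2 * I) ≠ 0 := hq.one_sub_zpow_ne_zero (by omega)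
  have hp := zpow_ne_zero P h0
  have hi := zpow_ne_zero I h0
  rw [qNum_eq_one_sub hq (P + 1), qNum_eq_one_sub hq I, show 2 * (P + 1) = 2 * P + 2 by ring]
  have := zpow_ne_zero (P + 1) h0
  field_simp
  simp only [qNum_eq, zpow_add₀ h0, zpow_sub₀ h0, two_mul, zpow_one, zpow_ofNat]
  field_simp
  ring

/-- With M = L₁ - i, the top row of u^i_n contributes q⁻¹[M+1] and the row below it [M]; their
difference collapses to a power of q in C(n) and in the c₁-part of B(n). -/
theorem qNum_succ_sub (hq : IsGenericQ q) (M : ℤ) :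
    q⁻¹ * qNum q (M + 1) - qNum q M = q ^ (-M - 1) := by
  have h0 := hq.ne_zero
  have h2 := hq.sq_sub_one_ne_zero
  have hp := zpow_ne_zero M h0
  simp only [qNum_eq, zpow_add₀ h0, zpow_sub₀ h0, zpow_one, zpow_neg]
  field_simp
  ring

/-- The numerator of the `c₂`-part of the diagonal coefficient. -/
theorem qNum_B (hq : IsGenericQ q) (L₁ L₂ n i : ℤ)
    (h : L₂ + L₁ - n ≠ 0) (h' : L₂ + L₁ - n + 1 ≠ 0) :
    qNum q (L₁ - i) * qNum q (n + 1) * qNum q (L₂ - n) / qNum q (L₂ + L₁ - n)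
      - qNum q L₁ * qNum q (L₂ + L₁ + 1) / qNum q (L₂ + L₁ - n + 1)
        * (qNum q (L₂ + i - n) / qNum q (L₂ + L₁ - n))
      - qNum q n * qNum q (L₂ - n + 1) * qNum q (L₁ - i + 1) / qNum q (L₂ + L₁ - n + 1)
      = -qNum q (n + i) := by
  have h0 := hq.ne_zero
  have h2 := hq.sq_sub_one_ne_zero
  have e1 := hq.qNum_ne_zero h
  have e2 := hq.qNum_ne_zero h'
  field_simp
  simp only [qNum_eq, zpow_add₀ h0, zpow_sub₀ h0, zpow_one]
  have := zpow_ne_zero L₁ h0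
  have := zpow_ne_zero L₂ h0
  have := zpow_ne_zero n h0
  have := zpow_ne_zero i h0
  generalize q ^ L₁ = X at *
  generalize q ^ L₂ = Y at *
  generalize q ^ n = T at *
  generalize q ^ i = Z at *
  field_simp
  ring

theorem qNum_B_degenerate (hq : IsGenericQ q) (L₁ L₂ n i : ℕ) (hn : n ≤ L₂) (hi : i ≤ L₁) :
    qNum q (L₁ - i) * qNum q (n + 1) * qNum q (L₂ - n) / qNum q (L₂ + L₁ - n)
      - qNum q L₁ * qNum q (L₂ + L₁ + 1) / qNum q (L₂ + L₁ - n + 1)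
        * (qNum q (L₂ + i - n) / qNum q (L₂ + L₁ - n))
      - qNum q n * qNum q (L₂ - n + 1) * qNum q (L₁ - i + 1) / qNum q (L₂ + L₁ - n + 1)
      = -qNum q (n + i) := by
  -- The denominator vanishes only for n = L₂ and L₁ = i = 0. There the affected quotients are 0
  -- under division by zero, and the identity still holds.
  by_cases h : (L₂ : ℤ) + L₁ - n = 0
  · obtain rfl : n = L₂ := by omega
    obtain rfl : L₁ = 0 := by omega
    obtain rfl : i = 0 := by omega
    simp [hq.qNum_one]
  · exact qNum_B hq _ _ _ _ h (by omega)

theorem triA_eq (hq : IsGenericQ q) (L₁ L₂ i n : ℕ) (hn : n < L₂) :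
    triA q L₁ L₂ i n = qNum q (L₁ - i + 1) / qNum q (L₂ + L₁ - n + 1)
      - qNum q (L₁ - i) * qNum q (L₂ + i - n - 1)
        / (qNum q (L₂ + L₁ - n + 1) * qNum q (L₂ + i - n)) := by
  have := qNum_A hq (L₂ + L₁ - n) (L₂ + i - n) (by omega) (by omega)
  rw [show (L₂ : ℤ) + L₁ - n - (L₂ + i - n) = L₁ - i by ring] at this
  rw [this, triA]
  congr 4 <;> ring

theorem triB_eq (hq : IsGenericQ q) (c₁ c₂ : ℂ) (L₁ L₂ i n : ℕ) :
    triB q c₁ c₂ L₁ L₂ i n = -c₁ * q ^ ((n : ℤ) + i) * qNum q (L₂ + i - n) * q ^ ((i : ℤ) - L₁ - 1)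
      - c₂ * q ^ (-((L₂ : ℤ) + 2 * i - n - L₁)) * qNum q (n + i) := by
  have h0 := hq.ne_zero
  have h2 := hq.sq_sub_one_ne_zero
  have h3 := hq.one_sub_sq_ne_zero
  simp only [triB, qNum_eq, zpow_add₀ h0, zpow_sub₀ h0, zpow_one, two_mul, zpow_neg, neg_add,
    neg_mul, neg_sub, zpow_natCast, zpow_ofNat]
  have := pow_ne_zero L₁ h0
  have := pow_ne_zero L₂ h0
  have := pow_ne_zero n h0
  have := pow_ne_zero i h0
  generalize q ^ L₁ = X at *
  generalize q ^ L₂ = Y at *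
  generalize q ^ n = T at *
  generalize q ^ i = Z at *
  field_simp
  ring

theorem triC_eq (hq : IsGenericQ q) (c₁ c₂ : ℂ) (L₁ L₂ i n : ℕ) (hn : n ≤ L₂) :
    triC q c₁ c₂ L₁ L₂ i n = c₁ * c₂ * q ^ ((n : ℤ) + i - 1 - (L₂ + 2 * i - n - L₁))
      * (qNum q n * qNum q (L₂ + L₁ - n + 2) * qNum q (L₂ - n + 1) * qNum q (L₂ + i - n + 1)
        / qNum q (L₂ + L₁ - n + 1)) * q ^ ((i : ℤ) - L₁ - 1) := by
  have h0 := hq.ne_zero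
  have h3 := hq.one_sub_sq_ne_zero
  have d1 : 1 - q ^ (2 * ((L₂ : ℤ) + L₁ - n + 1)) ≠ 0 := hq.one_sub_zpow_ne_zero (by omega)
  have e1 : 2 * (L₂ : ℤ) + 2 * L₁ + 2 - 2 * n = 2 * ((L₂ : ℤ) + L₁ - n + 1) := by ring
  have e2 : 2 * (L₁ : ℤ) + 2 * L₂ - 2 * n + 4 = 2 * ((L₂ : ℤ) + L₁ - n + 2) := by ring
  have e3 : 2 * (L₂ : ℤ) - 2 * n + 2 = 2 * ((L₂ : ℤ) - n + 1) := by ring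
  have e4 : 2 * (L₂ : ℤ) + 2 * i + 2 - 2 * n = 2 * ((L₂ : ℤ) + i - n + 1) := by ring
  have e5 : q ^ (2 * n) = q ^ (2 * (n : ℤ)) := by
    rw [← zpow_natCast]; push_cast; rfl
  rw [triC, e1, e2, e3, e4, e5, qNum_eq_one_sub hq n, qNum_eq_one_sub hq ((L₂ : ℤ) + L₁ - n + 2),
    qNum_eq_one_sub hq ((L₂ : ℤ) - n + 1), qNum_eq_one_sub hq ((L₂ : ℤ) + i - n + 1),
    qNum_eq_one_sub hq ((L₂ : ℤ) + L₁ - n + 1)]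
  generalize 1 - q ^ (2 * ((L₂ : ℤ) + L₁ - n + 1)) = d at *
  generalize 1 - q ^ (2 * ((L₂ : ℤ) + L₁ - n + 2)) = d2 at *
  generalize 1 - q ^ (2 * ((L₂ : ℤ) - n + 1)) = d3 at *
  generalize 1 - q ^ (2 * ((L₂ : ℤ) + i - n + 1)) = d4 at *
  generalize 1 - q ^ (2 * (n : ℤ)) = d5 at *
  simp only [zpow_add₀ h0, zpow_sub₀ h0, zpow_one, two_mul, zpow_neg, neg_add,
    neg_mul, neg_sub, zpow_natCast, zpow_ofNat, show (3 : ℤ) = 1 + 1 + 1 by rfl, add_mul, one_mul]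
  have := pow_ne_zero L₁ h0
  have := pow_ne_zero L₂ h0
  have := pow_ne_zero n h0
  have := pow_ne_zero i h0
  generalize q ^ L₁ = X at *
  generalize q ^ L₂ = Y at *
  generalize q ^ n = T at *
  generalize q ^ i = Z at *
  field_simp

end scalars

/-! ### C₁ and B₁B₂ on the rows of U_i -/

section rows

open Uq

variable {q : ℂ} {V : Type*} [AddCommGroup V] [Module ℂ V] [Module (Uq q) V]
  [IsScalarTower ℂ (Uq q) V]

/-- K acts on the whole layer by the single scalar q^(L₁-L₂-3i), since the difference of the two
weights depends on neither k nor l. -/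
theorem C₁_smul_of_mem_range_diagSum (hq : IsGenericQ q) (c₁ c₂ : ℂ) {L₁ L₂ : ℕ} {v : V}
    (hv : IsHighestWeightVector q L₁ L₂ v) (i N : ℕ) {x : V}
    (hx : x ∈ LinearMap.range (diagSum q L₂ v i N)) :
    C₁ q c₁ c₂ • x = B₁ q c₁ • B₂ q c₂ • x - q • B₂ q c₂ • B₁ q c₁ • x
      + triD q c₁ c₂ L₁ L₂ i • x := by
  obtain ⟨c, rfl⟩ := hx
  rw [diagSum_apply]
  simp only [smul_eq_toEnd, map_sum, map_smul, smul_sum, ← sum_add_distrib, ← sum_sub_distrib]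
  refine sum_congr rfl fun k _ => sum_congr rfl fun l _ => ?_
  have h := (isWt_mudrovVec hq hv k l (k + i)).C₁_smul hq.ne_zero c₁ c₂
  have e1 : (L₁ : ℤ) - l - 2 * (k + i : ℕ) + k - (L₂ + (k + i : ℕ) - l - 2 * k) = L₁ - L₂ - 3 * i := by
    push_cast; ring
  have e2 : (L₂ : ℤ) + (k + i : ℕ) - l - 2 * k - (L₁ - l - 2 * (k + i : ℕ) + k) = L₂ - L₁ + 3 * i := by
    push_cast; ring
  rw [e1, e2] at h
  simp only [smul_eq_toEnd] at h
  rw [h, triD]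
  module

theorem serre_B₁_B₂_of_mem_range_diagSum (hq : IsGenericQ q) (c₁ c₂ : ℂ) {L₁ L₂ : ℕ} {v : V}
    (hv : IsHighestWeightVector q L₁ L₂ v) (i N : ℕ) :
    ∃ t : ℂ, ∀ x ∈ LinearMap.range (diagSum q L₂ v i N),
      B₁ q c₁ • B₁ q c₁ • B₂ q c₂ • x - (q + q⁻¹) • B₁ q c₁ • B₂ q c₂ • B₁ q c₁ • x
        + B₂ q c₂ • B₁ q c₁ • B₁ q c₁ • x = t • B₁ q c₁ • x := by
  refine ⟨(q + q⁻¹) * (c₂ * q ^ ((L₁ : ℤ) - L₂ - 3 * i - 2)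
    + c₁ * q ^ ((L₂ : ℤ) - L₁ + 3 * i + 1)), ?_⟩
  rintro _ ⟨c, rfl⟩
  rw [diagSum_apply]
  simp only [smul_eq_toEnd, map_sum, map_smul, smul_sum, ← sum_add_distrib, ← sum_sub_distrib]
  refine sum_congr rfl fun k _ => sum_congr rfl fun l _ => ?_
  have h := (isWt_mudrovVec hq hv k l (k + i)).serre_B₁_B₂ hq c₁ c₂
  have e1 : (L₁ : ℤ) - l - 2 * (k + i : ℕ) + k - (L₂ + (k + i : ℕ) - l - 2 * k) = L₁ - L₂ - 3 * i := by
    push_cast; ring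
  have e2 : (L₂ : ℤ) + (k + i : ℕ) - l - 2 * k - (L₁ - l - 2 * (k + i : ℕ) + k) = L₂ - L₁ + 3 * i := by
    push_cast; ring
  rw [e1, e2] at h
  simp only [smul_eq_toEnd] at h
  linear_combination (norm := module) c k l • h

/-- When B₁x = 0, every term of the Serre relation except B₁B₁B₂x contains B₁x. -/
theorem B₁_C₁_eq_zero (hq : IsGenericQ q) (c₁ c₂ : ℂ) {L₁ L₂ : ℕ} {v : V}
    (hv : IsHighestWeightVector q L₁ L₂ v) (i N : ℕ) {x : V}
    (hx : x ∈ LinearMap.range (diagSum q L₂ v i N)) (hB : B₁ q c₁ • x = 0) :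
    B₁ q c₁ • C₁ q c₁ c₂ • x = 0 := by
  obtain ⟨t, ht⟩ := serre_B₁_B₂_of_mem_range_diagSum hq c₁ c₂ hv i N
  have h := ht x hx
  rw [C₁_smul_of_mem_range_diagSum hq c₁ c₂ hv i N hx]
  simp only [hB, smul_zero, sub_zero, add_zero, smul_add, smul_comm (B₁ q c₁) (_ : ℂ)] at h ⊢
  exact h

theorem B₂_mudrovVec (hq : IsGenericQ q) (c₂ : ℂ) {L₁ L₂ : ℕ} {v : V}
    (hv : IsHighestWeightVector q L₁ L₂ v) (k l m : ℕ) (hl : l ≤ L₂) :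
    B₂ q c₂ • mudrovVec q v k l m = mudrovVec q v (k + 1) l m
      - (c₂ * q ^ (-((L₂ : ℤ) + m - l - 2 * k))) • (coefα q L₁ L₂ l m • mudrovVec q v k l (m - 1)
        + coefβ q L₁ L₂ l m • mudrovVec q v (k + 1) (l - 1) m) := by
  rw [(isWt_mudrovVec hq hv k l m).B₂_smul hq.ne_zero, E₁_mudrovVec hq hv k l m hl,
    mudrovVec_succ_left v k l m]

/-- `B₁B₂` on `F₂^k F̂₃^l F₁^(k+i) v`, modulo the rows below the `k`-th. -/
theorem B₁_B₂_mudrovVec [FiniteDimensional ℂ V] (hq : IsGenericQ q) (c₁ c₂ : ℂ) {L₁ L₂ : ℕ} {v : V}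
    (hv : IsHighestWeightVector q L₁ L₂ v) (i k l : ℕ) (hl : l ≤ L₂) :
    B₁ q c₁ • B₂ q c₂ • mudrovVec q v k l (k + i)
      - (coefa q L₂ (k + 1) l (k + i) • mudrovVec q v (k + 1) l (k + 1 + i)
        - (c₂ * q ^ (-((L₂ : ℤ) + i - l - k)) * coefβ q L₁ L₂ l (k + i)
            * coefa q L₂ (k + 1) (l - 1) (k + i)) • mudrovVec q v (k + 1) (l - 1) (k + 1 + i)
        + coefb q L₂ (k + 1) l (k + i) • mudrovVec q v k (l + 1) (k + i)
        + (-(c₁ * q ^ ((l : ℤ) + k + 2 * i - 1 - L₁) * coefη q L₂ (k + 1) l (k + i))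
            - c₂ * q ^ (-((L₂ : ℤ) + i - l - k)) *
              (coefα q L₁ L₂ l (k + i) * coefa q L₂ k l (k + i - 1)
              + coefβ q L₁ L₂ l (k + i) * coefb q L₂ (k + 1) (l - 1) (k + i)))
          • mudrovVec q v k l (k + i)
        + (c₁ * c₂ * q ^ (-((L₂ : ℤ) + i - l - k)) * coefβ q L₁ L₂ l (k + i)
            * q ^ ((l : ℤ) + k + 2 * i - 2 - L₁) * coefη q L₂ (k + 1) (l - 1) (k + i))
          • mudrovVec q v k (l - 1) (k + i)) ∈ LinearMap.range (diagSum q L₂ v i k) := by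
  -- In B₁ applied to the α-part of B₂, only the F₁-term that keeps k stays in row k; the others lie
  -- in row k - 1.
  have hα : coefα q L₁ L₂ l (k + i) • B₁ q c₁ • mudrovVec q v k l (k + i - 1)
      - (coefα q L₁ L₂ l (k + i) * coefa q L₂ k l (k + i - 1)) • mudrovVec q v k l (k + i)
      ∈ LinearMap.range (diagSum q L₂ v i k) := by
    -- For k + i = 0 the exponent k + i - 1 truncates, but α carries the factor [k+i] = 0.
    rcases Nat.eq_zero_or_pos (k + i) with h0 | hpos
    · have : coefα q L₁ L₂ l (k + i) = 0 := by
        have : (k : ℤ) + i = 0 := by omega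
        rw [coefα, this]; simp
      rw [this]; simp
    · have hc : ((k + i - 1 : ℕ) : ℤ) = k + i - 1 := by omega
      rw [B₁_mudrovVec hq c₁ hv _ _ _ (by omega), Nat.sub_add_cancel hpos, hc]
      have hk0 : coefb q L₂ (0 : ℕ) l ((0 : ℕ) + i - 1) = 0 := by simp [coefb_eq hq]
      have hη0 : coefη q L₂ (0 : ℕ) l ((0 : ℕ) + i - 1) = 0 := by simp [coefη_eq]
      have h1 : coefb q L₂ k l (k + i - 1) • mudrovVec q v (k - 1) (l + 1) (k + i - 1)
          ∈ LinearMap.range (diagSum q L₂ v i k) := by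
        rcases k with _ | k
        · rw [hk0]; simp
        · refine Submodule.smul_mem _ _ ?_
          rw [show k + 1 + i - 1 = k + i by omega, Nat.add_sub_cancel]
          rcases Nat.lt_or_ge l L₂ with h | h
          · exact mudrovVec_mem_range_diagSum L₂ v i _ k (l + 1) (by omega) (by omega)
          · obtain rfl : l = L₂ := by omega
            rw [mudrovVec_eq_zero_of_lt_left hq hv]
            exact zero_mem _
      have h2 : coefη q L₂ k l (k + i - 1) • mudrovVec q v (k - 1) l (k + i - 1)
          ∈ LinearMap.range (diagSum q L₂ v i k) := by
        rcases k with _ | k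
        · rw [hη0]; simp
        · refine Submodule.smul_mem _ _ ?_
          rw [show k + 1 + i - 1 = k + i by omega, Nat.add_sub_cancel]
          exact mudrovVec_mem_range_diagSum L₂ v i _ k l (by omega) (by omega)
      have h3 := Submodule.smul_mem _ (coefα q L₁ L₂ l (k + i)) (Submodule.sub_mem _ h1
        (Submodule.smul_mem _ (c₁ * q ^ ((l : ℤ) + 2 * (k + i - 1) - k - L₁)) h2))
      convert h3 using 1
      module
  have hβ : coefβ q L₁ L₂ l (k + i) • B₁ q c₁ • mudrovVec q v (k + 1) (l - 1) (k + i)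
      = (coefβ q L₁ L₂ l (k + i) * coefa q L₂ (k + 1) (l - 1) (k + i))
          • mudrovVec q v (k + 1) (l - 1) (k + 1 + i)
        + (coefβ q L₁ L₂ l (k + i) * coefb q L₂ (k + 1) (l - 1) (k + i))
          • mudrovVec q v k l (k + i)
        - (coefβ q L₁ L₂ l (k + i) * (c₁ * q ^ ((l : ℤ) + k + 2 * i - 2 - L₁)
          * coefη q L₂ (k + 1) (l - 1) (k + i))) • mudrovVec q v k (l - 1) (k + i) := by
    rcases l with _ | l
    · simp [coefβ]
    · rw [Nat.add_sub_cancel, B₁_mudrovVec hq c₁ hv _ _ _ (by omega), Nat.add_sub_cancel]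
      rw [show k + i + 1 = k + 1 + i by ring,
        show (l : ℤ) + 2 * (k + i : ℕ) - (k + 1 : ℕ) - L₁ = (l + 1 : ℕ) + k + 2 * i - 2 - L₁ by
          push_cast; ring]
      push_cast
      rw [show (l : ℤ) + 1 - 1 = l by ring]
      module
  have hγ : B₁ q c₁ • mudrovVec q v (k + 1) l (k + i)
      = coefa q L₂ (k + 1) l (k + i) • mudrovVec q v (k + 1) l (k + 1 + i)
        + coefb q L₂ (k + 1) l (k + i) • mudrovVec q v k (l + 1) (k + i)
        - (c₁ * q ^ ((l : ℤ) + k + 2 * i - 1 - L₁) * coefη q L₂ (k + 1) l (k + i))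
          • mudrovVec q v k l (k + i) := by
    rw [B₁_mudrovVec hq c₁ hv _ _ _ (by omega), Nat.add_sub_cancel,
      show k + i + 1 = k + 1 + i by ring,
      show (l : ℤ) + 2 * (k + i : ℕ) - (k + 1 : ℕ) - L₁ = l + k + 2 * i - 1 - L₁ by
        push_cast; ring]
    push_cast
    rfl
  rw [B₂_mudrovVec hq c₂ hv k l _ hl,
    show -((L₂ : ℤ) + (k + i : ℕ) - l - 2 * k) = -((L₂ : ℤ) + i - l - k) by push_cast; ring]
  have hα' := Submodule.smul_mem _ (-(c₂ * q ^ (-((L₂ : ℤ) + i - l - k)))) hα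
  convert hα' using 1
  rw [smul_sub, smul_comm (B₁ q c₁) (_ : ℂ), smul_add, smul_comm (B₁ q c₁) (_ : ℂ),
    smul_comm (B₁ q c₁) (_ : ℂ)]
  push_cast
  rw [hβ, hγ]
  simp only [smul_eq_toEnd]
  module

theorem B₁_B₂_mem_range_diagSum [FiniteDimensional ℂ V] (hq : IsGenericQ q) (c₁ c₂ : ℂ) {L₁ L₂ : ℕ}
    {v : V} (hv : IsHighestWeightVector q L₁ L₂ v) (i N : ℕ) {x : V}
    (hx : x ∈ LinearMap.range (diagSum q L₂ v i N)) :
    B₁ q c₁ • B₂ q c₂ • x ∈ LinearMap.range (diagSum q L₂ v i (N + 1)) := by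
  obtain ⟨c, rfl⟩ := hx
  rw [diagSum_apply]
  simp only [smul_eq_toEnd, map_sum, map_smul]
  refine Submodule.sum_mem _ fun k hk => Submodule.sum_mem _ fun l hl => Submodule.smul_mem _ _ ?_
  have hk := mem_range.mp hk
  have hl : l ≤ L₂ := by have := mem_range.mp hl; omega
  have h := range_diagSum_mono L₂ v i (show k ≤ N + 1 by omega)
    (B₁_B₂_mudrovVec hq c₁ c₂ hv i k l hl)
  refine (Submodule.sub_mem_iff_left _ ?_).mp h
  have hmem : ∀ k' l', k' < N + 1 → l' ≤ L₂ + 1 →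
      mudrovVec q v k' l' (k' + i) ∈ LinearMap.range (diagSum q L₂ v i (N + 1)) := by
    intro k' l' hk' hl'
    rcases Nat.lt_or_ge L₂ l' with h | h
    · obtain rfl : l' = L₂ + 1 := by omega
      rw [mudrovVec_eq_zero_of_lt_left hq hv]
      exact zero_mem _
    · exact mudrovVec_mem_range_diagSum L₂ v i _ k' l' hk' h
  refine Submodule.add_mem _ (Submodule.add_mem _ (Submodule.add_mem _ (Submodule.sub_mem _ ?_ ?_)
    ?_) ?_) ?_ <;> exact Submodule.smul_mem _ _ (hmem _ _ (by omega) (by omega))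

end rows

/-! ### Top row of B₁B₂ u^i_n -/

section tridiagonal

open Uq

variable {q : ℂ}

/-- The coefficient of row `L₁ - i - 1` of `u^i_n`, and zero if there is no such row. -/
theorem gammaCoef_pred_top (c₁ : ℂ) (M L₂ i n l : ℕ) :
    gammaCoef q c₁ (M + 1 + i) L₂ i n M l
      = (c₁ * q ^ ((l : ℤ) + i) * coefη q L₂ (M + 1) l (M + 1 + i) * (if l = n then 1 else 0)
          - (if l = 0 then 0 else
              coefb q L₂ (M + 1) (l - 1) (M + 1 + i) * if l - 1 = n then 1 else 0))
        / coefa q L₂ M l (M + i) := by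
  rw [gammaCoef, show M + 1 + i - i - M = 0 + 1 by omega, gammaDown, gammaDown, gammaDown]
  have e : ((M + 1 + i : ℕ) : ℤ) - i - ((0 : ℕ) + 1) = M := by push_cast; ring
  simp only [e]
  rw [show (l : ℤ) + 2 * i + M + 1 - (M + 1 + i : ℕ) = l + i by push_cast; ring,
    show (M : ℤ) + i + 1 = M + 1 + i by ring]

end tridiagonal

section top

open Uq

variable {q : ℂ} {V : Type*} [AddCommGroup V] [Module ℂ V] [Module (Uq q) V]
  [IsScalarTower ℂ (Uq q) V]

theorem uVec_sub_top_mem (c₁ : ℂ) (L₁ L₂ : ℕ) (v : V) (i n : ℕ) (hi : i ≤ L₁) (hn : n ≤ L₂) :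
    uVec q c₁ L₁ L₂ v i n - mudrovVec q v (L₁ - i) n L₁
      ∈ LinearMap.range (diagSum q L₂ v i (L₁ - i)) := by
  rw [uVec_eq_diagSum, diagSum_succ, sum_eq_single_of_mem n (mem_range.mpr (by omega))
    (fun l _ hl => by rw [gammaCoef_top, if_neg hl, zero_smul]), gammaCoef_top, if_pos rfl, one_smul,
    Nat.sub_add_cancel hi, add_sub_cancel_right]
  exact ⟨_, rfl⟩

/-- Column L₂ + 1 is admitted because its vectors vanish; this spares a case split wherever F₁
raises l. -/
theorem mudrovVec_mem_range_diagSum_of_le_succ [FiniteDimensional ℂ V] (hq : IsGenericQ q)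
    {L₁ L₂ : ℕ} {v : V} (hv : IsHighestWeightVector q L₁ L₂ v) (i N k l : ℕ) (hk : k < N)
    (hl : l ≤ L₂ + 1) : mudrovVec q v k l (k + i) ∈ LinearMap.range (diagSum q L₂ v i N) := by
  rcases Nat.lt_or_ge L₂ l with h | h
  · obtain rfl : l = L₂ + 1 := by omega
    rw [mudrovVec_eq_zero_of_lt_left hq hv]
    exact zero_mem _
  · exact mudrovVec_mem_range_diagSum L₂ v i _ k l hk h

/-- `B₁B₂` on `F₂^k F̂₃^l F₁^(k+i) v`, modulo the `k`-th row and the rows below it. -/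
theorem B₁_B₂_mudrovVec_succ [FiniteDimensional ℂ V] (hq : IsGenericQ q) (c₁ c₂ : ℂ) {L₁ L₂ : ℕ}
    {v : V} (hv : IsHighestWeightVector q L₁ L₂ v) (i k l : ℕ) (hl : l ≤ L₂) :
    B₁ q c₁ • B₂ q c₂ • mudrovVec q v k l (k + i)
      - (coefa q L₂ (k + 1) l (k + i) • mudrovVec q v (k + 1) l (k + 1 + i)
        - (c₂ * q ^ (-((L₂ : ℤ) + i - l - k)) * coefβ q L₁ L₂ l (k + i)
            * coefa q L₂ (k + 1) (l - 1) (k + i)) • mudrovVec q v (k + 1) (l - 1) (k + 1 + i))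
      ∈ LinearMap.range (diagSum q L₂ v i (k + 1)) := by
  have h := range_diagSum_mono L₂ v i (Nat.le_succ k) (B₁_B₂_mudrovVec hq c₁ c₂ hv i k l hl)
  have hm := fun l' (hl' : l' ≤ L₂ + 1) =>
    mudrovVec_mem_range_diagSum_of_le_succ hq hv i (k + 1) k l' (by omega) hl'
  have h1 := Submodule.smul_mem _ (coefb q L₂ (k + 1) l (k + i)) (hm (l + 1) (by omega))
  have h2 := Submodule.smul_mem _ (-(c₁ * q ^ ((l : ℤ) + k + 2 * i - 1 - L₁)
      * coefη q L₂ (k + 1) l (k + i)) - c₂ * q ^ (-((L₂ : ℤ) + i - l - k)) *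
      (coefα q L₁ L₂ l (k + i) * coefa q L₂ k l (k + i - 1)
        + coefβ q L₁ L₂ l (k + i) * coefb q L₂ (k + 1) (l - 1) (k + i))) (hm l (by omega))
  have h3 := Submodule.smul_mem _ (c₁ * c₂ * q ^ (-((L₂ : ℤ) + i - l - k))
    * coefβ q L₁ L₂ l (k + i) * q ^ ((l : ℤ) + k + 2 * i - 2 - L₁)
    * coefη q L₂ (k + 1) (l - 1) (k + i)) (hm (l - 1) (by omega))
  have h4 := Submodule.add_mem _ h (Submodule.add_mem _ (Submodule.add_mem _ h1 h2) h3)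
  convert h4 using 1
  abel

/-- The two top rows of `u^i_n`. -/
theorem uVec_sub_top_sub_mem [FiniteDimensional ℂ V] (hq : IsGenericQ q) (c₁ : ℂ) {p L₂ : ℕ} {v : V}
    (i : ℕ) (hv : IsHighestWeightVector q (p + 1 + i) L₂ v) (n : ℕ) (hn : n ≤ L₂) :
    uVec q c₁ (p + 1 + i) L₂ v i n - mudrovVec q v (p + 1) n (p + 1 + i)
      - ((c₁ * q ^ ((n : ℤ) + i) * coefη q L₂ (p + 1) n (p + 1 + i) / coefa q L₂ p n (p + i))
          • mudrovVec q v p n (p + i)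
        - (coefb q L₂ (p + 1) n (p + 1 + i) / coefa q L₂ p (n + 1) (p + i))
          • mudrovVec q v p (n + 1) (p + i))
      ∈ LinearMap.range (diagSum q L₂ v i p) := by
  rw [uVec_eq_diagSum, diagSum_succ, sum_eq_single_of_mem n (mem_range.mpr (by omega))
    (fun l _ hl => by rw [gammaCoef_top, if_neg hl, zero_smul]), gammaCoef_top, if_pos rfl, one_smul,
    show p + 1 + i - i = p + 1 by omega, add_sub_cancel_right, diagSum_succ]
  have hrow : ∑ l ∈ range (L₂ + 1), gammaCoef q c₁ (p + 1 + i) L₂ i n p l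
        • mudrovVec q v p l (p + i)
      = (c₁ * q ^ ((n : ℤ) + i) * coefη q L₂ (p + 1) n (p + 1 + i) / coefa q L₂ p n (p + i))
          • mudrovVec q v p n (p + i)
        - (coefb q L₂ (p + 1) n (p + 1 + i) / coefa q L₂ p (n + 1) (p + i))
          • mudrovVec q v p (n + 1) (p + i) := by
    -- One step of the recursion from a unit vector in column n reaches only columns n (through
    -- c₁E₂) and n + 1 (through F₁).
    have hsplit : ∀ l : ℕ, gammaCoef q c₁ (p + 1 + i) L₂ i n p l • mudrovVec q v p l (p + i)
        = (if l = n then (c₁ * q ^ ((n : ℤ) + i) * coefη q L₂ (p + 1) n (p + 1 + i)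
            / coefa q L₂ p n (p + i)) • mudrovVec q v p n (p + i) else 0)
          - (if l = n + 1 then (coefb q L₂ (p + 1) n (p + 1 + i) / coefa q L₂ p (n + 1) (p + i))
            • mudrovVec q v p (n + 1) (p + i) else 0) := by
      intro l
      rw [gammaCoef_pred_top]
      rcases eq_or_ne l n with rfl | h1
      · rcases l with _ | l
        · simp
        · simp
      · rcases eq_or_ne l (n + 1) with rfl | h2
        · simp [neg_div]
        · rcases l with _ | l
          · simp [h1, h2]
          · have : l ≠ n := fun h => h2 (by rw [h])
            simp [h1, h2, this]
    simp only [hsplit, sum_sub_distrib, sum_ite_eq', mem_range]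
    rw [if_pos (by omega)]
    congr 1
    split_ifs with h
    · rfl
    · obtain rfl : n = L₂ := by omega
      rw [mudrovVec_eq_zero_of_lt_left hq hv, smul_zero]
  rw [hrow, add_sub_cancel_right]
  exact ⟨_, rfl⟩

/-- The contribution of the lower rows of `u^i_n` to the top coefficients of `B₁B₂ u^i_n`. -/
theorem B₁_B₂_uVec_sub_top [FiniteDimensional ℂ V] (hq : IsGenericQ q) (c₁ c₂ : ℂ) {M L₂ : ℕ} {v : V}
    (i : ℕ) (hv : IsHighestWeightVector q (M + i) L₂ v) (n : ℕ) (hn : n ≤ L₂) :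
    B₁ q c₁ • B₂ q c₂ • (uVec q c₁ (M + i) L₂ v i n - mudrovVec q v M n (M + i))
      - ((-(qNum q M * qNum q (L₂ + i - n - 1)
              / (qNum q (L₂ + M + i - n + 1) * qNum q (L₂ + i - n))))
          • mudrovVec q v M (n + 1) (M + i)
        + (c₁ * q ^ ((n : ℤ) + i) * (qNum q (L₂ + i - n) * qNum q M)
          + c₂ * q ^ (-((L₂ : ℤ) + i - n - M)) *
            (qNum q M * qNum q (n + 1) * qNum q (L₂ - n) / qNum q (L₂ + M + i - n)))
          • mudrovVec q v M n (M + i)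
        + (c₁ * c₂ * q ^ ((n : ℤ) + i - 1 - (L₂ + i - n - M))
            * (qNum q n * qNum q (L₂ + M + i - n + 2) * qNum q (L₂ - n + 1)
              * qNum q (L₂ + i - n + 1) / qNum q (L₂ + M + i - n + 1)) * -qNum q M)
          • mudrovVec q v M (n - 1) (M + i)) ∈ LinearMap.range (diagSum q L₂ v i M) := by
  have h0 := hq.ne_zero
  -- For M = 0 there is no lower row: u^i_n equals its top vector, and all listed coefficients
  -- vanish or multiply [0].
  rcases M with _ | p
  · have := uVec_sub_top_mem (q := q) c₁ (0 + i) L₂ v i n (by omega) hn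
    rw [show 0 + i - i = 0 by omega] at this
    obtain ⟨c, hc⟩ := this
    rw [← hc]
    simp [diagSum_apply]
  -- Rows below p are raised at most to row p, hence stay below the top row M = p + 1; only the
  -- entries of row p in columns n and n + 1 remain.
  have hu := B₁_B₂_mem_range_diagSum hq c₁ c₂ hv i p (uVec_sub_top_sub_mem hq c₁ i hv n hn)
  have hN := B₁_B₂_mudrovVec_succ hq c₁ c₂ hv i p n hn
  have hI := hq.qNum_ne_zero (show (L₂ : ℤ) + i - n + 1 ≠ 0 by omega)
  have hP := hq.qNum_ne_zero (show (L₂ : ℤ) + p + i - n + 1 ≠ 0 by omega)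
  have hP1 := hq.qNum_ne_zero (show (L₂ : ℤ) + p + i - n + 2 ≠ 0 by omega)
  have a1 : coefa q L₂ p n (p + i)
      = qNum q (L₂ + i - n + 1) / qNum q (L₂ + p + i - n + 1) := by
    rw [coefa_eq hq]; congr 2 <;> ring
  have a2 : coefa q L₂ (p + 1) n (p + i)
      = qNum q (L₂ + i - n) / qNum q (L₂ + p + i - n + 1) := by
    rw [coefa_eq hq]; congr 2 <;> ring
  have a3 : coefη q L₂ (p + 1) n (p + 1 + i)
      = qNum q (p + 1) * qNum q (L₂ + i - n + 1) := by
    rw [coefη_eq]; congr 2; ring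
  have a4 : coefβ q (p + 1 + i) L₂ n (p + i) = qNum q n * qNum q (L₂ + p + i - n + 3)
      * qNum q (L₂ - n + 1) / qNum q (L₂ + p + i - n + 1) := by
    rw [coefβ]; push_cast; ring_nf
  have a5 : coefa q L₂ (p + 1) (n - 1) (p + i)
      = qNum q (L₂ + i - n + 1) / qNum q (L₂ + p + i - n + 2) := by
    rw [coefa_eq hq]; congr 2 <;> ring
  have z1 : q ^ ((n : ℤ) + i) * q ^ (-((L₂ : ℤ) + i - n - p))
      = q ^ ((n : ℤ) + i - 1 - (L₂ + i - n - (p + 1))) := by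
    rw [← zpow_add₀ h0]; congr 1; ring
  have hN' := Submodule.smul_mem _ (c₁ * q ^ ((n : ℤ) + i) * coefη q L₂ (p + 1) n (p + 1 + i)
    / coefa q L₂ p n (p + i)) hN
  have hsum := Submodule.add_mem _ hu hN'
  have p2 : c₁ * q ^ ((n : ℤ) + i) * coefη q L₂ (p + 1) n (p + 1 + i) / coefa q L₂ p n (p + i)
      * coefa q L₂ (p + 1) n (p + i)
      = c₁ * q ^ ((n : ℤ) + i) * (qNum q (L₂ + i - n) * qNum q (p + 1)) := by
    rw [a1, a2, a3]; field_simp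
  have p4 : c₁ * q ^ ((n : ℤ) + i) * coefη q L₂ (p + 1) n (p + 1 + i) / coefa q L₂ p n (p + i)
      * (c₂ * q ^ (-((L₂ : ℤ) + i - n - p)) * coefβ q (p + 1 + i) L₂ n (p + i)
            * coefa q L₂ (p + 1) (n - 1) (p + i))
      = c₁ * c₂ * q ^ ((n : ℤ) + i - 1 - (L₂ + i - n - (p + 1)))
            * (qNum q n * qNum q (L₂ + p + i - n + 3) * qNum q (L₂ - n + 1)
              * qNum q (L₂ + i - n + 1) / qNum q (L₂ + p + i - n + 2)) * qNum q (p + 1) := by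
    rw [a1, a3, a4, a5, ← z1]; field_simp
  push_cast
  rw [show (L₂ : ℤ) + (p + 1) + i - n + 1 = L₂ + p + i - n + 2 by ring,
    show (L₂ : ℤ) + (p + 1) + i - n + 2 = L₂ + p + i - n + 3 by ring,
    show (L₂ : ℤ) + (p + 1) + i - n = L₂ + p + i - n + 1 by ring]
  -- Column n + 1 contributes only for n < L₂. At n = L₂ its vector is zero and the factor [L₂-n]
  -- removes the matching c₂-term.
  rcases Nat.lt_or_ge n L₂ with hlt | hge
  · have hS := B₁_B₂_mudrovVec_succ hq c₁ c₂ hv i p (n + 1) hlt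
    have hI0 := hq.qNum_ne_zero (show (L₂ : ℤ) + i - n ≠ 0 by omega)
    have hP0 := hq.qNum_ne_zero (show (L₂ : ℤ) + p + i - n ≠ 0 by omega)
    have b1 : coefb q L₂ (p + 1) n (p + 1 + i) = qNum q (p + 1) / qNum q (L₂ + p + i - n + 2) := by
      rw [coefb_eq hq]; congr 2; ring
    have b2 : coefa q L₂ p (n + 1) (p + i) = qNum q (L₂ + i - n) / qNum q (L₂ + p + i - n) := by
      rw [coefa_eq hq]; congr 2 <;> ring
    have b3 : coefa q L₂ (p + 1) (n + 1) (p + i)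
        = qNum q (L₂ + i - n - 1) / qNum q (L₂ + p + i - n) := by
      rw [coefa_eq hq]; congr 2 <;> ring
    have b4 : coefβ q (p + 1 + i) L₂ (n + 1) (p + i) = qNum q (n + 1) * qNum q (L₂ + p + i - n + 2)
        * qNum q (L₂ - n) / qNum q (L₂ + p + i - n) := by
      rw [coefβ]; push_cast; ring_nf
    have z2 : q ^ (-((L₂ : ℤ) + i - (n + 1) - p)) = q ^ (-((L₂ : ℤ) + i - n - (p + 1))) := by
      congr 1; ring
    have p1 : coefb q L₂ (p + 1) n (p + 1 + i) / coefa q L₂ p (n + 1) (p + i)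
        * coefa q L₂ (p + 1) (n + 1) (p + i)
        = qNum q (p + 1) * qNum q (L₂ + i - n - 1)
              / (qNum q (L₂ + p + i - n + 2) * qNum q (L₂ + i - n)) := by
      rw [b1, b2, b3]; field_simp
    have p3 : coefb q L₂ (p + 1) n (p + 1 + i) / coefa q L₂ p (n + 1) (p + i)
        * (c₂ * q ^ (-((L₂ : ℤ) + i - (n + 1) - p)) * coefβ q (p + 1 + i) L₂ (n + 1) (p + i)
            * coefa q L₂ (p + 1) n (p + i))
        = c₂ * q ^ (-((L₂ : ℤ) + i - n - (p + 1))) *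
            (qNum q (p + 1) * qNum q (n + 1) * qNum q (L₂ - n) / qNum q (L₂ + p + i - n + 1)) := by
      rw [b1, b2, b4, a2, z2]; field_simp
    have hS' := Submodule.smul_mem _ (coefb q L₂ (p + 1) n (p + 1 + i)
      / coefa q L₂ p (n + 1) (p + i)) hS
    have htot := Submodule.sub_mem _ hsum hS'
    convert htot using 1
    rw [Nat.add_sub_cancel, Nat.cast_add, Nat.cast_one, show (n : ℤ) + 1 - 1 = n by ring]
    rw [← p2, ← p1, ← p3, mul_neg, ← p4]
    simp only [smul_eq_toEnd, map_sub, map_smul]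
    module
  · obtain rfl : n = L₂ := by omega
    convert hsum using 1
    rw [mudrovVec_eq_zero_of_lt_left hq hv, mudrovVec_eq_zero_of_lt_left hq hv, mul_neg, ← p4, ← p2,
      sub_self (n : ℤ), qNum_zero]
    simp only [smul_eq_toEnd, map_sub, map_smul, map_zero, smul_zero]
    module

/-- The top coefficients of `B₁B₂ u^i_n`. -/
theorem B₁_B₂_uVec [FiniteDimensional ℂ V] (hq : IsGenericQ q) (c₁ c₂ : ℂ) {M L₂ : ℕ} {v : V}
    (i : ℕ) (hv : IsHighestWeightVector q (M + i) L₂ v) (n : ℕ) (hn : n ≤ L₂) :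
    B₁ q c₁ • B₂ q c₂ • uVec q c₁ (M + i) L₂ v i n
      - ((qNum q (M + 1) / qNum q (L₂ + M + i - n + 1)
            - qNum q M * qNum q (L₂ + i - n - 1)
              / (qNum q (L₂ + M + i - n + 1) * qNum q (L₂ + i - n)))
          • mudrovVec q v M (n + 1) (M + i)
        + (c₁ * q ^ ((n : ℤ) + i) * qNum q (L₂ + i - n) * (qNum q M - q⁻¹ * qNum q (M + 1))
          + c₂ * q ^ (-((L₂ : ℤ) + i - n - M)) *
            (qNum q M * qNum q (n + 1) * qNum q (L₂ - n) / qNum q (L₂ + M + i - n)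
            - qNum q (M + i) * qNum q (L₂ + M + i + 1) / qNum q (L₂ + M + i - n + 1)
              * (qNum q (L₂ + i - n) / qNum q (L₂ + M + i - n))
            - qNum q n * qNum q (L₂ - n + 1) * qNum q (M + 1) / qNum q (L₂ + M + i - n + 1)))
          • mudrovVec q v M n (M + i)
        + (c₁ * c₂ * q ^ ((n : ℤ) + i - 1 - (L₂ + i - n - M))
            * (qNum q n * qNum q (L₂ + M + i - n + 2) * qNum q (L₂ - n + 1)
              * qNum q (L₂ + i - n + 1) / qNum q (L₂ + M + i - n + 1))
            * (q⁻¹ * qNum q (M + 1) - qNum q M))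
          • mudrovVec q v M (n - 1) (M + i)) ∈ LinearMap.range (diagSum q L₂ v i M) := by
  have htop := B₁_B₂_mudrovVec hq c₁ c₂ hv i M n hn
  have h0 := hq.ne_zero
  -- closed forms of the contribution of the top row
  have y1 : coefb q L₂ (M + 1) n (M + i) = qNum q (M + 1) / qNum q (L₂ + M + i - n + 1) := by
    rw [coefb_eq hq]; congr 2; ring
  have y2 : coefη q L₂ (M + 1) n (M + i) = qNum q (M + 1) * qNum q (L₂ + i - n) := by
    rw [coefη_eq]; congr 2; ring
  have y3 : coefα q (M + i) L₂ n (M + i) * coefa q L₂ M n (M + i - 1)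
      = qNum q (M + i) * qNum q (L₂ + M + i + 1) / qNum q (L₂ + M + i - n + 1)
              * (qNum q (L₂ + i - n) / qNum q (L₂ + M + i - n)) := by
    rw [coefα, coefa_eq hq, show ((M + i : ℕ) : ℤ) - (M + i) + 1 = 1 by push_cast; ring, hq.qNum_one]
    ring_nf
  have y4 : coefβ q (M + i) L₂ n (M + i) * coefb q L₂ (M + 1) (n - 1) (M + i)
      = qNum q n * qNum q (L₂ - n + 1) * qNum q (M + 1) / qNum q (L₂ + M + i - n + 1) := by
    have := hq.qNum_ne_zero (show (L₂ : ℤ) + M + i - n + 2 ≠ 0 by omega)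
    rw [coefβ, coefb_eq hq,
      show ((M + i : ℕ) : ℤ) + L₂ + 2 - n = L₂ + M + i - n + 2 by push_cast; ring,
      show (L₂ : ℤ) + (M + i) - (n - 1) + 1 = L₂ + M + i - n + 2 by ring,
      show (L₂ : ℤ) + (M + i) - n + 1 = L₂ + M + i - n + 1 by ring]
    field_simp
  have y5 : coefβ q (M + i) L₂ n (M + i) * coefη q L₂ (M + 1) (n - 1) (M + i)
      = qNum q n * qNum q (L₂ + M + i - n + 2) * qNum q (L₂ - n + 1)
              * qNum q (L₂ + i - n + 1) / qNum q (L₂ + M + i - n + 1) * qNum q (M + 1) := by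
    rw [coefβ, coefη_eq]
    push_cast
    ring_nf
  have z1 : q ^ ((n : ℤ) + M + 2 * i - 1 - (M + i : ℕ)) = q ^ ((n : ℤ) + i) * q⁻¹ := by
    rw [← zpow_neg_one, ← zpow_add₀ h0]; congr 1; push_cast; ring
  have z2 : q ^ (-((L₂ : ℤ) + i - n - M)) * q ^ ((n : ℤ) + M + 2 * i - 2 - (M + i : ℕ))
      = q ^ ((n : ℤ) + i - 1 - (L₂ + i - n - M)) * q⁻¹ := by
    rw [← zpow_neg_one, ← zpow_add₀ h0, ← zpow_add₀ h0]; congr 1; push_cast; ring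
  have hlow := B₁_B₂_uVec_sub_top hq c₁ c₂ i hv n hn
  -- The row above the top contains F₁^(L₁+1) v, so raising the top row contributes nothing there.
  have hz : mudrovVec q v (M + 1) n (M + 1 + i) = 0 ∧ mudrovVec q v (M + 1) (n - 1) (M + 1 + i) = 0 := by
    rw [show M + 1 + i = M + i + 1 by ring]
    exact ⟨mudrovVec_eq_zero_of_lt_right hq hv _ _, mudrovVec_eq_zero_of_lt_right hq hv _ _⟩
  have htot := Submodule.add_mem _ htop hlow
  convert htot using 1
  have w2 : -(c₁ * q ^ ((n : ℤ) + M + 2 * i - 1 - (M + i : ℕ)) * coefη q L₂ (M + 1) n (M + i))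
            - c₂ * q ^ (-((L₂ : ℤ) + i - n - M)) *
              (coefα q (M + i) L₂ n (M + i) * coefa q L₂ M n (M + i - 1)
              + coefβ q (M + i) L₂ n (M + i) * coefb q L₂ (M + 1) (n - 1) (M + i))
      = -(c₁ * (q ^ ((n : ℤ) + i) * q⁻¹) * (qNum q (M + 1) * qNum q (L₂ + i - n)))
        - c₂ * q ^ (-((L₂ : ℤ) + i - n - M)) *
          (qNum q (M + i) * qNum q (L₂ + M + i + 1) / qNum q (L₂ + M + i - n + 1)
              * (qNum q (L₂ + i - n) / qNum q (L₂ + M + i - n))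
            + qNum q n * qNum q (L₂ - n + 1) * qNum q (M + 1) / qNum q (L₂ + M + i - n + 1)) := by
    rw [z1, y2, y3, y4]
  have w3 : c₁ * c₂ * q ^ (-((L₂ : ℤ) + i - n - M)) * coefβ q (M + i) L₂ n (M + i)
            * q ^ ((n : ℤ) + M + 2 * i - 2 - (M + i : ℕ)) * coefη q L₂ (M + 1) (n - 1) (M + i)
      = c₁ * c₂ * (q ^ ((n : ℤ) + i - 1 - (L₂ + i - n - M)) * q⁻¹)
        * (qNum q n * qNum q (L₂ + M + i - n + 2) * qNum q (L₂ - n + 1)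
              * qNum q (L₂ + i - n + 1) / qNum q (L₂ + M + i - n + 1) * qNum q (M + 1)) := by
    rw [← z2, ← y5]; ring
  rw [hz.1, hz.2, y1, w2, w3]
  simp only [smul_eq_toEnd, map_sub, smul_zero]
  module

end top

/-! ### Three-term recurrence of the dual Q-Krawtchouk polynomials -/

section krawtchouk

theorem qShifted_succ (a Q : ℂ) (n : ℕ) : qShifted a Q (n + 1) = qShifted a Q n * (1 - a * Q ^ n) :=
  prod_range_succ _ _

theorem qShifted_succ' (a Q : ℂ) (n : ℕ) :
    qShifted a Q (n + 1) = (1 - a) * qShifted (a * Q) Q n := by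
  rw [qShifted, prod_range_succ', mul_comm, pow_zero, mul_one, qShifted]
  congr 1
  exact prod_congr rfl fun j _ => by rw [pow_succ']; ring

variable {Q : ℂ}

theorem qShifted_zpow_eq_zero (hQ : Q ≠ 0) {n k : ℕ} (h : n < k) :
    qShifted (Q ^ (-(n : ℤ))) Q k = 0 := by
  refine prod_eq_zero (mem_range.mpr h) ?_
  rw [zpow_neg, zpow_natCast, inv_mul_cancel₀ (pow_ne_zero _ hQ), sub_self]

/-- The coefficient of `(Q^(-x), c Q^(x-N); Q)_k` in the dual `Q`-Krawtchouk polynomial. -/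
noncomputable def krawtchoukCoef (Q : ℂ) (N : ℕ) (n : ℤ) (k : ℕ) : ℂ :=
  qShifted (Q ^ (-n)) Q k / (qShifted (Q ^ (-(N : ℤ))) Q k * qShifted Q Q k) * Q ^ k

/-- The polynomials `(Q^(-x), c Q^(x-N); Q)_k` in `λ(x)`. -/
noncomputable def krawtchoukBasis (Q c : ℂ) (N x k : ℕ) : ℂ :=
  qShifted (Q ^ (-(x : ℤ))) Q k * qShifted (c * Q ^ ((x : ℤ) - N)) Q k

/-- (Q^(-n); Q)_k vanishes for k > n, so polynomials of different degree can be expanded over one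
range of k. -/
theorem dualQKrawtchouk_eq_sum (hQ : Q ≠ 0) (c : ℂ) {N n : ℕ} (x : ℕ) (hn : n ≤ N) :
    dualQKrawtchouk Q c N n x
      = ∑ k ∈ range (N + 1), krawtchoukCoef Q N n k * krawtchoukBasis Q c N x k := by
  rw [dualQKrawtchouk]
  have : range (n + 1) ⊆ range (N + 1) := range_subset_range.mpr (by omega)
  rw [← sum_subset this]
  · refine sum_congr rfl fun k _ => ?_
    rw [krawtchoukCoef, krawtchoukBasis]; ring
  · intro k _ hk
    rw [krawtchoukCoef, qShifted_zpow_eq_zero hQ (by have := mem_range.not.mp hk; omega)]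
    simp

/-- The multiplier is λ(x) - 1 - c Q^(-N). The factor leading from k to k+1 is affine in λ(x), so
multiplication is bidiagonal in this basis. -/
theorem krawtchoukBasis_mul (hQ : Q ≠ 0) (c : ℂ) (N x k : ℕ) :
    -((1 - Q ^ (-(x : ℤ))) * (1 - c * Q ^ ((x : ℤ) - N))) * krawtchoukBasis Q c N x k
      = ((Q ^ k)⁻¹ - 1) * (1 - c * Q ^ k * Q ^ (-(N : ℤ))) * krawtchoukBasis Q c N x k
        - (Q ^ k)⁻¹ * krawtchoukBasis Q c N x (k + 1) := by
  rw [krawtchoukBasis, krawtchoukBasis, qShifted_succ, qShifted_succ]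
  generalize qShifted (Q ^ (-(x : ℤ))) Q k = a
  generalize qShifted (c * Q ^ ((x : ℤ) - N)) Q k = b
  simp only [sub_eq_add_neg, zpow_add₀ hQ, zpow_neg, zpow_natCast]
  have := pow_ne_zero k hQ
  have := pow_ne_zero x hQ
  have := pow_ne_zero N hQ
  field_simp
  ring

/-- (Q^(-n); Q)_{k+1} is factored in two ways, by its first and by its last factor. -/
theorem krawtchoukCoef_pred (hQ : Q ≠ 0) (N : ℕ) (n : ℤ) (k : ℕ) :
    (1 - Q ^ n) * (krawtchoukCoef Q N (n - 1) k - krawtchoukCoef Q N n k)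
      = (Q ^ k - 1) * krawtchoukCoef Q N n k := by
  have h := (qShifted_succ' (Q ^ (-n)) Q k).symm.trans (qShifted_succ _ _ _)
  have e : Q ^ (-n) * Q = Q ^ (-(n - 1)) := by
    rw [← zpow_add_one₀ hQ]; congr 1; ring
  rw [e] at h
  have hn := zpow_ne_zero n hQ
  have h' : (1 - Q ^ n) * qShifted (Q ^ (-(n - 1))) Q k
      = (Q ^ k - Q ^ n) * qShifted (Q ^ (-n)) Q k := by
    rw [zpow_neg Q n] at h ⊢
    field_simp at h ⊢
    linear_combination -h
  simp only [krawtchoukCoef]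
  linear_combination (Q ^ k / (qShifted (Q ^ (-(N : ℤ))) Q k * qShifted Q Q k)) * h'

theorem krawtchoukCoef_succ (hQ : IsGenericQ Q) {N : ℕ} (n : ℤ) {k : ℕ} (hk : k < N) :
    ((Q ^ (k + 1))⁻¹ - 1) * krawtchoukCoef Q N n (k + 1) - (Q ^ k)⁻¹ * krawtchoukCoef Q N n k
      = (1 - Q ^ (n - N)) * (krawtchoukCoef Q N (n + 1) (k + 1) - krawtchoukCoef Q N n (k + 1)) := by
  have h0 := hQ.ne_zero
  have hk0 := pow_ne_zero k h0
  have d1 : 1 - Q ^ (-(N : ℤ)) * Q ^ k ≠ 0 := by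
    rw [← zpow_natCast, ← zpow_add₀ h0]
    exact sub_ne_zero.mpr (hQ.zpow_ne_one _ (by omega)).symm
  have d2 : 1 - Q * Q ^ k ≠ 0 := by
    rw [← pow_succ']
    exact sub_ne_zero.mpr (by exact_mod_cast (hQ.zpow_ne_one (k + 1) (by omega)).symm)
  have e : Q ^ (-(n + 1)) * Q = Q ^ (-n) := by
    rw [← zpow_add_one₀ h0]; congr 1; ring
  have e2 : qShifted (Q ^ (-(n + 1))) Q (k + 1) = (1 - Q ^ (-n) * Q⁻¹) * qShifted (Q ^ (-n)) Q k := by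
    rw [qShifted_succ', e, ← e, mul_inv_cancel_right₀ h0]
  simp only [krawtchoukCoef, e2]
  rw [qShifted_succ, qShifted_succ, qShifted_succ]
  -- With a zero denominator both sides are 0 under division by zero, so nonvanishing need not be
  -- established.
  by_cases hz : qShifted (Q ^ (-(N : ℤ))) Q k * qShifted Q Q k = 0
  · rw [mul_mul_mul_comm, hz]; simp
  generalize qShifted (Q ^ (-n)) Q k = a
  generalize qShifted (Q ^ (-(N : ℤ))) Q k = b at *
  generalize qShifted Q Q k = d at *
  have hb := left_ne_zero_of_mul hz
  have hd := right_ne_zero_of_mul hz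
  rw [zpow_sub₀ h0]
  rw [zpow_neg] at d1
  simp only [zpow_neg, zpow_natCast] at d1 ⊢
  have hn := zpow_ne_zero n h0
  have hN := pow_ne_zero N h0
  have d3 : Q ^ N - Q ^ k ≠ 0 := by
    intro h; apply d1; field_simp; rw [h, mul_zero]
  rw [pow_succ]
  generalize Q ^ k = S at *
  generalize Q ^ N = T at *
  generalize Q ^ n = R at *
  have d4 : 1 - T⁻¹ * S = (T - S) / T := by field_simp
  rw [d4]
  have d5 : 1 - S * Q ≠ 0 := by rwa [mul_comm]
  field_simp
  ring

theorem krawtchoukBasis_eq_zero (hQ : Q ≠ 0) (c : ℂ) {N x : ℕ} (hx : x ≤ N) :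
    krawtchoukBasis Q c N x (N + 1) = 0 := by
  rw [krawtchoukBasis, qShifted_zpow_eq_zero hQ (by omega), zero_mul]

theorem krawtchoukCoef_zero_right (N : ℕ) (n : ℤ) : krawtchoukCoef Q N n 0 = 1 := by
  simp [krawtchoukCoef, qShifted]

theorem krawtchoukSum_recurrence (hQ : IsGenericQ Q) (c : ℂ) {N x : ℕ} (hx : x ≤ N) (n : ℤ)
    {K : ℤ → ℂ}
    (hK : ∀ m, K m = ∑ k ∈ range (N + 1), krawtchoukCoef Q N m k * krawtchoukBasis Q c N x k) :
    -((1 - Q ^ (-(x : ℤ))) * (1 - c * Q ^ ((x : ℤ) - N))) * K n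
      = (1 - Q ^ (n - N)) * (K (n + 1) - K n)
        + c * Q ^ (-(N : ℤ)) * (1 - Q ^ n) * (K (n - 1) - K n) := by
  have h0 := hQ.ne_zero
  have h1 : -((1 - Q ^ (-(x : ℤ))) * (1 - c * Q ^ ((x : ℤ) - N))) * K n
      = (∑ k ∈ range (N + 1), ((Q ^ k)⁻¹ - 1) * (1 - c * Q ^ k * Q ^ (-(N : ℤ)))
            * krawtchoukCoef Q N n k * krawtchoukBasis Q c N x k)
        - ∑ k ∈ range (N + 1), (Q ^ k)⁻¹ * krawtchoukCoef Q N n k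
            * krawtchoukBasis Q c N x (k + 1) := by
    rw [hK, mul_sum, ← sum_sub_distrib]
    refine sum_congr rfl fun k _ => ?_
    linear_combination krawtchoukCoef Q N n k * krawtchoukBasis_mul h0 c N x k
  have h2 : (1 - Q ^ (n - N)) * (K (n + 1) - K n)
        + c * Q ^ (-(N : ℤ)) * (1 - Q ^ n) * (K (n - 1) - K n)
      = ∑ k ∈ range (N + 1), ((1 - Q ^ (n - N))
          * (krawtchoukCoef Q N (n + 1) k - krawtchoukCoef Q N n k)
        + c * Q ^ (-(N : ℤ)) * ((Q ^ k - 1) * krawtchoukCoef Q N n k))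
          * krawtchoukBasis Q c N x k := by
    rw [hK, hK, hK, ← sum_sub_distrib, ← sum_sub_distrib, mul_sum, mul_sum, ← sum_add_distrib]
    refine sum_congr rfl fun k _ => ?_
    rw [← krawtchoukCoef_pred h0]
    ring
  -- The basis element of index N + 1 vanishes at x ≤ N, so the shifted sum closes up; k = 0 is
  -- compared separately.
  rw [h1, h2, sum_range_succ (fun k => (Q ^ k)⁻¹ * _ * _), krawtchoukBasis_eq_zero h0 c hx, mul_zero,
    add_zero, sum_range_succ', sum_range_succ' (n := N), krawtchoukCoef_zero_right,
    krawtchoukCoef_zero_right, add_sub_right_comm, ← sum_sub_distrib]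
  congr 1
  · refine sum_congr rfl fun k hk => ?_
    rw [← krawtchoukCoef_succ hQ n (mem_range.mp hk)]
    have := pow_ne_zero (k + 1) h0
    field_simp
    ring
  · simp

/-- The three-term recurrence of the dual `Q`-Krawtchouk polynomials. -/
theorem dualQKrawtchouk_recurrence (hQ : IsGenericQ Q) (c : ℂ) {N x n : ℕ} (hx : x ≤ N)
    (hn : n ≤ N) :
    -((1 - Q ^ (-(x : ℤ))) * (1 - c * Q ^ ((x : ℤ) - N))) * dualQKrawtchouk Q c N n x
      = (1 - Q ^ ((n : ℤ) - N)) * (dualQKrawtchouk Q c N (n + 1) x - dualQKrawtchouk Q c N n x)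
        + c * Q ^ (-(N : ℤ)) * (1 - Q ^ n)
          * (dualQKrawtchouk Q c N (n - 1) x - dualQKrawtchouk Q c N n x) := by
  have h0 := hQ.ne_zero
  have h := krawtchoukSum_recurrence hQ c hx n (fun _ => rfl)
  simp only [← dualQKrawtchouk_eq_sum h0 c x hn] at h
  rw [h]
  congr 1
  -- At n = N the factor 1 - Q^(n-N) is 0, so the value at N + 1 is irrelevant; likewise 1 - Q^n
  -- covers the truncated n - 1 at n = 0.
  · rcases Nat.lt_or_ge n N with hlt | hge
    · rw [dualQKrawtchouk_eq_sum h0 c x hlt]; push_cast; rfl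
    · obtain rfl : n = N := by omega
      simp
  · rcases n with _ | n
    · simp
    · rw [Nat.add_sub_cancel, dualQKrawtchouk_eq_sum h0 c x (show n ≤ N by omega)]
      push_cast
      rw [show (n : ℤ) + 1 - 1 = n by ring]
      norm_cast

end krawtchouk

/-! ### Matching the tridiagonal matrix with the recurrence -/

section eigenvectors

variable {q : ℂ}

/-- The factor in front of the dual `q`-Krawtchouk polynomial in `psiCoef`. -/
noncomputable def psiPrefactor (q c₂ : ℂ) (L₁ L₂ i l : ℕ) : ℂ :=
  (-1) ^ l * (c₂⁻¹) ^ l * (1 - q ^ 2) ^ (2 * l)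
      * q ^ (-(l : ℤ) * (L₁ + 3) + (l.choose 2 : ℤ))
    * qShifted (q ^ (-2 * (L₂ : ℤ) - 2 * L₁)) (q ^ 2) l
    / (qShifted (q ^ 2) (q ^ 2) l * qShifted (q ^ (-2 * (L₂ : ℤ) - 2 * L₁ - 2)) (q ^ 2) l
        * qShifted (q ^ (-2 * (L₂ : ℤ) - 2 * i)) (q ^ 2) l)

theorem one_sub_zpow_neg (hq : q ≠ 0) (n : ℤ) : 1 - q ^ (-n) = -(q ^ n)⁻¹ * (1 - q ^ n) := by
  have := zpow_ne_zero n hq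
  rw [zpow_neg]; field_simp; ring

theorem psiPrefactor_succ (hq : IsGenericQ q) (c₂ : ℂ) (L₁ L₂ i m : ℕ) :
    psiPrefactor q c₂ L₁ L₂ i (m + 1) = psiPrefactor q c₂ L₁ L₂ i m
      * (c₂⁻¹ * (1 - q ^ 2) ^ 2 * q ^ (-((L₁ : ℤ) + 3) + m) * q ^ (2 * ((L₁ : ℤ) + L₂ - m + 1))
        * q ^ (2 * ((L₂ : ℤ) + i - m)) * (q ^ (2 * ((L₁ : ℤ) + L₂ - m)))⁻¹
        * (1 - q ^ (2 * ((L₁ : ℤ) + L₂ - m)))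
        / ((1 - q ^ (2 * ((m : ℤ) + 1))) * (1 - q ^ (2 * ((L₁ : ℤ) + L₂ - m + 1)))
          * (1 - q ^ (2 * ((L₂ : ℤ) + i - m))))) := by
  have h0 := hq.ne_zero
  have e1 : 1 - q ^ (-2 * (L₂ : ℤ) - 2 * L₁) * (q ^ 2) ^ m
      = -(q ^ (2 * ((L₁ : ℤ) + L₂ - m)))⁻¹ * (1 - q ^ (2 * ((L₁ : ℤ) + L₂ - m))) := by
    rw [← one_sub_zpow_neg h0, ← pow_mul, ← zpow_natCast, ← zpow_add₀ h0]
    congr 2; push_cast; ring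
  have e2 : 1 - q ^ (-2 * (L₂ : ℤ) - 2 * L₁ - 2) * (q ^ 2) ^ m
      = -(q ^ (2 * ((L₁ : ℤ) + L₂ - m + 1)))⁻¹ * (1 - q ^ (2 * ((L₁ : ℤ) + L₂ - m + 1))) := by
    rw [← one_sub_zpow_neg h0, ← pow_mul, ← zpow_natCast, ← zpow_add₀ h0]
    congr 2; push_cast; ring
  have e3 : 1 - q ^ (-2 * (L₂ : ℤ) - 2 * i) * (q ^ 2) ^ m
      = -(q ^ (2 * ((L₂ : ℤ) + i - m)))⁻¹ * (1 - q ^ (2 * ((L₂ : ℤ) + i - m))) := by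
    rw [← one_sub_zpow_neg h0, ← pow_mul, ← zpow_natCast, ← zpow_add₀ h0]
    congr 2; push_cast; ring
  have e4 : 1 - q ^ 2 * (q ^ 2) ^ m = 1 - q ^ (2 * ((m : ℤ) + 1)) := by
    rw [← pow_succ', ← pow_mul, ← zpow_natCast]
    congr 2
  have e5 : q ^ (-((m + 1 : ℕ) : ℤ) * (L₁ + 3) + ((m + 1).choose 2 : ℤ))
      = q ^ (-(m : ℤ) * (L₁ + 3) + (m.choose 2 : ℤ)) * q ^ (-((L₁ : ℤ) + 3) + m) := by
    rw [← zpow_add₀ h0, Nat.choose_succ_succ, Nat.choose_one_right]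
    congr 1; push_cast; ring
  rw [psiPrefactor, psiPrefactor, qShifted_succ, qShifted_succ, qShifted_succ, qShifted_succ,
    e1, e2, e3, e4, e5, mul_add 2 m 1, pow_add, pow_succ (-1 : ℂ), pow_succ c₂⁻¹]
  simp only [div_eq_mul_inv, mul_inv, inv_neg, inv_inv, mul_one]
  ring

/-- `χ`, the ratio between the recurrences of `psiCoef` and of the polynomials. -/
noncomputable def recScale (q c₁ : ℂ) (L₁ L₂ i : ℕ) : ℂ :=
  -c₁ * q ^ ((L₂ : ℤ) + i - L₁) / (1 - q ^ 2)

/-- The prefactor is the diagonal rescaling that makes the off-diagonal entries proportional to the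
recurrence coefficients 1 - Q^(m-N) here, and c Q^(-N)(1 - Q^m) in the companion identity for A,
with Q = q² and N = L₂. -/
theorem triC_mul_psiPrefactor (hq : IsGenericQ q) {c₁ c₂ : ℂ} (hc₂ : c₂ ≠ 0) {L₁ L₂ i m : ℕ}
    (hm : m < L₂) : triC q c₁ c₂ L₁ L₂ i (m + 1) * psiPrefactor q c₂ L₁ L₂ i (m + 1)
      = recScale q c₁ L₁ L₂ i * (1 - (q ^ 2) ^ ((m : ℤ) - L₂)) * psiPrefactor q c₂ L₁ L₂ i m := by
  have h0 := hq.ne_zero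
  have h1 := hq.one_sub_sq_ne_zero
  have d1 : 1 - q ^ (2 * ((L₁ : ℤ) + L₂ - m)) ≠ 0 := hq.one_sub_zpow_ne_zero (by omega)
  have d2 : 1 - q ^ (2 * ((L₁ : ℤ) + L₂ - m + 1)) ≠ 0 := hq.one_sub_zpow_ne_zero (by omega)
  have d3 : 1 - q ^ (2 * ((L₂ : ℤ) + i - m)) ≠ 0 := hq.one_sub_zpow_ne_zero (by omega)
  have d4 : 1 - q ^ (2 * ((m : ℤ) + 1)) ≠ 0 := hq.one_sub_zpow_ne_zero (by omega)
  have f5 : 1 - (q ^ 2) ^ ((m : ℤ) - L₂)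
      = -(q ^ (2 * ((L₂ : ℤ) - m)))⁻¹ * (1 - q ^ (2 * ((L₂ : ℤ) - m))) := by
    rw [← one_sub_zpow_neg h0, ← zpow_natCast q 2, ← zpow_mul]
    congr 2; push_cast; ring
  have f4 : q ^ (2 * (m + 1)) = q ^ (2 * ((m : ℤ) + 1)) := by
    rw [← zpow_natCast]; push_cast; rfl
  rw [psiPrefactor_succ hq, f5, triC, recScale, f4,
    show 2 * (L₂ : ℤ) - 2 * (m + 1 : ℕ) + 2 = 2 * ((L₂ : ℤ) - m) by push_cast; ring,
    show 2 * (L₁ : ℤ) + 2 * L₂ - 2 * (m + 1 : ℕ) + 4 = 2 * ((L₁ : ℤ) + L₂ - m + 1) by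
      push_cast; ring,
    show 2 * (L₂ : ℤ) + 2 * i + 2 - 2 * (m + 1 : ℕ) = 2 * ((L₂ : ℤ) + i - m) by push_cast; ring,
    show 2 * (L₂ : ℤ) + 2 * L₁ + 2 - 2 * (m + 1 : ℕ) = 2 * ((L₁ : ℤ) + L₂ - m) by push_cast; ring]
  generalize psiPrefactor q c₂ L₁ L₂ i m = w
  generalize 1 - q ^ (2 * ((L₁ : ℤ) + L₂ - m)) = d1 at *
  generalize 1 - q ^ (2 * ((L₁ : ℤ) + L₂ - m + 1)) = d2 at *
  generalize 1 - q ^ (2 * ((L₂ : ℤ) + i - m)) = d3 at *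
  generalize 1 - q ^ (2 * ((m : ℤ) + 1)) = d4 at *
  generalize 1 - q ^ (2 * ((L₂ : ℤ) - m)) = d5 at *
  push_cast
  simp only [zpow_add₀ h0, zpow_sub₀ h0, zpow_one, two_mul, zpow_neg, neg_add, mul_add, mul_one,
    zpow_natCast, zpow_ofNat, show (3 : ℤ) = 1 + 1 + 1 by rfl, add_mul, one_mul]
  have := pow_ne_zero L₁ h0
  have := pow_ne_zero L₂ h0
  have := pow_ne_zero m h0
  have := pow_ne_zero i h0
  generalize q ^ L₁ = X at *
  generalize q ^ L₂ = Y at *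
  generalize q ^ m = T at *
  generalize q ^ i = Z at *
  field_simp

theorem triA_mul_psiPrefactor (hq : IsGenericQ q) {c₁ c₂ : ℂ} (hc₁ : c₁ ≠ 0) (hc₂ : c₂ ≠ 0)
    {L₁ L₂ i m : ℕ} (hm : m < L₂) : triA q L₁ L₂ i m * psiPrefactor q c₂ L₁ L₂ i m
      = recScale q c₁ L₁ L₂ i * (-c₁⁻¹ * c₂ * q ^ (2 * (L₁ : ℤ) - 2 * i + 1)
        * (q ^ 2) ^ (-(L₂ : ℤ)) * (1 - (q ^ 2) ^ (m + 1))) * psiPrefactor q c₂ L₁ L₂ i (m + 1) := by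
  have h0 := hq.ne_zero
  have h1 := hq.one_sub_sq_ne_zero
  have d1 : 1 - q ^ (2 * ((L₁ : ℤ) + L₂ - m)) ≠ 0 := hq.one_sub_zpow_ne_zero (by omega)
  have d2 : 1 - q ^ (2 * ((L₁ : ℤ) + L₂ - m + 1)) ≠ 0 := hq.one_sub_zpow_ne_zero (by omega)
  have d3 : 1 - q ^ (2 * ((L₂ : ℤ) + i - m)) ≠ 0 := hq.one_sub_zpow_ne_zero (by omega)
  have d4 : 1 - q ^ (2 * ((m : ℤ) + 1)) ≠ 0 := hq.one_sub_zpow_ne_zero (by omega)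
  have f4 : (q ^ 2) ^ (m + 1) = q ^ (2 * ((m : ℤ) + 1)) := by
    rw [← pow_mul, ← zpow_natCast]; push_cast; rfl
  have f5 : (q ^ 2) ^ (-(L₂ : ℤ)) = q ^ (-(L₂ : ℤ)) * q ^ (-(L₂ : ℤ)) := by
    rw [← zpow_add₀ h0, ← zpow_natCast q 2, ← zpow_mul]; congr 1; push_cast; ring
  rw [psiPrefactor_succ hq, f4, f5, triA, recScale,
    show 2 * (L₁ : ℤ) + 2 * L₂ - 2 * m = 2 * ((L₁ : ℤ) + L₂ - m) by ring,
    show 2 * (L₂ : ℤ) + 2 * L₁ - 2 * m + 2 = 2 * ((L₁ : ℤ) + L₂ - m + 1) by ring,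
    show 2 * (L₂ : ℤ) + 2 * i - 2 * m = 2 * ((L₂ : ℤ) + i - m) by ring]
  generalize psiPrefactor q c₂ L₁ L₂ i m = w
  generalize 1 - q ^ (2 * ((L₁ : ℤ) + L₂ - m)) = d1 at *
  generalize 1 - q ^ (2 * ((L₁ : ℤ) + L₂ - m + 1)) = d2 at *
  generalize 1 - q ^ (2 * ((L₂ : ℤ) + i - m)) = d3 at *
  generalize 1 - q ^ (2 * ((m : ℤ) + 1)) = d4 at *
  simp only [zpow_add₀ h0, zpow_sub₀ h0, zpow_one, two_mul, zpow_neg, neg_add, mul_add, mul_one,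
    zpow_natCast, zpow_ofNat]
  have := pow_ne_zero L₁ h0
  have := pow_ne_zero L₂ h0
  have := pow_ne_zero m h0
  have := pow_ne_zero i h0
  generalize q ^ L₁ = X at *
  generalize q ^ L₂ = Y at *
  generalize q ^ m = T at *
  generalize q ^ i = Z at *
  field_simp

/-- The diagonal part of the recurrence, including the x-dependent multiplier, with the same scale
`recScale`; this is where η₁ is identified with λ(x) up to an affine change. -/
theorem triB_add_triD_sub_eta₁ (hq : IsGenericQ q) {c₁ c₂ : ℂ} (hc₁ : c₁ ≠ 0) (L₁ L₂ i x m : ℕ) :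
    triB q c₁ c₂ L₁ L₂ i m + triD q c₁ c₂ L₁ L₂ i
        - eta₁ q c₁ c₂ (q ^ ((L₁ : ℤ) - 3 * i - L₂)) (x + i)
      = recScale q c₁ L₁ L₂ i *
        ((1 - (q ^ 2) ^ (-(x : ℤ))) *
            (1 - -c₁⁻¹ * c₂ * q ^ (2 * (L₁ : ℤ) - 2 * i + 1) * (q ^ 2) ^ ((x : ℤ) - L₂))
          - (1 - (q ^ 2) ^ ((m : ℤ) - L₂))
          - -c₁⁻¹ * c₂ * q ^ (2 * (L₁ : ℤ) - 2 * i + 1) * (q ^ 2) ^ (-(L₂ : ℤ))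
            * (1 - (q ^ 2) ^ m)) := by
  have h0 := hq.ne_zero
  have h1 := hq.one_sub_sq_ne_zero
  have h2 := hq.sq_sub_one_ne_zero
  have f : ∀ n : ℤ, (q ^ 2) ^ n = q ^ n * q ^ n := fun n => by rw [sq, mul_zpow]
  have f' : (q ^ 2) ^ m = q ^ m * q ^ m := by rw [sq, mul_pow]
  have f2 : q ^ (2 * (x + i)) = q ^ x * q ^ x * q ^ i * q ^ i := by ring
  rw [triB, triD, eta₁, recScale, f2, f', f, f, f, f]
  push_cast
  simp only [zpow_add₀ h0, zpow_sub₀ h0, zpow_one, two_mul, zpow_neg, neg_add, mul_add, mul_one,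
    neg_mul, zpow_natCast, zpow_ofNat, show (3 : ℤ) = 1 + 1 + 1 by rfl, add_mul, one_mul]
  have := pow_ne_zero L₁ h0
  have := pow_ne_zero L₂ h0
  have := pow_ne_zero m h0
  have := pow_ne_zero i h0
  have := pow_ne_zero x h0
  generalize q ^ L₁ = X at *
  generalize q ^ L₂ = Y at *
  generalize q ^ m = T at *
  generalize q ^ i = Z at *
  generalize q ^ x = W at *
  field_simp
  ring

end eigenvectors

/-! ### The matrix applied to the eigenvector coefficients; distinct eigenvalues -/

theorem isGenericQ_ofReal {q : ℝ} (hq0 : 0 < q) (hq1 : q < 1) : IsGenericQ (q : ℂ) where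
  ne_zero := by exact_mod_cast hq0.ne'
  zpow_ne_one n hn h := by
    have h' : q ^ n = q ^ (0 : ℤ) := by rw [zpow_zero]; exact_mod_cast h
    exact hn (zpow_right_injective₀ hq0 hq1.ne h')

theorem IsGenericQ.sq {q : ℂ} (hq : IsGenericQ q) : IsGenericQ (q ^ 2) where
  ne_zero := pow_ne_zero 2 hq.ne_zero
  zpow_ne_one n hn := by
    rw [← zpow_natCast, ← zpow_mul]
    exact hq.zpow_ne_one _ (by push_cast; omega)

theorem triMatrix_split (q c₁ c₂ : ℂ) (L₁ L₂ i m n : ℕ) : triMatrix q c₁ c₂ L₁ L₂ i m n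
    = (if m = n + 1 then triA q L₁ L₂ i n else 0)
      + (if m = n then triB q c₁ c₂ L₁ L₂ i n + triD q c₁ c₂ L₁ L₂ i else 0)
      + (if m + 1 = n then triC q c₁ c₂ L₁ L₂ i n else 0) := by
  rw [triMatrix]
  split_ifs <;> first | omega | simp

theorem sum_triMatrix_smul {V : Type*} [AddCommGroup V] [Module ℂ V] (q c₁ c₂ : ℂ)
    (L₁ L₂ i n : ℕ) (hn : n ≤ L₂) (x : ℕ → V) :
    ∑ m ∈ range (L₂ + 1), triMatrix q c₁ c₂ L₁ L₂ i m n • x m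
      = (if n < L₂ then triA q L₁ L₂ i n • x (n + 1) else 0)
        + (triB q c₁ c₂ L₁ L₂ i n + triD q c₁ c₂ L₁ L₂ i) • x n
        + triC q c₁ c₂ L₁ L₂ i n • x (n - 1) := by
  simp only [triMatrix_split, add_smul, ite_smul, zero_smul, sum_add_distrib, sum_ite_eq', mem_range,
    add_lt_add_iff_right]
  rw [if_pos (show n < L₂ + 1 by omega)]
  congr 1
  -- At n = 0 the truncated index n - 1 is harmless, since C(0) contains the factor 1 - q^0.
  rcases n with _ | n
  · simp [triC]
  · simp only [add_left_inj, sum_ite_eq', mem_range, Nat.add_sub_cancel]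
    rw [if_pos (by omega)]

theorem sum_triMatrix_mul (q c₁ c₂ : ℂ) (L₁ L₂ i m : ℕ) (hm : m ≤ L₂) (p : ℕ → ℂ) :
    ∑ n ∈ range (L₂ + 1), triMatrix q c₁ c₂ L₁ L₂ i m n * p n
      = (if 0 < m then triA q L₁ L₂ i (m - 1) * p (m - 1) else 0)
        + (triB q c₁ c₂ L₁ L₂ i m + triD q c₁ c₂ L₁ L₂ i) * p m
        + (if m < L₂ then triC q c₁ c₂ L₁ L₂ i (m + 1) * p (m + 1) else 0) := by
  simp only [triMatrix_split, add_mul, ite_mul, zero_mul, sum_add_distrib, sum_ite_eq, mem_range,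
    add_lt_add_iff_right]
  rw [if_pos (show m < L₂ + 1 by omega)]
  congr 2
  rcases m with _ | m
  · simp
  · simp only [add_left_inj, sum_ite_eq, mem_range, Nat.add_sub_cancel]
    rw [if_pos (by omega), if_pos (by omega)]

theorem sum_triMatrix_mul_psiCoef {q : ℂ} (hq : IsGenericQ q) {c₁ c₂ : ℂ} (hc₁ : c₁ ≠ 0)
    (hc₂ : c₂ ≠ 0) (L₁ L₂ i x m : ℕ) (hx : x ≤ L₂) (hm : m ≤ L₂) :
    ∑ n ∈ range (L₂ + 1), triMatrix q c₁ c₂ L₁ L₂ i m n * psiCoef q c₁ c₂ L₁ L₂ i x n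
      = eta₁ q c₁ c₂ (q ^ ((L₁ : ℤ) - 3 * i - L₂)) (x + i) * psiCoef q c₁ c₂ L₁ L₂ i x m := by
  have hpsi : ∀ l, psiCoef q c₁ c₂ L₁ L₂ i x l = psiPrefactor q c₂ L₁ L₂ i l
      * dualQKrawtchouk (q ^ 2) (-c₁⁻¹ * c₂ * q ^ (2 * (L₁ : ℤ) - 2 * i + 1)) L₂ l x := fun _ => rfl
  have hrec := dualQKrawtchouk_recurrence hq.sq (-c₁⁻¹ * c₂ * q ^ (2 * (L₁ : ℤ) - 2 * i + 1)) hx hm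
  have hB := triB_add_triD_sub_eta₁ hq (c₂ := c₂) hc₁ L₁ L₂ i x m
  rw [sum_triMatrix_mul _ _ _ _ _ _ _ hm]
  have hA : (if 0 < m then triA q L₁ L₂ i (m - 1) * psiCoef q c₁ c₂ L₁ L₂ i x (m - 1) else 0)
      = recScale q c₁ L₁ L₂ i * (-c₁⁻¹ * c₂ * q ^ (2 * (L₁ : ℤ) - 2 * i + 1)
        * (q ^ 2) ^ (-(L₂ : ℤ)) * (1 - (q ^ 2) ^ m)) * psiPrefactor q c₂ L₁ L₂ i m
        * dualQKrawtchouk (q ^ 2) (-c₁⁻¹ * c₂ * q ^ (2 * (L₁ : ℤ) - 2 * i + 1)) L₂ (m - 1) x := by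
    rcases m with _ | m
    · simp
    · rw [if_pos (Nat.succ_pos m), Nat.add_sub_cancel, hpsi, ← mul_assoc,
        triA_mul_psiPrefactor hq hc₁ hc₂ (by omega)]
  have hC : (if m < L₂ then triC q c₁ c₂ L₁ L₂ i (m + 1) * psiCoef q c₁ c₂ L₁ L₂ i x (m + 1) else 0)
      = recScale q c₁ L₁ L₂ i * (1 - (q ^ 2) ^ ((m : ℤ) - L₂)) * psiPrefactor q c₂ L₁ L₂ i m
        * dualQKrawtchouk (q ^ 2) (-c₁⁻¹ * c₂ * q ^ (2 * (L₁ : ℤ) - 2 * i + 1)) L₂ (m + 1) x := by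
    split_ifs with h
    · rw [hpsi, ← mul_assoc, triC_mul_psiPrefactor hq hc₂ h]
    · obtain rfl : m = L₂ := by omega
      simp
  rw [hA, hC, hpsi]
  generalize dualQKrawtchouk (q ^ 2) (-c₁⁻¹ * c₂ * q ^ (2 * (L₁ : ℤ) - 2 * i + 1)) L₂ m x = k at *
  generalize dualQKrawtchouk (q ^ 2) (-c₁⁻¹ * c₂ * q ^ (2 * (L₁ : ℤ) - 2 * i + 1)) L₂ (m - 1) x
    = k' at *
  generalize dualQKrawtchouk (q ^ 2) (-c₁⁻¹ * c₂ * q ^ (2 * (L₁ : ℤ) - 2 * i + 1)) L₂ (m + 1) x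
    = k'' at *
  linear_combination (psiPrefactor q c₂ L₁ L₂ i m * k) * hB
    - (recScale q c₁ L₁ L₂ i * psiPrefactor q c₂ L₁ L₂ i m) * hrec

theorem psiCoef_zero (q c₁ c₂ : ℂ) (L₁ L₂ i x : ℕ) : psiCoef q c₁ c₂ L₁ L₂ i x 0 = 1 := by
  simp [psiCoef, dualQKrawtchouk, qShifted]

/-- With a = q^(2(x+i)) and b = q^(2(y+i)), equality of eigenvalues factors as (a - b)(c₂κ²qab + c₁)
= 0. As a ≠ b, the ratio c₂/c₁ would be -κ⁻²q⁻¹a⁻¹b⁻¹, an excluded value. -/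
theorem eta₁_ne {q c₁ c₂ : ℂ} (hq : IsGenericQ q) (hc₁ : c₁ ≠ 0) {L₁ L₂ i : ℕ} (hi : i ≤ L₁)
    (hc : ∀ k : ℕ, c₂ * c₁⁻¹ ≠ -q ^ (2 * (L₁ : ℤ) + 2 * L₂ + 1 - k)) {x y : ℕ} (hxy : x ≠ y) :
    eta₁ q c₁ c₂ (q ^ ((L₁ : ℤ) - 3 * i - L₂)) (x + i)
      ≠ eta₁ q c₁ c₂ (q ^ ((L₁ : ℤ) - 3 * i - L₂)) (y + i) := by
  intro h
  obtain ⟨M, rfl⟩ := Nat.exists_eq_add_of_le hi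
  -- The k solving q^(2L₁+2L₂+1-k) = κ⁻²q⁻¹a⁻¹b⁻¹ is 4L₁ - 2i + 2 + 2x + 2y; writing L₁ = i + M
  -- shows that it is a natural number.
  refine hc (2 * (i + M) + 2 * M + 2 + 2 * x + 2 * y) ?_
  have h0 := hq.ne_zero
  have hne : q ^ (2 * (x + i)) - q ^ (2 * (y + i)) ≠ 0 := by
    intro h
    have h' : q ^ ((2 * (x + i) : ℕ) : ℤ) = q ^ ((2 * (y + i) : ℕ) : ℤ) := by
      rw [zpow_natCast, zpow_natCast]; exact sub_eq_zero.mp h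
    have := hq.zpow_injective h'
    omega
  have e1 : ∀ n : ℕ, q ^ (-2 * (n : ℤ) - 2) = (q ^ (2 * n))⁻¹ * (q ^ 2)⁻¹ := by
    intro n
    rw [← zpow_natCast, ← zpow_natCast q 2, ← zpow_neg, ← zpow_neg, ← zpow_add₀ h0]
    congr 1
  have e2 : q ^ (2 * ((i + M : ℕ) : ℤ) + 2 * L₂ + 1 - (2 * (i + M) + 2 * M + 2 + 2 * x + 2 * y : ℕ))
      = (q ^ (((i + M : ℕ) : ℤ) - 3 * i - L₂))⁻¹ * (q ^ (((i + M : ℕ) : ℤ) - 3 * i - L₂))⁻¹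
        * q⁻¹ * (q ^ (2 * (x + i)))⁻¹ * (q ^ (2 * (y + i)))⁻¹ := by
    rw [← zpow_natCast, ← zpow_natCast q (2 * (y + i)), ← zpow_neg, ← zpow_neg, ← zpow_neg,
      ← zpow_neg_one q, ← zpow_add₀ h0, ← zpow_add₀ h0, ← zpow_add₀ h0, ← zpow_add₀ h0]
    congr 1; push_cast; ring
  rw [e2]
  have hκ := zpow_ne_zero (((i + M : ℕ) : ℤ) - 3 * i - L₂) h0
  have ha := pow_ne_zero (2 * (x + i)) h0
  have hb := pow_ne_zero (2 * (y + i)) h0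
  rw [eta₁, eta₁, div_left_inj' hq.sub_inv_ne_zero, e1, e1] at h
  generalize q ^ (((i + M : ℕ) : ℤ) - 3 * i - L₂) = κ at *
  generalize q ^ (2 * (x + i)) = a at *
  generalize q ^ (2 * (y + i)) = b at *
  have h3 : (a - b) * (c₂ * κ ^ 2 * q * a * b + c₁) = 0 := by
    field_simp at h
    linear_combination -h
  have h4 := (mul_eq_zero.mp h3).resolve_left hne
  field_simp
  linear_combination h4

/-! ### Action of C₁ on the two families and the final statement -/

section main

open Uq

variable {q : ℂ} {V : Type*} [AddCommGroup V] [Module ℂ V] [Module (Uq q) V]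
  [IsScalarTower ℂ (Uq q) V]

theorem C₁_uVec [FiniteDimensional ℂ V] (hq : IsGenericQ q) (c₁ c₂ : ℂ) {L₁ L₂ : ℕ} {v : V}
    (hv : IsHighestWeightVector q L₁ L₂ v) (i n : ℕ) (hi : i ≤ L₁) (hn : n ≤ L₂) :
    C₁ q c₁ c₂ • uVec q c₁ L₁ L₂ v i n
      = ∑ m ∈ range (L₂ + 1), triMatrix q c₁ c₂ L₁ L₂ i m n • uVec q c₁ L₁ L₂ v i m := by
  have hB := B₁_uVec hq c₁ hv i n hi
  have hmem := (mem_kerB₁U.mp (uVec_mem_kerB₁U hq c₁ hv i n hi)).2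
  rw [← sub_eq_zero]
  -- The difference of the two sides is annihilated by B₁, so it is enough that its top row
  -- vanishes.
  refine eq_zero_of_mem_range_diagSum hq c₁ hv i hi ?_ ?_
  swap
  · rw [smul_sub, B₁_C₁_eq_zero hq c₁ c₂ hv i _ hmem hB, uq_smul_sum, zero_sub, neg_eq_zero]
    exact sum_eq_zero fun m _ => by rw [B₁_uVec hq c₁ hv i m hi, smul_zero]
  have hsum : ∑ m ∈ range (L₂ + 1), triMatrix q c₁ c₂ L₁ L₂ i m n • uVec q c₁ L₁ L₂ v i m
      - ∑ m ∈ range (L₂ + 1), triMatrix q c₁ c₂ L₁ L₂ i m n • mudrovVec q v (L₁ - i) m L₁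
      ∈ LinearMap.range (diagSum q L₂ v i (L₁ - i)) := by
    rw [← sum_sub_distrib]
    refine Submodule.sum_mem _ fun m hm => ?_
    rw [← smul_sub]
    exact Submodule.smul_mem _ _
      (uVec_sub_top_mem c₁ L₁ L₂ v i m hi (by have := mem_range.mp hm; omega))
  have hD := Submodule.smul_mem _ (triD q c₁ c₂ L₁ L₂ i) (uVec_sub_top_mem (q := q) c₁ L₁ L₂ v i n hi hn)
  rw [sum_triMatrix_smul _ _ _ _ _ _ _ hn (fun m => mudrovVec q v (L₁ - i) m L₁)] at hsum
  rw [C₁_smul_of_mem_range_diagSum hq c₁ c₂ hv i _ hmem, hB, smul_zero, smul_zero, sub_zero]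
  obtain ⟨M, rfl⟩ : ∃ M, L₁ = M + i := ⟨L₁ - i, by omega⟩
  have hBB := B₁_B₂_uVec hq c₁ c₂ i hv n hn
  rw [Nat.add_sub_cancel] at hsum hD ⊢
  have htot := Submodule.add_mem _ (Submodule.sub_mem _ hBB hsum) hD
  convert htot using 1
  have hM : ((M + i : ℕ) : ℤ) = M + i := by push_cast; rfl
  have tB := triB_eq hq c₁ c₂ (M + i) L₂ i n
  have tC := triC_eq hq c₁ c₂ (M + i) L₂ i n hn
  have tb := qNum_B_degenerate hq (M + i) L₂ n i hn (by omega)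
  have ts := qNum_succ_sub hq M
  rw [hM] at tB tC tb
  rw [show (M : ℤ) + i - i = M by ring] at tb
  rw [show (i : ℤ) - (M + i) - 1 = -M - 1 by ring, ← ts] at tB tC
  rw [show (L₂ : ℤ) + 2 * i - n - (M + i) = L₂ + i - n - M by ring] at tB tC
  rw [← add_assoc (L₂ : ℤ) M i] at tC tb
  have tB' : c₁ * q ^ ((n : ℤ) + i) * qNum q (L₂ + i - n) * (qNum q M - q⁻¹ * qNum q (M + 1))
          + c₂ * q ^ (-((L₂ : ℤ) + i - n - M)) * (-qNum q (n + i))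
      = triB q c₁ c₂ (M + i) L₂ i n := by rw [tB]; ring
  rw [tb, tB', ← tC]
  rcases Nat.lt_or_ge n L₂ with h | h
  · have tA := triA_eq hq (M + i) L₂ i n h
    rw [hM, show (M : ℤ) + i - i = M by ring, ← add_assoc (L₂ : ℤ) M i] at tA
    rw [if_pos h, ← tA]
    simp only [smul_eq_toEnd]
    module
  · obtain rfl : n = L₂ := by omega
    rw [if_neg (lt_irrefl _), mudrovVec_eq_zero_of_lt_left hq hv]
    simp only [smul_eq_toEnd, smul_zero]
    module

theorem psiVec_mem_kerB₁U [FiniteDimensional ℂ V] (hq : IsGenericQ q) (c₁ c₂ : ℂ) {L₁ L₂ : ℕ} {v : V}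
    (hv : IsHighestWeightVector q L₁ L₂ v) (i x : ℕ) (hi : i ≤ L₁) :
    psiVec q c₁ c₂ L₁ L₂ v i x ∈ kerB₁U q c₁ L₁ L₂ v i :=
  Submodule.sum_mem _ fun n _ => Submodule.smul_mem _ _ (uVec_mem_kerB₁U hq c₁ hv i n hi)

theorem psiVec_ne_zero (hq : IsGenericQ q) (c₁ c₂ : ℂ) {L₁ L₂ : ℕ} {v : V}
    (hv : IsHighestWeightVector q L₁ L₂ v) (i x : ℕ) (hi : i ≤ L₁) :
    psiVec q c₁ c₂ L₁ L₂ v i x ≠ 0 := by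
  intro h
  rw [psiVec, sum_range] at h
  have := Fintype.linearIndependent_iff.mp (linearIndependent_uVec hq c₁ hv i hi)
    (fun l => psiCoef q c₁ c₂ L₁ L₂ i x l) h 0
  simp only [Fin.val_zero, psiCoef_zero] at this
  exact one_ne_zero this

theorem C₁_psiVec [FiniteDimensional ℂ V] (hq : IsGenericQ q) {c₁ c₂ : ℂ} (hc₁ : c₁ ≠ 0)
    (hc₂ : c₂ ≠ 0) {L₁ L₂ : ℕ} {v : V} (hv : IsHighestWeightVector q L₁ L₂ v) (i x : ℕ)
    (hi : i ≤ L₁) (hx : x ≤ L₂) : C₁ q c₁ c₂ • psiVec q c₁ c₂ L₁ L₂ v i x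
      = eta₁ q c₁ c₂ (q ^ ((L₁ : ℤ) - 3 * i - L₂)) (x + i) • psiVec q c₁ c₂ L₁ L₂ v i x := by
  have hle : ∀ {n}, n ∈ range (L₂ + 1) → n ≤ L₂ := fun h => by have := mem_range.mp h; omega
  rw [psiVec, uq_smul_sum, smul_sum]
  have h1 : ∀ n ∈ range (L₂ + 1), psiCoef q c₁ c₂ L₁ L₂ i x n • C₁ q c₁ c₂ • uVec q c₁ L₁ L₂ v i n
      = ∑ m ∈ range (L₂ + 1), (triMatrix q c₁ c₂ L₁ L₂ i m n * psiCoef q c₁ c₂ L₁ L₂ i x n)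
        • uVec q c₁ L₁ L₂ v i m := by
    intro n hn
    rw [C₁_uVec hq c₁ c₂ hv i n hi (hle hn), smul_sum]
    exact sum_congr rfl fun m _ => by rw [smul_smul, mul_comm]
  -- After exchanging the sums, the coefficient of u^i_m is row m of the matrix applied to the
  -- vector of coefficients of ψ^i_x.
  rw [sum_congr rfl h1, sum_comm]
  refine sum_congr rfl fun m hm => ?_
  rw [← sum_smul, sum_triMatrix_mul_psiCoef hq hc₁ hc₂ L₁ L₂ i x m hx (hle hm), mul_smul]

theorem linearIndependent_psiVec [FiniteDimensional ℂ V] (hq : IsGenericQ q) {c₁ c₂ : ℂ}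
    (hc₁ : c₁ ≠ 0) (hc₂ : c₂ ≠ 0) {L₁ L₂ : ℕ} {v : V} (hv : IsHighestWeightVector q L₁ L₂ v)
    (i : ℕ) (hi : i ≤ L₁)
    (hc : ∀ k : ℕ, c₂ * c₁⁻¹ ≠ -q ^ (2 * (L₁ : ℤ) + 2 * L₂ + 1 - k)) :
    LinearIndependent ℂ (fun x : Fin (L₂ + 1) => psiVec q c₁ c₂ L₁ L₂ v i x) :=
  Module.End.eigenvectors_linearIndependent' (toEnd (V := V) (C₁ q c₁ c₂))
    (fun x : Fin (L₂ + 1) => eta₁ q c₁ c₂ (q ^ ((L₁ : ℤ) - 3 * i - L₂)) (x + i))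
    (fun x y hxy => by
      by_contra hne
      exact eta₁_ne hq hc₁ hi hc (fun h => hne (Fin.ext h)) hxy)
    _
    (fun x => ⟨Module.End.mem_eigenspace_iff.mpr
      (C₁_psiVec hq hc₁ hc₂ hv i x hi (Nat.lt_succ_iff.mp x.2)), psiVec_ne_zero hq c₁ c₂ hv i x hi⟩)

end main

theorem proposition4p8 (q : ℝ) (hq0 : 0 < q) (hq1 : q < 1) (c₁ c₂ : ℂ) (hc₁ : c₁ ≠ 0)
    (hc₂ : c₂ ≠ 0) (L₁ L₂ : ℕ) {V : Type*} [AddCommGroup V] [Module ℂ V] [FiniteDimensional ℂ V]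
    [Module (Uq (q : ℂ)) V] [IsScalarTower ℂ (Uq (q : ℂ)) V] [IsSimpleModule (Uq (q : ℂ)) V]
    (v : V) (hv : IsHighestWeightVector (q : ℂ) L₁ L₂ v) (i : ℕ) (hi : i ≤ L₁) :
    -- the vectors `u^i_n`, `n = 0, …, L₂`, are a basis of `ker(B₁)|_{U_i}`
    (LinearIndependent ℂ (fun n : Fin (L₂ + 1) => uVec (q : ℂ) c₁ L₁ L₂ v i n) ∧
      Submodule.span ℂ (Set.range fun n : Fin (L₂ + 1) => uVec (q : ℂ) c₁ L₁ L₂ v i n)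
        = kerB₁U (q : ℂ) c₁ L₁ L₂ v i) ∧
    -- in which `C₁` acts tridiagonally
    (∀ n ≤ L₂, Uq.C₁ (q : ℂ) c₁ c₂ • uVec (q : ℂ) c₁ L₁ L₂ v i n
        = ∑ m ∈ range (L₂ + 1),
            triMatrix (q : ℂ) c₁ c₂ L₁ L₂ i m n • uVec (q : ℂ) c₁ L₁ L₂ v i m) ∧
    -- each `ψ^i_x` is an eigenvector of `C₁` in `ker(B₁)|_{U_i}` with eigenvalue `η₁`
    (∀ x ≤ L₂, psiVec (q : ℂ) c₁ c₂ L₁ L₂ v i x ∈ kerB₁U (q : ℂ) c₁ L₁ L₂ v i ∧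
        psiVec (q : ℂ) c₁ c₂ L₁ L₂ v i x ≠ 0 ∧
        Uq.C₁ (q : ℂ) c₁ c₂ • psiVec (q : ℂ) c₁ c₂ L₁ L₂ v i x
          = eta₁ (q : ℂ) c₁ c₂ ((q : ℂ) ^ ((L₁ : ℤ) - 3 * i - L₂)) (x + i)
            • psiVec (q : ℂ) c₁ c₂ L₁ L₂ v i x) ∧
    -- under the genericity condition on `c₁, c₂` they form a basis
    ((∀ k : ℕ, c₂ * c₁⁻¹ ≠ -(q : ℂ) ^ (2 * (L₁ : ℤ) + 2 * L₂ + 1 - k)) →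
      LinearIndependent ℂ (fun x : Fin (L₂ + 1) => psiVec (q : ℂ) c₁ c₂ L₁ L₂ v i x) ∧
      Submodule.span ℂ (Set.range fun x : Fin (L₂ + 1) => psiVec (q : ℂ) c₁ c₂ L₁ L₂ v i x)
        = kerB₁U (q : ℂ) c₁ L₁ L₂ v i) := by
  have hq := isGenericQ_ofReal hq0 hq1
  have hu := linearIndependent_uVec hq c₁ hv i hi
  have hs := span_uVec hq c₁ hv i hi
  refine ⟨⟨hu, hs⟩, fun n hn => C₁_uVec hq c₁ c₂ hv i n hi hn, fun x hx =>
    ⟨psiVec_mem_kerB₁U hq c₁ c₂ hv i x hi, psiVec_ne_zero hq c₁ c₂ hv i x hi,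
      C₁_psiVec hq hc₁ hc₂ hv i x hi hx⟩, fun hc => ?_⟩
  have hpsi := linearIndependent_psiVec hq hc₁ hc₂ hv i hi hc
  refine ⟨hpsi, Submodule.eq_of_le_of_finrank_eq ?_ ?_⟩
  · rw [Submodule.span_le]
    rintro _ ⟨x, rfl⟩
    exact psiVec_mem_kerB₁U hq c₁ c₂ hv i x hi
  · rw [finrank_span_eq_card hpsi, ← hs, finrank_span_eq_card hu]
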